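/- Let $d\ge2$ be an integer and $n>d$ a real number. For $x\in\mathbb R^d\setminus\{0\}$ write $r=|x|$, $\omega=x/r$, $'=\partial_r=\omega\cdot\nabla$, let $\nabla_\omega$ and $\Delta_\omega$ be the gradient and the Laplace–Beltrami operator of the unit sphere $\mathbb S^{d-1}$ acting on $w(r\,\cdot)$, let $d\omega$ be the surface measure of $\mathbb S^{d-1}$, and set $d\mu_n=|x|^{n-d}dx=r^{n-1}dr\,d\omega$ and $\alpha_{\rm FS}=\sqrt{(d-1)/(n-1)}$. For $\alpha>0$ let $$\mathsf D_\alpha w=\nabla w+(\alpha-1)\,\omega\,\partial_rw,\qquad \mathsf D_\alpha^*\mathsf F=-|x|^{d-n}\,\nabla\cdot(|x|^{n-d}\mathsf F)-(\alpha-1)\,r^{1-n}\,\omega\cdot\partial_r(r^{n-1}\mathsf F),\qquad \mathsf L_\alpha=-\mathsf D_\alpha^*\mathsf D_\alpha,$$ $$\mathsf K[\mathsf F]=\tfrac12\,\mathsf L_\alpha(|\mathsf F|^2)+\mathsf F\cdot\mathsf D_\alpha(\mathsf D_\alpha^*\mathsf F)-\tfrac1n(\mathsf D_\alpha^*\mathsf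 F)^2,$$ $$\mathsf k[\mathsf p]=\tfrac12\,\Delta_\omega|\nabla_\omega\mathsf p|^2-\nabla_\omega\mathsf p\cdot\nabla_\omega(\Delta_\omega\mathsf p)-\tfrac1{n-1}(\Delta_\omega\mathsf p)^2-(n-2)\,\alpha^2|\nabla_\omega\mathsf p|^2.$$ For $\sigma>0$ let $$g_\star^{\alpha,\sigma}(x)=\Big(\frac{2\sigma}{\alpha^2}\Big)^{n/4}c_{n,d}\,e^{-\sigma|x|^2/(2\alpha^2)},\qquad c_{n,d}=\Big(\frac{\Gamma(d/2)}{2^{n/2}\,\pi^{d/2}\,\Gamma(n/2)}\Big)^{1/2}.$$ For a positive function $u$ on $\mathbb R^d\setminus\{0\}$ let $\mathsf p=\log u-2\log g_\star^{\alpha,\sigma}$ (that is, $\log u+\sigma|x|^2/\alpha^2$ up to an additive constant) and $\mathsf F=\mathsf D_\alpha\mathsf p=\mathsf D_\alpha\log u+\frac{2\sigma}\alpha\,x$. (i) For every $\alpha>0$ and every $\mathsf p\in C^3(\mathbb R^d\setminus\{0\})$, at every $x\ne0$, $$\mathsf K[\mathsf D_\alpha\mathsf p]=\alpha^4\Big(1-\frac1n\Big)\Big|\mathsf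 p''-\frac{\mathsf p'}r-\frac{\Delta_\omega\mathsf p}{\alpha^2(n-1)r^2}\Big|^2+\frac{2\alpha^2}{r^2}\Big|\nabla_\omega\mathsf p'-\frac{\nabla_\omega\mathsf p}r\Big|^2+\frac{\mathsf k[\mathsf p]}{r^4}.$$ (ii) There is $\delta>0$, depending only on $n$ and $d$, such that for all $\alpha,\sigma>0$, every positive $u\in C^3(\mathbb R^d\setminus\{0\})$ with $\mathsf p=\log u-2\log g_\star^{\alpha,\sigma}$, and every $r>0$, all functions being evaluated at $r\omega$, $$\int_{\mathbb S^{d-1}}\mathsf k[\mathsf p]\,u\,d\omega\ \ge\ (n-2)(\alpha_{\rm FS}^2-\alpha^2)\int_{\mathbb S^{d-1}}|\nabla_\omega\mathsf p|^2u\,d\omega+\delta\int_{\mathbb S^{d-1}}|\nabla_\omega\mathsf p|^4\,u\,d\omega .$$ Now let $0<\alpha\le\alpha_{\rm FS}$ and let $\sigma=\alpha/2$ (so that $\mathsf F=\mathsf D_\alpha\log u+x$) or $\sigma=1/2$ (so that $\mathsf p=\log u-2\log g_\star^{\alpha,1/2}$). Let $I\subset\mathbb R$ be open and let $u>0$, of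 class $C^3$ on $I\times(\mathbb R^d\setminus\{0\})$, solve there the Fokker–Planck equation $$\partial_tu=-\,\mathsf D_\alpha^*(u\,\mathsf F),\qquad \mathsf F=\mathsf D_\alpha\mathsf p .$$ Assume that, for every compact $J\subset I$: for each $m\in\mathbb N$, $|x|^m\,u(t,x)$ is bounded on $J\times(\mathbb R^d\setminus\{0\})$; and there are $C,N$ such that $|x|^{j}\,|\nabla_x^{j+1}\log u(t,x)|\le C(1+|x|)^N$ for $j=0,1,2$, $t\in J$, $x\neq0$. Then for every $t\in I$: (iii) the functions $u\,|\mathsf F|^2$, $u\,x\cdot\mathsf D_\alpha(|\mathsf F|^2)$ and $u\,\mathsf F\cdot\mathsf D_\alpha(\mathsf F\cdot x)$ are $\mu_n$-integrable and $$\int_{\mathbb R^d} u\,x\cdot\mathsf D_\alpha(|\mathsf F|^2)\,d\mu_n-2\int_{\mathbb R^d} u\,\mathsf F\cdot\mathsf D_\alpha(\mathsf F\cdot x)\,d\mu_n=-2\alpha\int_{\mathbb R^d} u\,|\mathsf F|^2\,d\mu_n;$$ (iv) the Fisher information $\int_{\mathbb R^d} u\,|\mathsf F|^2\,d\mu_n$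 is differentiable in $t$ and $$\frac{d}{dt}\int_{\mathbb R^d} u\,|\mathsf F|^2\,d\mu_n\le-2\alpha\int_{\mathbb R^d} u\,|\mathsf F|^2\,d\mu_n .$$ -/

import Mathlib

open MeasureTheory Set

open scoped RealInnerProductSpace

noncomputable section

namespace WLS

/-- The Euclidean space of dimension `d`. -/
abbrev E (d : ℕ) : Type := EuclideanSpace ℝ (Fin d)

/-- The Felli-Schneider value of the parameter. -/
def alphaFS (d : ℕ) (n : ℝ) : ℝ := Real.sqrt (((d : ℝ) - 1) / (n - 1))

/-- The measure `r ^ (n - 1) dr dω = |x| ^ (n - d) dx`. -/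
def mu (d : ℕ) (n : ℝ) : Measure (E d) :=
  volume.withDensity fun x => ENNReal.ofReal (‖x‖ ^ (n - (d : ℝ)))

/-- The surface measure of the unit sphere. -/
def dω (d : ℕ) : Measure (Metric.sphere (0 : E d) 1) := (volume : Measure (E d)).toSphere

/-- The direction `ω = x / |x|`. -/
def dir {d : ℕ} (x : E d) : E d := ‖x‖⁻¹ • x

/-- The radial derivative `∂_r = ω · ∇` of a scalar- or vector-valued function. -/
def radial {d : ℕ} {V : Type*} [NormedAddCommGroup V] [NormedSpace ℝ V] (w : E d → V)
    (x : E d) : V :=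
  fderiv ℝ w x (dir x)

/-- The angular gradient: at `x = r ω`, the gradient at `ω` of the function `w (r ·)` on the
unit sphere, computed from its extension to the punctured space that is constant along rays. -/
def angGrad {d : ℕ} (w : E d → ℝ) (x : E d) : E d :=
  gradient (fun y => w (‖x‖ • dir y)) (dir x)

/-- The Laplace-Beltrami operator: at `x = r ω`, the value at `ω` of the Laplacian on the unit
sphere of `w (r ·)`, computed from its extension that is constant along rays. -/
def angLap {d : ℕ} (w : E d → ℝ) (x : E d) : ℝ :=
  Laplacian.laplacian (fun y => w (‖x‖ • dir y)) (dir x)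

/-- The anisotropic gradient `D_α = ∇ + (α - 1) ω ∂_r`. -/
def Da {d : ℕ} (α : ℝ) (w : E d → ℝ) (x : E d) : E d :=
  gradient w x + ((α - 1) * radial w x) • dir x

/-- The divergence of a vector field. -/
def divg {d : ℕ} (F : E d → E d) (x : E d) : ℝ :=
  ∑ i, fderiv ℝ F x (EuclideanSpace.single i 1) i

/-- The adjoint of `D_α` with respect to `|x| ^ (n - d) dx`:
`D_α^* F = - |x|^(d-n) ∇·(|x|^(n-d) F) - (α - 1) r^(1-n) ω·∂_r (r^(n-1) F)`. -/
def DaStar {d : ℕ} (n α : ℝ) (F : E d → E d) (x : E d) : ℝ :=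
  -(‖x‖ ^ ((d : ℝ) - n) * divg (fun y => ‖y‖ ^ (n - (d : ℝ)) • F y) x)
    - (α - 1) * ‖x‖ ^ (1 - n) * ⟪dir x, radial (fun y => ‖y‖ ^ (n - 1) • F y) x⟫

/-- The operator `L_α = - D_α^* D_α`. -/
def La {d : ℕ} (n α : ℝ) (w : E d → ℝ) (x : E d) : ℝ := -DaStar n α (Da α w) x

/-- `K[F] = (1/2) L_α |F|² + F · D_α (D_α^* F) - (1/n) (D_α^* F)²`. -/
def K {d : ℕ} (n α : ℝ) (F : E d → E d) (x : E d) : ℝ :=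
  1 / 2 * La n α (fun y => ‖F y‖ ^ 2) x + ⟪F x, Da α (DaStar n α F) x⟫
    - 1 / n * DaStar n α F x ^ 2

/-- `k[p] = (1/2) Δ_ω |∇_ω p|² - ∇_ω p · ∇_ω (Δ_ω p) - (Δ_ω p)² / (n - 1)
- (n - 2) α² |∇_ω p|²`. -/
def kSph {d : ℕ} (n α : ℝ) (p : E d → ℝ) (x : E d) : ℝ :=
  1 / 2 * angLap (fun y => ‖angGrad p y‖ ^ 2) x - ⟪angGrad p x, angGrad (angLap p) x⟫
    - 1 / (n - 1) * angLap p x ^ 2 - (n - 2) * α ^ 2 * ‖angGrad p x‖ ^ 2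

/-- The normalization constant of the Gaussian function. -/
def gaussConst (d : ℕ) (n : ℝ) : ℝ :=
  Real.sqrt (Real.Gamma ((d : ℝ) / 2) /
    ((2 : ℝ) ^ (n / 2) * Real.pi ^ ((d : ℝ) / 2) * Real.Gamma (n / 2)))

/-- The Gaussian function `c_{n,d} exp (- |x|² / 4)`. -/
def gStar {d : ℕ} (n : ℝ) (x : E d) : ℝ := gaussConst d n * Real.exp (-(1 / 4) * ‖x‖ ^ 2)

/-- The rescaled Gaussian function `(2 σ α⁻²)^(n/4) g_⋆ (√(2 σ) x / α)`. -/
def gStarScaled {d : ℕ} (n α σ : ℝ) (x : E d) : ℝ :=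
  (2 * σ * (α ^ 2)⁻¹) ^ (n / 4) * gStar n ((Real.sqrt (2 * σ) / α) • x)

/-- The relative pressure `log u - 2 log g_⋆^{α,σ}`, which is
`log u + σ |x|² / α²` up to an additive constant. -/
def pressure {d : ℕ} (n α σ : ℝ) (u : E d → ℝ) (x : E d) : ℝ :=
  Real.log (u x) - 2 * Real.log (gStarScaled n α σ x)

/-- The flux `F = D_α p`, which is `D_α log u + (2 σ / α) x`. -/
def flux {d : ℕ} (n α σ : ℝ) (u : E d → ℝ) : E d → E d := Da α (pressure n α σ u)

/-- The Fisher information `∫ u |F|² dμ_n`. -/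
def fisher {d : ℕ} (n α σ : ℝ) (u : E d → ℝ) : ℝ :=
  ∫ x, u x * ‖flux n α σ u x‖ ^ 2 ∂(mu d n)

/-- Positive classical solutions, on a set `I` of times, of the Fokker-Planck equation
`∂_t u = - D_α^* (u F)`, `F = D_α (log u - 2 log g_⋆^{α,σ})`, on the punctured space,
which locally uniformly in time decay at infinity faster than any power of `|x|` and
whose logarithm has `x`-derivatives of order `j + 1 ≤ 3` that grow at most polynomially at
infinity and are `O(|x| ^ (-j))` at the origin.  If `α ≤ alphaFS d n`, the positive
solutions `(g_⋆^{α,σ})² v` with `v` a finite combination of eigenfunctions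
`r ^ s L(r²) Y(ω)` (generalized Hermite functions) are of this type, since `s = 0` or `1 ≤ s`. -/
structure IsRegularSolution {d : ℕ} (n α σ : ℝ) (I : Set ℝ) (u : ℝ → E d → ℝ) : Prop where
  smooth : ContDiffOn ℝ 3 (fun z : ℝ × E d => u z.1 z.2) (I ×ˢ {0}ᶜ)
  pos : ∀ t ∈ I, ∀ x : E d, x ≠ 0 → 0 < u t x
  equation : ∀ t ∈ I, ∀ x : E d, x ≠ 0 →
    HasDerivAt (fun s => u s x)
      (-DaStar n α (fun y => u t y • flux n α σ (u t) y) x) t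
  decay : ∀ J ⊆ I, IsCompact J → ∀ m : ℕ, ∃ C : ℝ, ∀ t ∈ J, ∀ x : E d, x ≠ 0 →
    ‖x‖ ^ m * u t x ≤ C
  growth : ∀ J ⊆ I, IsCompact J → ∃ (C : ℝ) (N : ℕ), ∀ t ∈ J, ∀ x : E d, x ≠ 0 →
    ∀ j < 3, ‖x‖ ^ j * ‖iteratedFDeriv ℝ (j + 1) (fun y => Real.log (u t y)) x‖
      ≤ C * (1 + ‖x‖) ^ N

end WLS

end

/-! The sphere is handled through the rotation fields `rotF i j`, defined on the whole punctured
space. Half the sum of the squares of these derivations is the Laplace–Beltrami operator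
(`angLap_eq`), and the associated bilinear form `Γ`, written `Gam`, is the product of angular
gradients (`inner_angGrad`). The rotation fields commute with `∂_r` and annihilate radial functions.
Hence `|D_α p|² = α² p'² + Γ(p,p)/r²` and `L_α w = α² (w'' + (n-1) w'/r) + Δ_ω w/r²` can be
differentiated by pure algebra, and (i) is the outcome of that expansion (`K_Da`).

For (ii), the Gaussian is radial, so `p` and `log u` have the same angular derivatives, and `u` can
serve as the weight in integrations by parts on spheres. If `d ≥ 3`, the trace inequality for `Hess
p + t ∇p ⊗ ∇p` on the sphere, together with its Ricci curvature `d - 2`, gives a one-parameter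
family of curvature-dimension inequalities (`curvature_dimension`). Integrated against `u`, every
second-order term reduces to the integrals of `(Δ_ω p)² u`, `Γ Δ_ω p u` and `Γ² u`. A suitable `t`
and a suitable multiple of the inequality match the first two coefficients and leave a positive
multiple of the third, because `n > d`. The circle has no curvature; there Wirtinger's inequality
for the derivative of `√u` takes over.

For (iii), `F · x = α r p'` makes the identity hold pointwise (`drift_identity`), so only
integrability is at stake.

For (iv), `∂_t log u = |F|² - (2σ/α) F · x - D_α^* F`, and integrations by parts yield
(`integral_rate`) that the Fisher information has derivative `-2 ∫ u K[F] - (2/n) ∫ u (D_α^* F)² -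
4σ ∫ u |F|²`. By (i), `K[F] ≥ k[p]/r⁴`; by (ii), the spherical integrals of `k[p] u` are nonnegative
when `α ≤ α_FS`; and `4σ ≥ 2α`. The analysis rests on symbol classes `SB` that count powers of
`1/r`: all the integrands are at worst of order `r^(-2)` at the origin, which is integrable since `n
> 2`, and logarithmic cutoffs remove the boundary terms. -/

noncomputable section

namespace WLS

/-! ### Derivations along coordinate, radial and rotation fields. -/

variable {d : ℕ} {V : Type*} [NormedAddCommGroup V] [NormedSpace ℝ V]

/-- `f` is of class `C^k` on the punctured space. -/
def SP (k : ℕ) (f : E d → V) : Prop := ∀ x, x ≠ 0 → ContDiffAt ℝ k f x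

/-- The derivation along a vector field. -/
def X (v : E d → E d) (f : E d → ℝ) (x : E d) : ℝ := fderiv ℝ f x (v x)

/-- The coordinate vector fields. -/
def cst (i : Fin d) : E d → E d := fun _ => EuclideanSpace.single i 1

/-- The rotation vector fields. -/
def rotF (i j : Fin d) (x : E d) : E d :=
  x i • EuclideanSpace.single j 1 - x j • EuclideanSpace.single i 1

notation "pd[" i "]" => X (cst i)

notation "rot[" i "," j "]" => X (rotF i j)

/-- The function `1 / r`. -/
def rho (x : E d) : ℝ := ‖x‖⁻¹

section smoothness

variable {k : ℕ} {f g : E d → ℝ} {F G : E d → V}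

lemma nhds_punct {x : E d} (hx : x ≠ 0) : ({0}ᶜ : Set (E d)) ∈ nhds x :=
  isOpen_compl_singleton.mem_nhds hx

lemma sp_iff {k : ℕ} {F : E d → V} : SP k F ↔ ContDiffOn ℝ k F {0}ᶜ :=
  ⟨fun h x hx => (h x hx).contDiffWithinAt, fun h _ hx => h.contDiffAt (nhds_punct hx)⟩

lemma SP.mono {l : ℕ} (h : SP k F) (hl : l ≤ k) : SP l F := fun x hx =>
  (h x hx).of_le (by exact_mod_cast hl)

lemma SP.congr (h : SP k F) (hFG : ∀ x, x ≠ 0 → G x = F x) : SP k G := fun x hx =>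
  (h x hx).congr_of_eventuallyEq (Filter.eventuallyEq_of_mem (nhds_punct hx) hFG)

lemma SP.add (hf : SP k F) (hg : SP k G) : SP k (fun x => F x + G x) :=
  fun x hx => (hf x hx).add (hg x hx)

lemma SP.sub (hf : SP k F) (hg : SP k G) : SP k (fun x => F x - G x) :=
  fun x hx => (hf x hx).sub (hg x hx)

lemma SP.neg (hf : SP k F) : SP k (fun x => -F x) :=
  fun x hx => (hf x hx).neg

lemma SP.mul (hf : SP k f) (hg : SP k g) : SP k (fun x => f x * g x) :=
  fun x hx => (hf x hx).mul (hg x hx)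

lemma SP.smul (hf : SP k f) (hg : SP k G) : SP k (fun x => f x • G x) :=
  fun x hx => (hf x hx).smul (hg x hx)

lemma SP.pow (hf : SP k f) (m : ℕ) : SP k (fun x => f x ^ m) :=
  fun x hx => (hf x hx).pow m

lemma SP.const (c : V) : SP k (fun _ : E d => c) := fun _ _ => contDiffAt_const

lemma SP.sum {ι : Type*} {s : Finset ι} {F : ι → E d → V} (h : ∀ i ∈ s, SP k (F i)) :
    SP k (fun x => ∑ i ∈ s, F i x) :=
  fun x hx => ContDiffAt.sum fun i hi => h i hi x hx

lemma SP.coord (i : Fin d) : SP k (fun x : E d => x i) := fun x _ => by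
  have : ContDiff ℝ k (fun x : E d => x i) := by fun_prop
  exact this.contDiffAt

lemma SP.vec {F : E d → E d} (h : ∀ i, SP k (fun x => F x i)) : SP k F := fun x hx => by
  rw [contDiffAt_euclidean]
  exact fun i => h i x hx

lemma SP.comp_vec {F : E d → E d} (h : SP k F) (i : Fin d) : SP k (fun x => F x i) :=
  fun x hx => contDiffAt_euclidean.1 (h x hx) i

lemma SP.inner {F G : E d → E d} (hF : SP k F) (hG : SP k G) : SP k (fun x => ⟪F x, G x⟫) :=
  fun x hx => (hF x hx).inner ℝ (hG x hx)

lemma SP.norm : SP k (fun x : E d => ‖x‖) := fun _ hx => contDiffAt_norm ℝ hx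

lemma SP.rho : SP k (rho : E d → ℝ) := fun _ hx =>
  (contDiffAt_norm ℝ hx).inv (norm_ne_zero_iff.2 hx)

lemma SP.norm_rpow (s : ℝ) : SP k (fun x : E d => ‖x‖ ^ s) := fun _ hx =>
  (contDiffAt_norm ℝ hx).rpow_const_of_ne (norm_ne_zero_iff.2 hx)

lemma SP.id : SP k (fun x : E d => x) := fun _ _ => contDiffAt_id

lemma SP.dir : SP k (dir : E d → E d) := SP.rho.smul SP.id

lemma SP.cst (i : Fin d) : SP k (cst i) := SP.const _

lemma contDiff_rotF (i j : Fin d) : ContDiff ℝ k (rotF i j : E d → E d) := by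
  unfold rotF; fun_prop

lemma SP.rotF (i j : Fin d) : SP k (rotF i j : E d → E d) :=
  fun _ _ => (contDiff_rotF i j).contDiffAt

lemma SP.X {v : E d → E d} (hf : SP (k + 1) f) (hv : SP k v) : SP k (X v f) := fun x hx =>
  ((hf x hx).fderiv_right (m := k) (by norm_cast)).clm_apply (hv x hx)

lemma SP.pd (hf : SP (k + 1) f) (i : Fin d) : SP k (pd[i] f) := SP.X hf (SP.cst i)

lemma SP.rot (hf : SP (k + 1) f) (i j : Fin d) : SP k (rot[i, j] f) := SP.X hf (SP.rotF i j)

lemma SP.radial (hf : SP (k + 1) f) : SP k (radial f) := SP.X hf SP.dir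

lemma SP.diff (hf : SP (k + 1) F) {x : E d} (hx : x ≠ 0) : DifferentiableAt ℝ F x :=
  (hf x hx).differentiableAt (by simp)

lemma SP.log (hf : SP k f) (h : ∀ x, x ≠ 0 → f x ≠ 0) : SP k (fun x => Real.log (f x)) :=
  fun x hx => (hf x hx).log (h x hx)

lemma SP.exp (hf : SP k f) : SP k (fun x => Real.exp (f x)) :=
  fun x hx => (hf x hx).exp

end smoothness

section derivations

variable {f g : E d → ℝ} {v w : E d → E d} {x : E d}

lemma fderiv_congr {F G : E d → V} (h : ∀ y, y ≠ 0 → F y = G y) (hx : x ≠ 0) :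
    fderiv ℝ F x = fderiv ℝ G x :=
  Filter.EventuallyEq.fderiv_eq (Filter.eventuallyEq_of_mem (nhds_punct hx) h)

lemma X_congr (h : ∀ y, y ≠ 0 → f y = g y) (hx : x ≠ 0) : X v f x = X v g x := by
  rw [X, X, fderiv_congr h hx]

lemma X_add (hf : SP 1 f) (hg : SP 1 g) (hx : x ≠ 0) :
    X v (fun y => f y + g y) x = X v f x + X v g x := by
  simp only [X]; rw [fderiv_fun_add (hf.diff hx) (hg.diff hx)]; rfl

lemma X_sub (hf : SP 1 f) (hg : SP 1 g) (hx : x ≠ 0) :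
    X v (fun y => f y - g y) x = X v f x - X v g x := by
  simp only [X]; rw [fderiv_fun_sub (hf.diff hx) (hg.diff hx)]; rfl

lemma X_mul (hf : SP 1 f) (hg : SP 1 g) (hx : x ≠ 0) :
    X v (fun y => f y * g y) x = f x * X v g x + g x * X v f x := by
  simp only [X]; rw [fderiv_fun_mul (hf.diff hx) (hg.diff hx)]; rfl

lemma X_const_mul (c : ℝ) (hf : SP 1 f) (hx : x ≠ 0) :
    X v (fun y => c * f y) x = c * X v f x := by
  simp only [X]; rw [fderiv_const_mul (hf.diff hx)]; rfl

lemma X_neg : X v (fun y => - f y) x = - X v f x := by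
  simp only [X]; rw [fderiv_fun_neg]; rfl

lemma X_const (c : ℝ) : X v (fun _ => c) x = 0 := by
  simp [X]

lemma X_sum {ι : Type*} {s : Finset ι} {f : ι → E d → ℝ} (hf : ∀ i ∈ s, SP 1 (f i)) (hx : x ≠ 0) :
    X v (fun y => ∑ i ∈ s, f i y) x = ∑ i ∈ s, X v (f i) x := by
  simp only [X]; rw [fderiv_fun_sum fun i hi => (hf i hi).diff hx]; simp

lemma X_exp (hf : SP 1 f) (hx : x ≠ 0) :
    X v (fun y => Real.exp (f y)) x = Real.exp (f x) * X v f x := by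
  simp only [X]; rw [fderiv_exp (hf.diff hx)]; rfl

lemma X_log (hf : SP 1 f) (h : f x ≠ 0) (hx : x ≠ 0) :
    X v (fun y => Real.log (f y)) x = (f x)⁻¹ * X v f x := by
  simp only [X]; rw [fderiv.log (hf.diff hx) h]; rfl

lemma X_comm (hf : SP 2 f) (hv : SP 1 v) (hw : SP 1 w) (hx : x ≠ 0) :
    X v (X w f) x - X w (X v f) x = fderiv ℝ f x (fderiv ℝ w x (v x) - fderiv ℝ v x (w x)) := by
  have := VectorField.fderiv_apply_lieBracket (𝕜 := ℝ) (f := f) (x := x) (V := v) (W := w)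
    (hf x hx) (by simp) (hw.diff hx) (hv.diff hx)
  rw [VectorField.lieBracket] at this
  exact this.symm

lemma hasFDerivAt_norm (hx : x ≠ 0) : HasFDerivAt (fun y : E d => ‖y‖) (‖x‖⁻¹ • innerSL ℝ x) x := by
  have h := (hasStrictFDerivAt_norm_sq x).hasFDerivAt.sqrt (by simpa using hx)
  simp only [Real.sqrt_sq (norm_nonneg _)] at h
  refine h.congr_fderiv ?_
  ext v
  simp
  ring

lemma hasFDerivAt_rho (hx : x ≠ 0) :
    HasFDerivAt (rho : E d → ℝ) (-(‖x‖⁻¹ ^ 3) • innerSL ℝ x) x := by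
  have h := (hasDerivAt_inv (norm_ne_zero_iff.2 hx)).comp_hasFDerivAt x (hasFDerivAt_norm hx)
  refine (h : HasFDerivAt (rho : E d → ℝ) _ x).congr_fderiv ?_
  ext v
  simp
  ring

lemma fderiv_dir (hx : x ≠ 0) (h : E d) :
    fderiv ℝ (dir : E d → E d) x h = ‖x‖⁻¹ • h - (‖x‖⁻¹ ^ 3 * ⟪x, h⟫) • x := by
  have h1 := (hasFDerivAt_rho hx).smul (hasFDerivAt_id x)
  have h2 : HasFDerivAt (dir : E d → E d) _ x := h1
  rw [h2.fderiv]
  simp [rho, sub_eq_add_neg]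

@[simp] lemma rotF_apply (i j k : Fin d) :
    rotF i j x k = x i * (if k = j then 1 else 0) - x j * (if k = i then 1 else 0) := by
  simp [rotF, PiLp.single_apply]

lemma inner_rotF (i j : Fin d) : ⟪x, rotF i j x⟫ = 0 := by
  simp only [rotF, inner_sub_right, inner_smul_right, EuclideanSpace.inner_single_right]
  simp; ring

lemma fderiv_rotF (i j : Fin d) (h : E d) : fderiv ℝ (rotF i j) x h = rotF i j h := by
  let L : E d →L[ℝ] E d := (EuclideanSpace.proj i : E d →L[ℝ] ℝ).smulRight (EuclideanSpace.single j 1)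
    - (EuclideanSpace.proj j : E d →L[ℝ] ℝ).smulRight (EuclideanSpace.single i 1)
  have : (rotF i j : E d → E d) = L := by ext y; simp [L, rotF]
  rw [this, L.fderiv]

lemma rotF_smul (i j : Fin d) (c : ℝ) : rotF i j (c • x) = c • rotF i j x := by
  simp [rotF, mul_smul, smul_sub]

lemma radial_eq_X : radial f = X dir f := rfl

lemma fderiv_dir_rotF (i j : Fin d) (hx : x ≠ 0) :
    fderiv ℝ (dir : E d → E d) x (rotF i j x) = rotF i j (dir x) := by
  rw [fderiv_dir hx, inner_rotF, dir, rotF_smul]; simp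

/-- The Lie bracket of `dir` and `rotF i j` vanishes, since a rotation field is linear and `dir` is
rotation equivariant. This commutation is what lets radial derivatives pass through all the
spherical operators. -/
lemma radial_rot (hf : SP 2 f) (i j : Fin d) (hx : x ≠ 0) :
    radial (rot[i, j] f) x = rot[i, j] (radial f) x := by
  have := X_comm hf SP.dir (SP.rotF i j) hx
  rw [fderiv_dir_rotF i j hx, fderiv_rotF, sub_self, map_zero] at this
  exact sub_eq_zero.1 this

lemma pd_comm (hf : SP 2 f) (i j : Fin d) (hx : x ≠ 0) :
    pd[i] (pd[j] f) x = pd[j] (pd[i] f) x := by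
  have := X_comm hf (SP.cst i) (SP.cst j) hx
  have h0 : ∀ k : Fin d, fderiv ℝ (cst k : E d → E d) x = 0 := fun k => fderiv_const_apply _
  simp only [h0, zero_apply, sub_self, map_zero] at this
  exact sub_eq_zero.1 this

lemma fderiv_eq_sum (f : E d → ℝ) (x h : E d) : fderiv ℝ f x h = ∑ i, h i * pd[i] f x := by
  have : h = ∑ i, h i • (EuclideanSpace.single i 1 : E d) := by
    ext k; simp [Finset.sum_apply, Pi.single_apply]
  conv_lhs => rw [this]
  simp [X, cst]

lemma X_eq_sum : X v f x = ∑ i, v x i * pd[i] f x := fderiv_eq_sum f x (v x)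

lemma rot_eq (i j : Fin d) : rot[i, j] f x = x i * pd[j] f x - x j * pd[i] f x := by
  simp [X, rotF, cst]

lemma radial_eq_sum : radial f x = rho x * ∑ i, x i * pd[i] f x := by
  rw [radial_eq_X, X_eq_sum, Finset.mul_sum]
  refine Finset.sum_congr rfl fun i _ => ?_
  simp [dir, rho]; ring

lemma pd_coord (i j : Fin d) : pd[i] (fun y : E d => y j) x = if i = j then 1 else 0 := by
  have : (fun y : E d => y j) = (EuclideanSpace.proj j : E d →L[ℝ] ℝ) := by ext; simp
  simp only [X, cst]
  rw [this, ContinuousLinearMap.fderiv]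
  simp [PiLp.single_apply, eq_comm]

lemma X_rho (hx : x ≠ 0) : X v rho x = -(rho x ^ 3 * ⟪x, v x⟫) := by
  simp [X, (hasFDerivAt_rho hx).fderiv, rho]

lemma radial_rho (hx : x ≠ 0) : radial rho x = -rho x ^ 2 := by
  have : ‖x‖ ≠ 0 := norm_ne_zero_iff.2 hx
  rw [radial_eq_X, X_rho hx]
  simp only [rho, dir, inner_smul_right, real_inner_self_eq_norm_sq]
  field_simp

lemma rot_rho (i j : Fin d) (hx : x ≠ 0) : rot[i, j] rho x = 0 := by
  rw [X_rho hx, inner_rotF]; simp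

lemma pd_rho (i : Fin d) (hx : x ≠ 0) : pd[i] rho x = -(x i * rho x ^ 3) := by
  rw [X_rho hx]; simp [cst, EuclideanSpace.inner_single_right]; ring

lemma X_norm_rpow (s : ℝ) (hx : x ≠ 0) :
    X v (fun y => ‖y‖ ^ s) x = s * ‖x‖ ^ (s - 2) * ⟪x, v x⟫ := by
  have h0 : 0 < ‖x‖ := norm_pos_iff.2 hx
  have h := (hasFDerivAt_norm hx).rpow_const (p := s) (Or.inl h0.ne')
  simp only [X]; rw [h.fderiv]
  have : ‖x‖ ^ (s - 2) = ‖x‖ ^ (s - 1) * ‖x‖⁻¹ := by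
    rw [← Real.rpow_neg_one, ← Real.rpow_add h0]; ring_nf
  simp [this]
  ring

lemma sum_coord_sq (x : E d) : ∑ i, x i * x i = ‖x‖ ^ 2 := by
  rw [EuclideanSpace.real_norm_sq_eq]; simp [pow_two]

lemma inner_eq_sum (x y : E d) : ⟪x, y⟫ = ∑ i, x i * y i := by
  simp [PiLp.inner_apply, mul_comm]

lemma gradient_apply (f : E d → ℝ) (x : E d) (i : Fin d) : gradient f x i = pd[i] f x := by
  have : ⟪gradient f x, EuclideanSpace.single i 1⟫ = fderiv ℝ f x (EuclideanSpace.single i 1) :=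
    inner_gradient_left
  rw [EuclideanSpace.inner_single_right] at this
  simpa [X, cst] using this

end derivations

/-! ### Spherical calculus by means of rotation fields. -/

/-- The carré du champ of the sphere. -/
def Gam (f g : E d → ℝ) (x : E d) : ℝ := 1 / 2 * ∑ i, ∑ j, rot[i, j] f x * rot[i, j] g x

/-- The Casimir operator of the rotation derivatives. -/
def Lap (f : E d → ℝ) (x : E d) : ℝ := 1 / 2 * ∑ i, ∑ j, rot[i, j] (rot[i, j] f) x

/-- The Euler operator `x · ∇`. -/
def eul (f : E d → ℝ) (x : E d) : ℝ := ∑ i, x i * pd[i] f x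

/-- The extension constant along rays of the restriction to the sphere of radius `r`. -/
def ext (r : ℝ) (f : E d → V) (y : E d) : V := f (r • dir y)

section
variable {f g : E d → ℝ} {x : E d}

lemma rho_mul_norm (hx : x ≠ 0) : rho x * ‖x‖ = 1 :=
  inv_mul_cancel₀ (norm_ne_zero_iff.2 hx)

lemma norm_dir (hx : x ≠ 0) : ‖dir x‖ = 1 := by
  rw [dir, norm_smul, norm_inv, norm_norm, inv_mul_cancel₀ (norm_ne_zero_iff.2 hx)]

lemma dir_ne_zero (hx : x ≠ 0) : dir x ≠ 0 := by
  rw [← norm_ne_zero_iff, norm_dir hx]; exact one_ne_zero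

lemma norm_smul_dir (hx : x ≠ 0) : ‖x‖ • dir x = x := by
  rw [dir, smul_smul, mul_inv_cancel₀ (norm_ne_zero_iff.2 hx), one_smul]

lemma dir_smul {c : ℝ} (hc : 0 < c) (x : E d) : dir (c • x) = dir x := by
  rw [dir, dir, norm_smul, smul_smul, Real.norm_of_nonneg hc.le, mul_inv, mul_comm c⁻¹, mul_assoc,
    inv_mul_cancel₀ hc.ne', mul_one]

lemma dir_dir (hx : x ≠ 0) : dir (dir x) = dir x := dir_smul (by positivity) x

lemma smul_dir_ne_zero {r : ℝ} (hr : 0 < r) (hx : x ≠ 0) : r • dir x ≠ 0 :=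
  smul_ne_zero hr.ne' (dir_ne_zero hx)

lemma radial_eq_eul : radial f x = rho x * eul f x := radial_eq_sum

/-- Polarized Lagrange identity. With `a = x` and `b`, `c` two gradients it turns `Gam` into `r²`
times the Euclidean product minus its radial part. -/
lemma sum_rot_sq {ι : Type*} [Fintype ι] (a b c : ι → ℝ) :
    ∑ i, ∑ j, (a i * b j - a j * b i) * (a i * c j - a j * c i) =
      2 * ((∑ i, a i * a i) * (∑ i, b i * c i) - (∑ i, a i * b i) * (∑ i, a i * c i)) := by
  have h : ∀ i j, (a i * b j - a j * b i) * (a i * c j - a j * c i) =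
      (a i * a i) * (b j * c j) - (a i * c i) * (a j * b j)
        - (a i * b i) * (a j * c j) + (b i * c i) * (a j * a j) := fun i j => by ring
  simp only [h, Finset.sum_add_distrib, Finset.sum_sub_distrib, ← Finset.mul_sum, ← Finset.sum_mul]
  ring

lemma Gam_eq : Gam f g x = ‖x‖ ^ 2 * (∑ i, pd[i] f x * pd[i] g x) - eul f x * eul g x := by
  simp only [Gam, rot_eq, eul]
  rw [sum_rot_sq, sum_coord_sq]; ring

lemma SP.eul {k : ℕ} (hf : SP (k + 1) f) : SP k (eul f) :=
  SP.sum fun i _ => (SP.coord i).mul (hf.pd i)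

lemma SP.Gam {k : ℕ} (hf : SP (k + 1) f) (hg : SP (k + 1) g) : SP k (Gam f g) :=
  (SP.const _).mul (SP.sum fun i _ => SP.sum fun j _ => (hf.rot i j).mul (hg.rot i j))

lemma SP.Lap {k : ℕ} (hf : SP (k + 2) f) : SP k (Lap f) :=
  (SP.const _).mul (SP.sum fun i _ => SP.sum fun j _ => SP.rot (SP.rot hf i j) i j)

lemma pd_eul (hf : SP 2 f) (hx : x ≠ 0) (i : Fin d) :
    pd[i] (eul f) x = pd[i] f x + ∑ j, x j * pd[i] (pd[j] f) x := by
  have h1 : ∀ j : Fin d, SP 1 (fun y : E d => y j * pd[j] f y) :=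
    fun j => (SP.coord j).mul (hf.pd j)
  calc pd[i] (eul f) x = ∑ j, pd[i] (fun y => y j * pd[j] f y) x := X_sum (fun j _ => h1 j) hx
    _ = _ := by
      simp only [X_mul (SP.coord _) (hf.pd _) hx, pd_coord, Finset.sum_add_distrib]
      simp [add_comm]

lemma eul_eul (hf : SP 2 f) (hx : x ≠ 0) :
    eul (eul f) x = eul f x + ∑ i, ∑ j, x i * x j * pd[i] (pd[j] f) x := by
  rw [eul]
  simp only [pd_eul hf hx, mul_add, Finset.sum_add_distrib, Finset.mul_sum, mul_assoc]
  rfl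

/-- The Casimir formula: the Euclidean Laplacian times `r²` splits into a rotational part and a
polynomial in the Euler operator. The first-order terms come from the derivatives that hit the
coefficients of `rotF`. -/
lemma Lap_eq (hf : SP 2 f) (hx : x ≠ 0) :
    Lap f x = ‖x‖ ^ 2 * (∑ i, pd[i] (pd[i] f) x) - eul (eul f) x - ((d : ℝ) - 2) * eul f x := by
  have key : ∀ i j k : Fin d, pd[k] (rot[i, j] f) x = (if k = i then 1 else 0) * pd[j] f x
      + x i * pd[k] (pd[j] f) x - ((if k = j then 1 else 0) * pd[i] f x
      + x j * pd[k] (pd[i] f) x) := fun i j k => by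
    have h1 : ∀ i j : Fin d, SP 1 (fun y : E d => y j * pd[i] f y) :=
      fun i j => (SP.coord j).mul (hf.pd i)
    rw [X_congr (g := fun y => y i * pd[j] f y - y j * pd[i] f y) (fun y _ => rot_eq i j) hx,
      X_sub (h1 _ _) (h1 _ _) hx, X_mul (SP.coord _) (hf.pd _) hx, X_mul (SP.coord _) (hf.pd _) hx,
      pd_coord, pd_coord]
    ring
  have h : ∀ i j : Fin d, rot[i, j] (rot[i, j] f) x =
      (if j = i then x i * pd[j] f x else 0) + (x i * x i) * pd[j] (pd[j] f) x - x i * pd[i] f x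
      - x i * x j * pd[i] (pd[j] f) x - x j * pd[j] f x - x i * x j * pd[i] (pd[j] f) x
      + (if j = i then x j * pd[i] f x else 0) + pd[i] (pd[i] f) x * (x j * x j) := fun i j => by
    rw [rot_eq, key, key, pd_comm hf j i hx]
    by_cases hij : j = i
    · simp [hij]; ring
    · simp [hij, Ne.symm hij]; ring
  rw [eul_eul hf hx]
  simp only [Lap, h, Finset.sum_add_distrib, Finset.sum_sub_distrib, Finset.sum_ite_eq',
    Finset.mem_univ, if_true, ← Finset.mul_sum, ← Finset.sum_mul, sum_coord_sq,
    Finset.sum_const, Finset.card_univ, Fintype.card_fin, nsmul_eq_mul]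
  have h3 : ∑ i, x i * ((d : ℝ) * pd[i] f x) = d * eul f x := by
    rw [eul, Finset.mul_sum]; exact Finset.sum_congr rfl fun i _ => by ring
  rw [h3]
  simp only [eul]
  ring

section congruence

lemma Gam_congr {f' g' : E d → ℝ} (h : ∀ y, y ≠ 0 → f y = f' y) (h' : ∀ y, y ≠ 0 → g y = g' y)
    (hx : x ≠ 0) : Gam f g x = Gam f' g' x := by
  simp only [Gam, X_congr h hx, X_congr h' hx]

lemma Lap_congr {f' : E d → ℝ} (h : ∀ y, y ≠ 0 → f y = f' y) (hx : x ≠ 0) :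
    Lap f x = Lap f' x := by
  simp only [Lap, X_congr (fun y hy => X_congr h hy) hx]

lemma radial_congr {F G : E d → V} (h : ∀ y, y ≠ 0 → F y = G y) (hx : x ≠ 0) :
    radial F x = radial G x := by
  rw [radial, radial, fderiv_congr h hx]

end congruence

section extension

variable {r : ℝ}

lemma SP.ext {k : ℕ} {F : E d → V} (hF : SP k F) (hr : 0 < r) : SP k (ext r F) := fun x hx =>
  ContDiffAt.comp x (hF _ (smul_dir_ne_zero hr hx)) ((SP.const r).smul SP.dir x hx)

lemma fderiv_ext {F : E d → V} (hx : x ≠ 0)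
    (hF : DifferentiableAt ℝ F (r • dir x)) (h : E d) :
    fderiv ℝ (ext r F) x h = fderiv ℝ F (r • dir x) (r • fderiv ℝ dir x h) := by
  have h1 : HasFDerivAt (fun y : E d => r • dir y) (r • fderiv ℝ dir x) x :=
    ((SP.diff (k := 0) SP.dir hx).hasFDerivAt).const_smul r
  have h2 := hF.hasFDerivAt.comp x h1
  have h3 : HasFDerivAt (ext r F) _ x := h2
  rw [h3.fderiv]; simp

/-- The map `y ↦ r • dir y` sends `rotF i j` to itself, so restricting to a sphere and extending
along rays loses no rotational information. This links `Gam` and `Lap` with the definitions through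
extensions constant along rays. -/
lemma rot_ext (hf : SP 1 f) (hr : 0 < r) (hx : x ≠ 0) (i j : Fin d) :
    rot[i, j] (ext r f) x = ext r (rot[i, j] f) x := by
  rw [X, fderiv_ext hx (hf.diff (smul_dir_ne_zero hr hx)), fderiv_dir_rotF i j hx, ← rotF_smul]
  rfl

lemma Gam_ext (hf : SP 1 f) (hg : SP 1 g) (hr : 0 < r) (hx : x ≠ 0) :
    Gam (ext r f) (ext r g) x = ext r (Gam f g) x := by
  simp only [Gam, rot_ext hf hr hx, rot_ext hg hr hx, ext]

lemma Lap_ext (hf : SP 2 f) (hr : 0 < r) (hx : x ≠ 0) :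
    Lap (ext r f) x = ext r (Lap f) x := by
  have h1 : ∀ i j : Fin d, rot[i, j] (rot[i, j] (ext r f)) x = ext r (rot[i, j] (rot[i, j] f)) x :=
    fun i j => by
      rw [X_congr (fun y hy => rot_ext (hf.mono (by norm_num)) hr hy i j) hx,
        rot_ext (hf.rot i j) hr hx]
  simp only [Lap, h1, ext]

lemma fderiv_dir_self (hx : x ≠ 0) : fderiv ℝ (dir : E d → E d) x x = 0 := by
  have : ‖x‖ ≠ 0 := norm_ne_zero_iff.2 hx
  rw [fderiv_dir hx, ← sub_smul, real_inner_self_eq_norm_sq]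
  field_simp
  simp

lemma eul_eq_fderiv : eul f x = fderiv ℝ f x x := (fderiv_eq_sum f x x).symm

lemma eul_ext (hf : SP 1 f) (hr : 0 < r) (hx : x ≠ 0) : eul (ext r f) x = 0 := by
  rw [eul_eq_fderiv, fderiv_ext hx (hf.diff (smul_dir_ne_zero hr hx)), fderiv_dir_self hx]
  simp

end extension

lemma angGrad_eq_gradient_ext : angGrad f x = gradient (ext ‖x‖ f) (dir x) := rfl

lemma angLap_eq_laplacian_ext : angLap f x = Laplacian.laplacian (ext ‖x‖ f) (dir x) := rfl

lemma inner_gradient_gradient : ⟪gradient f x, gradient g x⟫ = ∑ i, pd[i] f x * pd[i] g x := by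
  simp only [inner_eq_sum, gradient_apply]

/-- The extension along rays has zero Euler derivative, so at a unit vector its `Gam` is just the
product of Euclidean gradients. -/
lemma inner_angGrad (hf : SP 1 f) (hg : SP 1 g) (hx : x ≠ 0) :
    ⟪angGrad f x, angGrad g x⟫ = Gam f g x := by
  have hr := norm_pos_iff.2 hx
  have h := Gam_ext hf hg hr (dir_ne_zero hx)
  rw [ext, dir_dir hx, norm_smul_dir hx, Gam_eq, eul_ext hf hr (dir_ne_zero hx), norm_dir hx] at h
  rw [angGrad_eq_gradient_ext, angGrad_eq_gradient_ext, inner_gradient_gradient, ← h]; ring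

lemma norm_angGrad_sq (hf : SP 1 f) (hx : x ≠ 0) : ‖angGrad f x‖ ^ 2 = Gam f f x := by
  rw [← inner_angGrad hf hf hx, real_inner_self_eq_norm_sq]

lemma laplacian_eq_sum (hf : SP 2 f) (hx : x ≠ 0) :
    Laplacian.laplacian f x = ∑ i, pd[i] (pd[i] f) x := by
  rw [InnerProductSpace.laplacian_eq_iteratedFDeriv_orthonormalBasis f
    (EuclideanSpace.basisFun (Fin d) ℝ)]
  refine Finset.sum_congr rfl fun i _ => ?_
  have hd : DifferentiableAt ℝ (fderiv ℝ f) x :=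
    ((hf x hx).fderiv_right (m := 1) (by norm_num)).differentiableAt (by simp)
  rw [iteratedFDeriv_two_apply]
  change _ = fderiv ℝ (fun y => fderiv ℝ f y (EuclideanSpace.single i 1)) x
    (EuclideanSpace.single i 1)
  rw [fderiv_clm_apply hd (differentiableAt_const _)]
  simp

lemma Lap_of_eul_eq_zero (hf : SP 2 f) (h : ∀ y, y ≠ 0 → eul f y = 0) (hx : x ≠ 0) :
    Lap f x = ‖x‖ ^ 2 * ∑ i, pd[i] (pd[i] f) x := by
  have h2 : eul (eul f) x = 0 := by
    rw [eul]
    refine Finset.sum_eq_zero fun i _ => ?_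
    rw [X_congr (g := fun _ => 0) h hx, X_const, mul_zero]
  rw [Lap_eq hf hx, h2, h x hx]; ring

/-- Same mechanism at second order: the Euler terms in the Casimir formula vanish for an extension
along rays, and at a unit vector the Euclidean Laplacian remains. -/
lemma angLap_eq (hf : SP 2 f) (hx : x ≠ 0) : angLap f x = Lap f x := by
  have hr := norm_pos_iff.2 hx
  have hω := dir_ne_zero hx
  have h := Lap_ext hf hr hω
  rw [ext, dir_dir hx, norm_smul_dir hx, Lap_of_eul_eq_zero (hf.ext hr)
    (fun y hy => eul_ext (hf.mono (by norm_num)) hr hy) hω, norm_dir hx] at h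
  rw [angLap_eq_laplacian_ext, laplacian_eq_sum (hf.ext hr) hω, ← h]; ring

end

/-- Functions killed by all rotation derivatives. -/
def RotInv (c : E d → ℝ) : Prop := ∀ x, x ≠ 0 → ∀ i j, rot[i, j] c x = 0

section
variable {f g h c : E d → ℝ} {x : E d}

lemma RotInv.rho : RotInv (rho : E d → ℝ) := fun _ hx i j => rot_rho i j hx

lemma RotInv.const (a : ℝ) : RotInv (fun _ : E d => a) := fun _ _ _ _ => X_const a

lemma RotInv.mul {b : E d → ℝ} (hb : RotInv b) (hc : RotInv c) (sb : SP 1 b) (sc : SP 1 c) :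
    RotInv (fun x => b x * c x) := fun x hx i j => by
  rw [X_mul sb sc hx, hb x hx, hc x hx]; ring

lemma rot_mul_rotInv (hc : RotInv c) (sc : SP 1 c) (hf : SP 1 f) (hx : x ≠ 0) (i j : Fin d) :
    rot[i, j] (fun y => c y * f y) x = c x * rot[i, j] f x := by
  rw [X_mul sc hf hx, hc x hx]; ring

lemma Gam_mul_rotInv (hc : RotInv c) (sc : SP 1 c) (hg : SP 1 g) (hx : x ≠ 0) :
    Gam f (fun y => c y * g y) x = c x * Gam f g x := by
  simp only [Gam, rot_mul_rotInv hc sc hg hx, Finset.mul_sum]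
  exact Finset.sum_congr rfl fun i _ => Finset.sum_congr rfl fun j _ => by ring

lemma Lap_mul_rotInv (hc : RotInv c) (sc : SP 2 c) (hg : SP 2 g) (hx : x ≠ 0) :
    Lap (fun y => c y * g y) x = c x * Lap g x := by
  have sc1 : SP 1 c := sc.mono (by norm_num)
  have h1 : ∀ i j : Fin d, rot[i, j] (rot[i, j] (fun y => c y * g y)) x =
      c x * rot[i, j] (rot[i, j] g) x := fun i j => by
    rw [X_congr (fun y hy => rot_mul_rotInv hc sc1 (hg.mono (by norm_num)) hy i j) hx,
      rot_mul_rotInv hc sc1 (hg.rot i j) hx]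
  simp only [Lap, h1, Finset.mul_sum]
  exact Finset.sum_congr rfl fun i _ => Finset.sum_congr rfl fun j _ => by ring

lemma Gam_comm : Gam f g x = Gam g f x := by
  simp only [Gam, mul_comm]

lemma Gam_add (hg : SP 1 g) (hh : SP 1 h) (hx : x ≠ 0) :
    Gam f (fun y => g y + h y) x = Gam f g x + Gam f h x := by
  simp only [Gam, X_add hg hh hx, mul_add, Finset.sum_add_distrib]

lemma Gam_const_mul (a : ℝ) (hg : SP 1 g) (hx : x ≠ 0) :
    Gam f (fun y => a * g y) x = a * Gam f g x :=
  Gam_mul_rotInv (RotInv.const a) (SP.const a) hg hx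

lemma Gam_mul (hg : SP 1 g) (hh : SP 1 h) (hx : x ≠ 0) :
    Gam f (fun y => g y * h y) x = g x * Gam f h x + h x * Gam f g x := by
  simp only [Gam, X_mul hg hh hx, Finset.mul_sum, ← Finset.sum_add_distrib]
  exact Finset.sum_congr rfl fun i _ => Finset.sum_congr rfl fun j _ => by ring

lemma Lap_add (hf : SP 2 f) (hg : SP 2 g) (hx : x ≠ 0) :
    Lap (fun y => f y + g y) x = Lap f x + Lap g x := by
  have h1 : ∀ i j : Fin d, rot[i, j] (rot[i, j] (fun y => f y + g y)) x =
      rot[i, j] (rot[i, j] f) x + rot[i, j] (rot[i, j] g) x := fun i j => by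
    rw [X_congr (fun y hy => X_add (hf.mono (by norm_num)) (hg.mono (by norm_num)) hy) hx,
      X_add (hf.rot i j) (hg.rot i j) hx]
  simp only [Lap, h1, Finset.sum_add_distrib, mul_add]

lemma Lap_const_mul (a : ℝ) (hg : SP 2 g) (hx : x ≠ 0) :
    Lap (fun y => a * g y) x = a * Lap g x :=
  Lap_mul_rotInv (RotInv.const a) (SP.const a) hg hx

lemma Lap_mul (hf : SP 2 f) (hg : SP 2 g) (hx : x ≠ 0) :
    Lap (fun y => f y * g y) x = f x * Lap g x + g x * Lap f x + 2 * Gam f g x := by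
  have hf1 : SP 1 f := hf.mono (by norm_num)
  have hg1 : SP 1 g := hg.mono (by norm_num)
  have h1 : ∀ i j : Fin d, rot[i, j] (rot[i, j] (fun y => f y * g y)) x =
      f x * rot[i, j] (rot[i, j] g) x + g x * rot[i, j] (rot[i, j] f) x
        + 2 * (rot[i, j] f x * rot[i, j] g x) := fun i j => by
    rw [X_congr (fun y hy => X_mul hf1 hg1 hy) hx,
      X_add (hf1.mul (hg.rot i j)) (hg1.mul (hf.rot i j)) hx, X_mul hf1 (hg.rot i j) hx,
      X_mul hg1 (hf.rot i j) hx]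
    ring
  simp only [Lap, h1, Gam, Finset.sum_add_distrib, ← Finset.mul_sum]
  ring

lemma radial_Gam (hf : SP 2 f) (hg : SP 2 g) (hx : x ≠ 0) :
    radial (Gam f g) x = Gam (radial f) g x + Gam f (radial g) x := by
  have hr : ∀ i j : Fin d, SP 1 (fun y => rot[i, j] f y * rot[i, j] g y) :=
    fun i j => (hf.rot i j).mul (hg.rot i j)
  have h1 : radial (Gam f g) x = 1 / 2 * ∑ i, ∑ j, radial (fun y => rot[i, j] f y * rot[i, j] g y) x := by
    simp only [radial_eq_X]
    unfold Gam
    rw [X_const_mul _ (SP.sum fun i _ => SP.sum fun j _ => hr i j) hx,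
      X_sum (fun i _ => SP.sum fun j _ => hr i j) hx]
    simp only [X_sum (fun j _ => hr _ j) hx]
  rw [h1]
  simp only [radial_eq_X, Gam, ← mul_add, ← Finset.sum_add_distrib]
  congr 1
  refine Finset.sum_congr rfl fun i _ => Finset.sum_congr rfl fun j _ => ?_
  rw [X_mul (hf.rot i j) (hg.rot i j) hx]
  have e1 := radial_rot hf i j hx
  have e2 := radial_rot hg i j hx
  simp only [radial_eq_X] at e1 e2
  rw [e1, e2]; ring

lemma radial_Lap (hf : SP 3 f) (hx : x ≠ 0) : radial (Lap f) x = Lap (radial f) x := by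
  have hr : ∀ i j : Fin d, SP 1 (rot[i, j] (rot[i, j] f)) := fun i j => SP.rot (SP.rot hf i j) i j
  have hf2 : SP 2 f := hf.mono (by norm_num)
  have h1 : radial (Lap f) x = 1 / 2 * ∑ i, ∑ j, radial (rot[i, j] (rot[i, j] f)) x := by
    simp only [radial_eq_X]
    unfold Lap
    rw [X_const_mul _ (SP.sum fun i _ => SP.sum fun j _ => hr i j) hx,
      X_sum (fun i _ => SP.sum fun j _ => hr i j) hx]
    simp only [X_sum (fun j _ => hr _ j) hx]
  rw [h1, Lap]
  congr 1
  refine Finset.sum_congr rfl fun i _ => Finset.sum_congr rfl fun j _ => ?_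
  rw [radial_rot (hf.rot i j) i j hx]
  exact X_congr (fun y hy => radial_rot hf2 i j hy) hx

lemma radial_add (hf : SP 1 f) (hg : SP 1 g) (hx : x ≠ 0) :
    radial (fun y => f y + g y) x = radial f x + radial g x := X_add hf hg hx

lemma radial_mul (hf : SP 1 f) (hg : SP 1 g) (hx : x ≠ 0) :
    radial (fun y => f y * g y) x = f x * radial g x + g x * radial f x := X_mul hf hg hx

lemma radial_const_mul (a : ℝ) (hg : SP 1 g) (hx : x ≠ 0) :
    radial (fun y => a * g y) x = a * radial g x := X_const_mul a hg hx

end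

/-! ### Divergence and the operators `D_α`, `D_α^*` and `L_α`. -/

section fields
variable {F : E d → E d} {f : E d → ℝ} {x : E d} {n α : ℝ}

lemma fderiv_coord (hF : DifferentiableAt ℝ F x) (h : E d) (i : Fin d) :
    fderiv ℝ F x h i = fderiv ℝ (fun y => F y i) x h := by
  have h1 := ((EuclideanSpace.proj i : E d →L[ℝ] ℝ).hasFDerivAt.comp x hF.hasFDerivAt)
  have h2 : HasFDerivAt (fun y => F y i) _ x := h1
  rw [h2.fderiv]; rfl

lemma divg_eq (hF : SP 1 F) (hx : x ≠ 0) : divg F x = ∑ i, pd[i] (fun y => F y i) x :=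
  Finset.sum_congr rfl fun i _ => fderiv_coord (hF.diff hx) _ i

lemma divg_smul (hf : SP 1 f) (hF : SP 1 F) (hx : x ≠ 0) :
    divg (fun y => f y • F y) x = f x * divg F x + fderiv ℝ f x (F x) := by
  rw [divg_eq (hf.smul hF) hx, divg_eq hF hx, fderiv_eq_sum, Finset.mul_sum,
    ← Finset.sum_add_distrib]
  refine Finset.sum_congr rfl fun i _ => ?_
  simp only [PiLp.smul_apply, smul_eq_mul]
  rw [X_mul hf (hF.comp_vec i) hx]

lemma divg_add {G : E d → E d} (hF : SP 1 F) (hG : SP 1 G) (hx : x ≠ 0) :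
    divg (fun y => F y + G y) x = divg F x + divg G x := by
  rw [divg_eq (hF.add hG) hx, divg_eq hF hx, divg_eq hG hx, ← Finset.sum_add_distrib]
  refine Finset.sum_congr rfl fun i _ => ?_
  simp only [PiLp.add_apply]
  rw [X_add (hF.comp_vec i) (hG.comp_vec i) hx]

lemma divg_id (x : E d) : divg (fun y : E d => y) x = d := by
  simp [divg]

lemma divg_dir (hx : x ≠ 0) : divg (dir : E d → E d) x = ((d : ℝ) - 1) * rho x := by
  have h : divg (fun y : E d => rho y • y) x = rho x * d + fderiv ℝ rho x x := by
    rw [divg_smul SP.rho SP.id hx, divg_id]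
  have h2 : fderiv ℝ rho x x = - rho x := by
    have h0 : ‖x‖ ≠ 0 := norm_ne_zero_iff.2 hx
    simp only [(hasFDerivAt_rho hx).fderiv, rho, smul_apply, innerSL_apply_apply,
      real_inner_self_eq_norm_sq, smul_eq_mul]
    field_simp
  change divg (fun y : E d => rho y • y) x = _
  rw [h, h2]; ring

lemma fderiv_dir_dir (hx : x ≠ 0) : fderiv ℝ (dir : E d → E d) x (dir x) = 0 := by
  conv_lhs => rw [dir]
  rw [map_smul, fderiv_dir_self hx, smul_zero]

lemma inner_dir_dir (hx : x ≠ 0) : ⟪dir x, dir x⟫ = (1 : ℝ) := by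
  rw [real_inner_self_eq_norm_sq, norm_dir hx]; norm_num

lemma radial_inner_dir (hF : SP 1 F) (hx : x ≠ 0) :
    radial (fun y => ⟪dir y, F y⟫) x = ⟪dir x, radial F x⟫ := by
  rw [radial, fderiv_inner_apply ℝ (SP.diff (k := 0) SP.dir hx) (hF.diff hx), fderiv_dir_dir hx,
    inner_zero_left, add_zero]
  rfl

lemma radial_smul_field (hf : SP 1 f) (hF : SP 1 F) (hx : x ≠ 0) :
    radial (fun y => f y • F y) x = f x • radial F x + radial f x • F x := by
  rw [radial, fderiv_fun_smul (hf.diff hx) (hF.diff hx)]; rfl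

lemma X_dir_norm_rpow (s : ℝ) (hx : x ≠ 0) :
    radial (fun y : E d => ‖y‖ ^ s) x = s * rho x * ‖x‖ ^ s := by
  have h0 : 0 < ‖x‖ := norm_pos_iff.2 hx
  rw [radial_eq_X, X_norm_rpow s hx, dir, inner_smul_right, real_inner_self_eq_norm_sq,
    Real.rpow_sub h0, Real.rpow_two, rho]
  field_simp

lemma fderiv_norm_rpow_apply (s : ℝ) (hx : x ≠ 0) (v : E d) :
    fderiv ℝ (fun y : E d => ‖y‖ ^ s) x v = s * rho x * ‖x‖ ^ s * ⟪dir x, v⟫ := by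
  have h0 : 0 < ‖x‖ := norm_pos_iff.2 hx
  have := X_norm_rpow (v := fun _ => v) s hx
  rw [X] at this
  rw [this, dir, real_inner_smul_left, Real.rpow_sub h0, Real.rpow_two, rho]
  field_simp

/-- The field `F + (α - 1) (ω · F) ω`. -/
def stretch (α : ℝ) (F : E d → E d) (x : E d) : E d := F x + ((α - 1) * ⟪dir x, F x⟫) • dir x

lemma SP.stretch {k : ℕ} (hF : SP k F) : SP k (stretch α F) :=
  hF.add (((SP.const _).mul (SP.dir.inner hF)).smul SP.dir)

lemma divg_stretch (hF : SP 1 F) (hx : x ≠ 0) :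
    divg (stretch α F) x = divg F x + (α - 1) * (radial (fun y => ⟪dir y, F y⟫) x
      + ((d : ℝ) - 1) * rho x * ⟪dir x, F x⟫) := by
  have h1 : SP 1 (fun y => (α - 1) * ⟪dir y, F y⟫) := (SP.const _).mul (SP.dir.inner hF)
  unfold stretch
  rw [divg_add hF (h1.smul SP.dir) hx, divg_smul h1 SP.dir hx, divg_dir hx]
  have h2 : fderiv ℝ (fun y => (α - 1) * ⟪dir y, F y⟫) x (dir x)
      = (α - 1) * radial (fun y => ⟪dir y, F y⟫) x := radial_const_mul _ (SP.dir.inner hF) hx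
  rw [h2]; ring

lemma DaStar_eq (hF : SP 1 F) (hx : x ≠ 0) :
    DaStar n α F x = -(divg F x + (n - d) * rho x * ⟪dir x, F x⟫
      + (α - 1) * (radial (fun y => ⟪dir y, F y⟫) x + (n - 1) * rho x * ⟪dir x, F x⟫)) := by
  have h0 : 0 < ‖x‖ := norm_pos_iff.2 hx
  rw [DaStar, divg_smul (SP.norm_rpow _) hF hx, radial_smul_field (SP.norm_rpow _) hF hx,
    X_dir_norm_rpow _ hx, fderiv_norm_rpow_apply _ hx, radial_inner_dir hF hx, inner_add_right,
    inner_smul_right, inner_smul_right]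
  have e1 : ‖x‖ ^ ((d : ℝ) - n) * ‖x‖ ^ (n - (d : ℝ)) = 1 := by
    rw [← Real.rpow_add h0]; simp
  have e2 : ‖x‖ ^ (1 - n) * ‖x‖ ^ (n - 1) = 1 := by
    rw [← Real.rpow_add h0]; simp
  linear_combination (-(divg F x) - (n - d) * rho x * ⟪dir x, F x⟫) * e1
    - (α - 1) * (⟪dir x, radial F x⟫ + (n - 1) * rho x * ⟪dir x, F x⟫) * e2

/-- `D_α` is the gradient multiplied by the symmetric matrix `I + (α-1) ω ⊗ ω`, and `stretch`
applies this matrix. Thus `D_α^*` is a genuine weighted divergence, to which the divergence theorem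
applies. -/
lemma DaStar_eq_divg (hF : SP 1 F) (hx : x ≠ 0) :
    DaStar n α F x = -(‖x‖ ^ ((d : ℝ) - n) *
      divg (fun y => ‖y‖ ^ (n - (d : ℝ)) • stretch α F y) x) := by
  have h0 : 0 < ‖x‖ := norm_pos_iff.2 hx
  have e1 : ‖x‖ ^ ((d : ℝ) - n) * ‖x‖ ^ (n - (d : ℝ)) = 1 := by
    rw [← Real.rpow_add h0]; simp
  have e3 : ⟪dir x, stretch α F x⟫ = α * ⟪dir x, F x⟫ := by
    rw [stretch, inner_add_right, inner_smul_right, inner_dir_dir hx]; ring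
  rw [DaStar_eq hF hx, divg_smul (SP.norm_rpow _) hF.stretch hx, fderiv_norm_rpow_apply _ hx,
    divg_stretch hF hx, e3]
  linear_combination (divg F x + (α - 1) * (radial (fun y => ⟪dir y, F y⟫) x
      + ((d : ℝ) - 1) * rho x * ⟪dir x, F x⟫) + (n - d) * rho x * (α * ⟪dir x, F x⟫)) * e1

end fields

section Da
variable {f g w : E d → ℝ} {x : E d} {n α : ℝ}

lemma gradient_eq_sum (f : E d → ℝ) (x v : E d) : ⟪v, gradient f x⟫ = fderiv ℝ f x v := by
  rw [real_inner_comm]; exact inner_gradient_left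

lemma SP.gradient {k : ℕ} (hf : SP (k + 1) f) : SP k (gradient f) :=
  SP.vec fun i => (hf.pd i).congr fun x _ => gradient_apply f x i

lemma SP.Da {k : ℕ} (hf : SP (k + 1) f) : SP k (Da α f) :=
  hf.gradient.add (((SP.const _).mul hf.radial).smul SP.dir)

lemma inner_dir_Da (hx : x ≠ 0) : ⟪dir x, Da α f x⟫ = α * radial f x := by
  rw [Da, inner_add_right, inner_smul_right, gradient_eq_sum, inner_dir_dir hx, radial]
  ring

lemma inner_Da_eq_fderiv (v : E d) :
    ⟪v, Da α f x⟫ = fderiv ℝ f x v + (α - 1) * radial f x * ⟪v, dir x⟫ := by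
  rw [Da, inner_add_right, inner_smul_right, gradient_eq_sum]

lemma sum_pd_mul_pd (hx : x ≠ 0) :
    ∑ i, pd[i] f x * pd[i] g x = radial f x * radial g x + rho x ^ 2 * Gam f g x := by
  rw [Gam_eq, radial_eq_eul, radial_eq_eul]
  have := rho_mul_norm hx
  linear_combination (-(1 + rho x * ‖x‖) * ∑ i, pd[i] f x * pd[i] g x) * this

/-- `D_α` multiplies the radial component of the gradient by `α` and leaves the tangential one
alone; the two are orthogonal. -/
lemma inner_Da_Da (hx : x ≠ 0) :
    ⟪Da α f x, Da α g x⟫ = α ^ 2 * (radial f x * radial g x) + rho x ^ 2 * Gam f g x := by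
  have h2 : ∀ f : E d → ℝ, fderiv ℝ f x (dir x) = radial f x := fun _ => rfl
  rw [inner_Da_eq_fderiv, Da, map_add, map_smul, ← gradient_eq_sum g, inner_gradient_gradient,
    sum_pd_mul_pd hx, inner_add_left, real_inner_comm, gradient_eq_sum, real_inner_smul_left,
    inner_dir_dir hx, h2 f, h2 g, smul_eq_mul]
  ring

lemma norm_Da_sq (hx : x ≠ 0) :
    ‖Da α f x‖ ^ 2 = α ^ 2 * (radial f x * radial f x) + rho x ^ 2 * Gam f f x := by
  rw [← real_inner_self_eq_norm_sq, inner_Da_Da hx]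

lemma radial_radial (hf : SP 2 f) (hx : x ≠ 0) :
    radial (radial f) x = rho x ^ 2 * (eul (eul f) x - eul f x) := by
  rw [radial_congr (G := fun y => rho y * eul f y) (fun y _ => radial_eq_eul) hx,
    radial_mul SP.rho hf.eul hx, radial_rho hx, radial_eq_eul]
  ring

lemma sum_pd_pd (hf : SP 2 f) (hx : x ≠ 0) :
    ∑ i, pd[i] (pd[i] f) x =
      radial (radial f) x + ((d : ℝ) - 1) * rho x * radial f x + rho x ^ 2 * Lap f x := by
  rw [Lap_eq hf hx, radial_radial hf hx, radial_eq_eul]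
  have := rho_mul_norm hx
  linear_combination (-(1 + rho x * ‖x‖) * ∑ i, pd[i] (pd[i] f) x) * this

lemma divg_gradient (hf : SP 2 f) (hx : x ≠ 0) :
    divg (gradient f) x = ∑ i, pd[i] (pd[i] f) x := by
  rw [divg_eq hf.gradient hx]
  exact Finset.sum_congr rfl fun i _ => X_congr (fun y _ => gradient_apply f y i) hx

lemma La_eq (hw : SP 2 w) (hx : x ≠ 0) :
    La n α w x = α ^ 2 * (radial (radial w) x + (n - 1) * rho x * radial w x)
      + rho x ^ 2 * Lap w x := by
  have hr : SP 1 (fun y => (α - 1) * radial w y) := (SP.const _).mul hw.radial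
  have h1 : divg (Da α w) x = ∑ i, pd[i] (pd[i] w) x
      + (α - 1) * (radial (radial w) x + ((d : ℝ) - 1) * rho x * radial w x) := by
    unfold Da
    rw [divg_add hw.gradient (hr.smul SP.dir) hx, divg_gradient hw hx, divg_smul hr SP.dir hx,
      divg_dir hx]
    have : fderiv ℝ (fun y => (α - 1) * radial w y) x (dir x) = (α - 1) * radial (radial w) x :=
      radial_const_mul _ hw.radial hx
    rw [this]; ring
  have h2 : radial (fun y => ⟪dir y, Da α w y⟫) x = α * radial (radial w) x := by
    rw [radial_congr (fun y hy => inner_dir_Da hy) hx, radial_const_mul _ hw.radial hx]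
  rw [La, DaStar_eq hw.Da hx, h1, h2, inner_dir_Da hx, sum_pd_pd hw hx]
  ring

lemma Da_neg (f : E d → ℝ) : Da α (fun y => - f y) x = - Da α f x := by
  ext i
  simp only [Da, PiLp.add_apply, gradient_apply, PiLp.smul_apply, PiLp.neg_apply, radial_eq_X, X_neg,
    smul_eq_mul]
  ring

lemma Da_congr (h : ∀ y, y ≠ 0 → f y = g y) (hx : x ≠ 0) : Da α f x = Da α g x := by
  ext i
  simp only [Da, PiLp.add_apply, gradient_apply, PiLp.smul_apply, radial_eq_X, X_congr h hx]

end Da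

/-! ### The pointwise identity for `K`. -/

/-- The Bochner-type identity for `K[D_α p]`. -/
theorem K_Da {n α : ℝ} (hn : 1 < n) (hα : 0 < α) {p : E d → ℝ} (hp : SP 3 p) {x : E d}
    (hx : x ≠ 0) :
    K n α (Da α p) x =
      α ^ 4 * (1 - 1 / n) *
          |radial (radial p) x - radial p x / ‖x‖
            - angLap p x / (α ^ 2 * (n - 1) * ‖x‖ ^ 2)| ^ 2
        + 2 * α ^ 2 / ‖x‖ ^ 2 *
          ‖angGrad (radial p) x - ‖x‖⁻¹ • angGrad p x‖ ^ 2
        + kSph n α p x / ‖x‖ ^ 4 := by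
  have hp2 : SP 2 p := hp.mono (by norm_num)
  have hp1 : SP 1 p := hp.mono (by norm_num)
  have T1 : SP 2 (radial p) := SP.radial hp
  have T1' : SP 1 (radial p) := T1.mono (by norm_num)
  have T2 : SP 1 (radial (radial p)) := SP.radial T1
  have G2 : SP 2 (Gam p p) := SP.Gam hp hp
  have G1 : SP 1 (Gam p p) := G2.mono (by norm_num)
  have L1 : SP 1 (Lap p) := SP.Lap hp
  have r2 : SP 2 (fun y : E d => rho y * rho y) := SP.rho.mul SP.rho
  have r1 : SP 1 (fun y : E d => rho y * rho y) := SP.rho.mul SP.rho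
  have ri : RotInv (fun y : E d => rho y * rho y) := RotInv.rho.mul RotInv.rho SP.rho SP.rho
  have Tr : ∀ y : E d, y ≠ 0 → radial (fun y : E d => rho y * rho y) y = -2 * rho y ^ 3 :=
    fun y hy => by rw [radial_mul SP.rho SP.rho hy, radial_rho hy]; ring
  -- the square of the flux
  have S2 : SP 2 (fun y => α ^ 2 * (radial p y * radial p y)) := (SP.const _).mul (T1.mul T1)
  have S1 : SP 1 (fun y => α ^ 2 * (radial p y * radial p y)) := S2.mono (by norm_num)
  have hW : ∀ y : E d, y ≠ 0 → ‖Da α p y‖ ^ 2 =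
      α ^ 2 * (radial p y * radial p y) + rho y * rho y * Gam p p y := fun y hy => by
    rw [norm_Da_sq hy]; ring
  have sW : SP 2 (fun y => ‖Da α p y‖ ^ 2) := (S2.add (r2.mul G2)).congr hW
  have hTW : ∀ y : E d, y ≠ 0 → radial (fun y => ‖Da α p y‖ ^ 2) y =
      2 * α ^ 2 * (radial p y * radial (radial p) y)
        + (2 * (rho y * rho y) * Gam p (radial p) y + -2 * (rho y * rho y * rho y) * Gam p p y) :=
    fun y hy => by
      rw [radial_congr hW hy, radial_add S1 (r1.mul G1) hy, radial_const_mul _ (T1'.mul T1') hy,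
        radial_mul T1' T1' hy, radial_mul r1 G1 hy, Tr y hy, radial_Gam hp2 hp2 hy,
        Gam_comm (f := radial p)]
      ring
  have GT1 : SP 1 (Gam p (radial p)) := SP.Gam hp2 T1
  have r3 : SP 1 (fun y : E d => rho y * rho y * rho y) := r1.mul SP.rho
  have hTTW : radial (radial (fun y => ‖Da α p y‖ ^ 2)) x =
      2 * α ^ 2 * (radial p x * radial (radial (radial p)) x + radial (radial p) x ^ 2)
        + 2 * rho x ^ 2 * (Gam (radial p) (radial p) x + Gam p (radial (radial p)) x)
        - 8 * rho x ^ 3 * Gam p (radial p) x + 6 * rho x ^ 4 * Gam p p x := by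
    have a1 : SP 1 (fun y : E d => 2 * (rho y * rho y)) := (SP.const _).mul r1
    have a2 : SP 1 (fun y : E d => -2 * (rho y * rho y * rho y)) := (SP.const _).mul r3
    rw [radial_congr hTW hx, radial_add ((SP.const _).mul (T1'.mul T2))
      ((a1.mul GT1).add (a2.mul G1)) hx, radial_add (a1.mul GT1) (a2.mul G1) hx,
      radial_const_mul _ (T1'.mul T2) hx, radial_mul T1' T2 hx, radial_mul a1 GT1 hx,
      radial_mul a2 G1 hx, radial_const_mul _ r1 hx, Tr x hx, radial_const_mul _ r3 hx,
      radial_mul r1 SP.rho hx, Tr x hx, radial_rho hx, radial_Gam hp2 T1 hx, radial_Gam hp2 hp2 hx,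
      Gam_comm (f := radial p) (g := p)]
    ring
  have hLW : Lap (fun y => ‖Da α p y‖ ^ 2) x =
      α ^ 2 * (2 * radial p x * Lap (radial p) x + 2 * Gam (radial p) (radial p) x)
        + rho x ^ 2 * Lap (Gam p p) x := by
    rw [Lap_congr hW hx, Lap_add S2 (r2.mul G2) hx, Lap_const_mul _ (T1.mul T1) hx,
      Lap_mul T1 T1 hx, Lap_mul_rotInv ri r2 G2 hx]
    ring
  -- the function `L_α p`
  have hq : ∀ y : E d, y ≠ 0 → La n α p y =
      α ^ 2 * (radial (radial p) y + (n - 1) * (rho y * radial p y)) + rho y * rho y * Lap p y :=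
    fun y hy => by rw [La_eq hp2 hy]; ring
  have b1 : SP 1 (fun y : E d => rho y * radial p y) := SP.rho.mul T1'
  have b2 : SP 1 (fun y : E d => (n - 1) * (rho y * radial p y)) := (SP.const _).mul b1
  have b3 : SP 1 (fun y : E d => α ^ 2 * (radial (radial p) y + (n - 1) * (rho y * radial p y))) :=
    (SP.const _).mul (T2.add b2)
  have b4 := r1.mul L1
  have hTq : radial (La n α p) x =
      α ^ 2 * (radial (radial (radial p)) x + (n - 1) * (rho x * radial (radial p) x
        - rho x ^ 2 * radial p x)) + rho x ^ 2 * Lap (radial p) x - 2 * rho x ^ 3 * Lap p x := by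
    rw [radial_congr hq hx, radial_add b3 b4 hx, radial_const_mul _ (T2.add b2) hx,
      radial_add T2 b2 hx, radial_const_mul _ b1 hx, radial_mul SP.rho T1' hx, radial_rho hx,
      radial_mul r1 L1 hx, Tr x hx, radial_Lap hp hx]
    ring
  have hGq : Gam p (La n α p) x =
      α ^ 2 * (Gam p (radial (radial p)) x + (n - 1) * (rho x * Gam p (radial p) x))
        + rho x ^ 2 * Gam p (Lap p) x := by
    rw [Gam_congr (fun _ _ => rfl) hq hx, Gam_add b3 b4 hx, Gam_const_mul _ (T2.add b2) hx,
      Gam_add T2 b2 hx, Gam_const_mul _ b1 hx, Gam_mul_rotInv RotInv.rho SP.rho T1' hx,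
      Gam_mul_rotInv ri r1 L1 hx]
    ring
  have hs : DaStar n α (Da α p) = fun y => - La n α p y := by ext y; rw [La, neg_neg]
  have hkk : ∀ y : E d, y ≠ 0 → ‖angGrad p y‖ ^ 2 = Gam p p y := fun y hy => norm_angGrad_sq hp1 hy
  have sk : SP 2 (fun y => ‖angGrad p y‖ ^ 2) := G2.congr hkk
  have sL : SP 1 (angLap p) := L1.congr fun y hy => angLap_eq hp2 hy
  have hnorm : ‖angGrad (radial p) x - ‖x‖⁻¹ • angGrad p x‖ ^ 2 =
      Gam (radial p) (radial p) x - 2 * rho x * Gam p (radial p) x + rho x ^ 2 * Gam p p x := by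
    rw [norm_sub_sq_real, norm_smul, inner_smul_right, mul_pow, norm_angGrad_sq hp1 hx,
      norm_angGrad_sq T1' hx, inner_angGrad T1' hp1 hx, Gam_comm (f := radial p) (g := p)]
    simp only [rho, norm_inv, norm_norm]
    ring
  rw [K, kSph, hs, Da_neg, inner_neg_right, inner_Da_Da hx, angLap_eq sk hx, Lap_congr hkk hx,
    inner_angGrad hp1 sL hx, Gam_congr (g' := Lap p) (fun _ _ => rfl) (fun y hy => angLap_eq hp2 hy) hx,
    hkk x hx, angLap_eq hp2 hx, hnorm, sq_abs, hTq, hGq, La_eq sW hx, hTTW, hTW x hx, hLW]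
  beta_reduce
  rw [hq x hx]
  -- Both sides are now polynomial in `Gam`, `Lap` and radial derivatives of `p`, with coefficients
  -- rational in `ρ`. The terms in `p' p'''`, `Γ(p,p'')` and `p' Δ_ω p'` cancel between `½ L_α |F|²`
  -- and `F · D_α (D_α^* F)`; the rest is a completion of squares.
  have hr : ‖x‖ = (rho x)⁻¹ := by rw [rho, inv_inv]
  have hρ : rho x ≠ 0 := inv_ne_zero (norm_ne_zero_iff.2 hx)
  have h1 : n - 1 ≠ 0 := by linarith
  have h2 : n ≠ 0 := by linarith
  rw [hr]
  field_simp
  ring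

/-! ### The divergence theorem on the punctured space. -/

lemma integral_divg_of_hasCompactSupport {G : E d → E d} (hG : ContDiff ℝ 1 G)
    (hc : HasCompactSupport G) : ∫ x, divg G x = 0 := by
  have hcont : ∀ i : Fin d, Continuous fun x => fderiv ℝ G x (EuclideanSpace.single i 1) :=
    fun i => (hG.continuous_fderiv (by simp)).clm_apply continuous_const
  have hcs : ∀ i : Fin d, HasCompactSupport fun x => fderiv ℝ G x (EuclideanSpace.single i 1) :=
    fun i => hc.fderiv_apply ℝ _
  have hint : ∀ i : Fin d, Integrable fun x => fderiv ℝ G x (EuclideanSpace.single i 1) :=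
    fun i => (hcont i).integrable_of_hasCompactSupport (hcs i)
  have hG0 : Integrable G := hG.continuous.integrable_of_hasCompactSupport hc
  have hint' : ∀ i ∈ Finset.univ, Integrable fun x => fderiv ℝ G x (EuclideanSpace.single i 1) i :=
    fun i _ => (EuclideanSpace.proj i : E d →L[ℝ] ℝ).integrable_comp (hint i)
  unfold divg
  rw [integral_finsetSum _ hint']
  refine Finset.sum_eq_zero fun i _ => ?_
  rw [show (fun x => fderiv ℝ G x (EuclideanSpace.single i 1) i) =
    fun x => (EuclideanSpace.proj i : E d →L[ℝ] ℝ) (fderiv ℝ G x (EuclideanSpace.single i 1)) from rfl,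
    ContinuousLinearMap.integral_comp_comm _ (hint i)]
  -- Integration by parts against the constant function `1` shows that each directional derivative
  -- of `G` has integral zero.
  have h := integral_smul_fderiv_eq_neg_fderiv_smul_of_integrable (𝕜 := ℝ) (μ := volume)
    (f := fun _ : E d => (1 : ℝ)) (g := G) (v := EuclideanSpace.single i 1)
    (by simp) (by simpa using hint i) (by simpa using hG0) (by fun_prop)
    (fun x _ => hG.differentiable (by simp) x)
  simp only [one_smul] at h
  rw [h]; simp

/-- Smooth cutoff functions that exhaust the punctured space. -/
def cutoff (d k : ℕ) (x : E d) : ℝ :=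
  if x = 0 then 0 else (⟨1, 2, one_pos, one_lt_two⟩ : ContDiffBump (0 : ℝ)) (Real.log ‖x‖ / (k + 1))

section cutoff
variable {k : ℕ} {x : E d}

lemma cutoff_of_ne (hx : x ≠ 0) : cutoff d k x =
    (⟨1, 2, one_pos, one_lt_two⟩ : ContDiffBump (0 : ℝ)) (Real.log ‖x‖ / (k + 1)) := if_neg hx

lemma cutoff_eq_zero (h : 2 * ((k : ℝ) + 1) ≤ |Real.log ‖x‖|) : cutoff d k x = 0 := by
  by_cases hx : x = 0
  · exact if_pos hx
  have hk : (0 : ℝ) < k + 1 := by positivity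
  rw [cutoff_of_ne hx]
  refine ContDiffBump.zero_of_le_dist _ ?_
  rw [dist_zero_right, Real.norm_eq_abs, abs_div, abs_of_pos hk, le_div_iff₀ hk]
  exact h

lemma cutoff_mem (k : ℕ) (x : E d) : ‖cutoff d k x‖ ≤ 1 := by
  by_cases hx : x = 0
  · simp [cutoff, hx]
  · rw [cutoff_of_ne hx, Real.norm_of_nonneg (ContDiffBump.nonneg _)]
    exact ContDiffBump.le_one _

lemma cutoff_smooth {m : ℕ} : SP m (cutoff d k) := fun x hx => by
  have h1 : ContDiffAt ℝ m (fun y : E d => Real.log ‖y‖ / (k + 1)) x :=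
    ((contDiffAt_norm ℝ hx).log (norm_ne_zero_iff.2 hx)).div_const _
  have h2 := (⟨1, 2, one_pos, one_lt_two⟩ : ContDiffBump (0 : ℝ)).contDiffAt (n := m)
    (x := Real.log ‖x‖ / (k + 1))
  exact (h2.comp x h1).congr_of_eventuallyEq
    (Filter.eventuallyEq_of_mem (nhds_punct hx) fun y hy => cutoff_of_ne hy)

lemma cutoff_eventually_zero : ∀ᶠ x in nhds (0 : E d), cutoff d k x = 0 := by
  have : Metric.ball (0 : E d) (Real.exp (-(2 * ((k : ℝ) + 1)))) ∈ nhds 0 :=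
    Metric.ball_mem_nhds _ (Real.exp_pos _)
  filter_upwards [this] with x hx
  by_cases h0 : x = 0
  · exact if_pos h0
  refine cutoff_eq_zero ?_
  rw [mem_ball_zero_iff, ← Real.log_lt_iff_lt_exp (norm_pos_iff.2 h0)] at hx
  exact le_trans (by linarith) (neg_le_abs _)

lemma contDiff_cutoff_smul {H : E d → E d} (hH : SP 1 H) :
    ContDiff ℝ 1 (fun x => cutoff d k x • H x) := by
  rw [contDiff_iff_contDiffAt]
  intro x
  by_cases hx : x = 0
  · subst hx
    refine (contDiffAt_const (c := (0 : E d))).congr_of_eventuallyEq ?_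
    filter_upwards [cutoff_eventually_zero (d := d) (k := k)] with y hy
    rw [hy, zero_smul]
  · exact cutoff_smooth.smul hH x hx

lemma hasCompactSupport_cutoff_smul {H : E d → E d} :
    HasCompactSupport (fun x => cutoff d k x • H x) := by
  refine HasCompactSupport.intro (isCompact_closedBall (0 : E d) (Real.exp (2 * ((k : ℝ) + 1)))) ?_
  intro x hx
  rw [mem_closedBall_zero_iff, not_le] at hx
  have h0 : 0 < ‖x‖ := (Real.exp_pos _).trans hx
  rw [← Real.lt_log_iff_exp_lt h0] at hx
  rw [cutoff_eq_zero (hx.le.trans (le_abs_self _)), zero_smul]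

/-- The cutoff is a fixed profile in `log |x| / (k+1)`. Its gradient is therefore radial and bounded
by `C / ((k+1) |x|)` at every scale: one factor `1/|x|` is the whole cost of cutting off at the
origin and at infinity together, and the prefactor tends to zero. -/
lemma exists_fderiv_cutoff (d : ℕ) : ∃ C : ℝ, 0 ≤ C ∧ ∀ (k : ℕ) (x : E d), x ≠ 0 →
    ∃ c : ℝ, |c| ≤ C / (k + 1) * ‖x‖⁻¹ ^ 2 ∧ ∀ v, fderiv ℝ (cutoff d k) x v = c * ⟪x, v⟫ := by
  let b : ContDiffBump (0 : ℝ) := ⟨1, 2, one_pos, one_lt_two⟩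
  have hc : Continuous (deriv b) := b.contDiff.continuous_deriv (n := 1) le_rfl
  obtain ⟨C, hC⟩ := b.hasCompactSupport.deriv.exists_bound_of_continuous hc
  refine ⟨C, (norm_nonneg _).trans (hC 0), fun k x hx => ?_⟩
  have hk : (0 : ℝ) < k + 1 := by positivity
  have h0 : 0 < ‖x‖ := norm_pos_iff.2 hx
  have h1 := ((hasFDerivAt_norm hx).log h0.ne').mul_const ((k : ℝ) + 1)⁻¹
  have h2 : HasDerivAt b (deriv b (Real.log ‖x‖ * ((k : ℝ) + 1)⁻¹)) (Real.log ‖x‖ * ((k : ℝ) + 1)⁻¹) :=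
    ((b.contDiff (n := 1)).differentiable (by simp) _).hasDerivAt
  have h3 := h2.comp_hasFDerivAt x h1
  rw [fderiv_congr (G := b ∘ fun y => (Real.log ‖y‖ * ((k : ℝ) + 1)⁻¹)) (fun y hy => cutoff_of_ne hy) hx,
    h3.fderiv]
  refine ⟨deriv b (Real.log ‖x‖ * ((k : ℝ) + 1)⁻¹) * (((k : ℝ) + 1)⁻¹ * ‖x‖⁻¹ ^ 2), ?_, fun v => ?_⟩
  · have h5 := hC (Real.log ‖x‖ * ((k : ℝ) + 1)⁻¹)
    rw [Real.norm_eq_abs] at h5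
    rw [abs_mul, abs_of_pos (by positivity : 0 < ((k : ℝ) + 1)⁻¹ * ‖x‖⁻¹ ^ 2), div_eq_mul_inv,
      mul_assoc]
    gcongr
  · simp only [smul_apply, innerSL_apply_apply, smul_eq_mul]
    ring

end cutoff

lemma nontrivial_E (hd : 0 < d) : Nontrivial (E d) :=
  ⟨⟨EuclideanSpace.single ⟨0, hd⟩ 1, 0, fun h => by simpa using congrArg norm h⟩⟩

lemma ae_ne_zero (hd : 0 < d) : ∀ᵐ x : E d, x ≠ 0 := by
  have := nontrivial_E hd
  exact Measure.ae_ne volume 0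

/-- The divergence theorem on the punctured space. -/
theorem integral_divg_eq_zero (hd : 0 < d) {H : E d → E d} (hH : SP 1 H)
    (h1 : Integrable fun x => ‖H x‖ / ‖x‖) (h2 : Integrable (divg H)) : ∫ x, divg H x = 0 := by
  obtain ⟨C, hC0, hC'⟩ := exists_fderiv_cutoff d
  have hC : ∀ (k : ℕ) (x : E d), x ≠ 0 → ∀ v : E d,
      ‖fderiv ℝ (cutoff d k) x v‖ ≤ C / (k + 1) * (‖v‖ / ‖x‖) := fun k x hx v => by
    obtain ⟨c, hc, hv⟩ := hC' k x hx
    have h0 : 0 < ‖x‖ := norm_pos_iff.2 hx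
    rw [hv, Real.norm_eq_abs, abs_mul]
    calc |c| * |⟪x, v⟫| ≤ (C / (k + 1) * ‖x‖⁻¹ ^ 2) * (‖x‖ * ‖v‖) := by
          gcongr; exact abs_real_inner_le_norm x v
      _ = _ := by field_simp
  have h0 : ∀ k, ∫ x, divg (fun y => cutoff d k y • H y) x = 0 := fun k =>
    integral_divg_of_hasCompactSupport (contDiff_cutoff_smul hH) hasCompactSupport_cutoff_smul
  have hdiv : ∀ k x, x ≠ 0 → divg (fun y => cutoff d k y • H y) x =
      cutoff d k x * divg H x + fderiv ℝ (cutoff d k) x (H x) :=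
    fun k x hx => divg_smul cutoff_smooth hH hx
  have hlim : Filter.Tendsto (fun k => ∫ x, divg (fun y => cutoff d k y • H y) x) Filter.atTop
      (nhds (∫ x, divg H x)) := by
    -- The two terms of the majorant dominate the cut-off divergence and the commutator with the
    -- cutoff; the commutator tends to zero pointwise because of the factor `1/(k+1)`.
    refine tendsto_integral_of_dominated_convergence
      (fun x => ‖divg H x‖ + C * (‖H x‖ / ‖x‖)) (fun k => ?_) (h2.norm.add (h1.const_mul _))
      (fun k => ?_) ?_
    · refine Continuous.aestronglyMeasurable ?_
      unfold divg
      have := (contDiff_cutoff_smul (k := k) hH).continuous_fderiv (by simp)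
      fun_prop
    · filter_upwards [ae_ne_zero hd] with x hx
      rw [hdiv k x hx]
      refine (norm_add_le _ _).trans (add_le_add ?_ ?_)
      · rw [norm_mul]
        exact mul_le_of_le_one_left (norm_nonneg _) (cutoff_mem k x)
      · refine (hC k x hx (H x)).trans ?_
        gcongr
        have hk : (1 : ℝ) ≤ k + 1 := by simp
        exact div_le_self hC0 hk
    · filter_upwards [ae_ne_zero hd] with x hx
      have e1 : Filter.Tendsto (fun k : ℕ => Real.log ‖x‖ / ((k : ℝ) + 1)) Filter.atTop (nhds 0) :=
        tendsto_const_nhds.div_atTop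
          (Filter.tendsto_atTop_add_const_right _ _ tendsto_natCast_atTop_atTop)
      have e2 : Filter.Tendsto (fun k : ℕ => cutoff d k x) Filter.atTop (nhds 1) := by
        have := ((⟨1, 2, one_pos, one_lt_two⟩ : ContDiffBump (0 : ℝ)).continuous.tendsto 0).comp e1
        rw [ContDiffBump.one_of_mem_closedBall _ (by simp)] at this
        exact this.congr fun k => (cutoff_of_ne hx).symm
      have e3 : Filter.Tendsto (fun k : ℕ => fderiv ℝ (cutoff d k) x (H x)) Filter.atTop (nhds 0) := by
        refine squeeze_zero_norm (fun k => hC k x hx (H x)) ?_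
        have : Filter.Tendsto (fun k : ℕ => C / ((k : ℝ) + 1)) Filter.atTop (nhds 0) :=
          tendsto_const_nhds.div_atTop
            (Filter.tendsto_atTop_add_const_right _ _ tendsto_natCast_atTop_atTop)
        simpa using this.mul_const (‖H x‖ / ‖x‖)
      have := (e2.mul_const (divg H x)).add e3
      rw [one_mul, add_zero] at this
      exact this.congr fun k => (hdiv k x hx).symm
  simp only [h0] at hlim
  exact (tendsto_nhds_unique hlim tendsto_const_nhds)

instance : IsFiniteMeasure (dω d) := by unfold dω; infer_instance

/-! ### Integration on spheres. -/

section polar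

lemma homeomorphUnitSphereProd_smul (x : ({0}ᶜ : Set (E d))) :
    (homeomorphUnitSphereProd (E d) x).2.1 • (homeomorphUnitSphereProd (E d) x).1.1 = x.1 := by
  simp [smul_smul, mul_inv_cancel₀ (norm_ne_zero_iff.2 x.2)]

lemma integrable_polar {f : E d → ℝ} (hf : Integrable f) :
    Integrable (fun z : Metric.sphere (0 : E d) 1 × Ioi (0 : ℝ) => f (z.2.1 • z.1.1))
      ((dω d).prod (Measure.volumeIoiPow (d - 1))) := by
  have hm := (volume : Measure (E d)).measurePreserving_homeomorphUnitSphereProd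
  rw [finrank_euclideanSpace_fin] at hm
  rw [dω, ← hm.integrable_comp_emb (Homeomorph.measurableEmbedding _)]
  have : Integrable (fun x : ({0}ᶜ : Set (E d)) => f x) (volume.comap Subtype.val) :=
    (integrableOn_iff_comap_subtypeVal (measurableSet_singleton _).compl).1 hf.integrableOn
  refine this.congr (Filter.Eventually.of_forall fun x => ?_)
  exact congrArg f (homeomorphUnitSphereProd_smul x).symm

lemma integral_polar (hd : 0 < d) (f : E d → ℝ) :
    ∫ x, f x = ∫ z : Metric.sphere (0 : E d) 1 × Ioi (0 : ℝ), f (z.2.1 • z.1.1)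
      ∂((dω d).prod (Measure.volumeIoiPow (d - 1))) := by
  have hm := (volume : Measure (E d)).measurePreserving_homeomorphUnitSphereProd
  rw [finrank_euclideanSpace_fin] at hm
  have := nontrivial_E hd
  rw [dω, ← hm.integral_comp (Homeomorph.measurableEmbedding _)]
  simp only [homeomorphUnitSphereProd_smul]
  rw [integral_subtype_comap (measurableSet_singleton _).compl f, restrict_compl_singleton]

end polar

section sphere

variable {f : E d → ℝ} {r : ℝ}

lemma sphere_smul_ne_zero (hr : 0 < r) (ω : Metric.sphere (0 : E d) 1) : r • ω.1 ≠ 0 :=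
  smul_ne_zero hr.ne' (ne_zero_of_mem_unit_sphere ω)

lemma dir_sphere (ω : Metric.sphere (0 : E d) 1) : dir ω.1 = ω.1 := by
  rw [dir, norm_eq_of_mem_sphere, inv_one, one_smul]

lemma dir_smul_sphere (hr : 0 < r) (ω : Metric.sphere (0 : E d) 1) : dir (r • ω.1) = ω.1 := by
  rw [dir_smul hr, dir_sphere]

lemma SP.continuous_sphere {k : ℕ} (hf : SP k f) (hr : 0 < r) :
    Continuous fun ω : Metric.sphere (0 : E d) 1 => f (r • ω.1) := by
  rw [continuous_iff_continuousAt]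
  intro ω
  have h1 : ContinuousAt f (r • ω.1) := (hf _ (sphere_smul_ne_zero hr ω)).continuousAt
  exact h1.comp (f := fun ω : Metric.sphere (0 : E d) 1 => r • ω.1) (by fun_prop)

lemma SP.integrable_sphere {k : ℕ} (hf : SP k f) (hr : 0 < r) :
    Integrable (fun ω => f (r • ω.1)) (dω d) :=
  (hf.continuous_sphere hr).integrable_of_hasCompactSupport (HasCompactSupport.of_compactSpace _)

lemma divg_rotF (i j : Fin d) (x : E d) : divg (rotF i j) x = 0 := by
  simp only [divg, fderiv_rotF, rotF_apply]
  simp [PiLp.single_apply, Finset.sum_sub_distrib, eq_comm]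

lemma rot_cutoff {k : ℕ} {x : E d} (hx : x ≠ 0) (i j : Fin d) : rot[i, j] (cutoff d k) x = 0 := by
  obtain ⟨C, -, hC⟩ := exists_fderiv_cutoff d
  obtain ⟨c, -, hc⟩ := hC k x hx
  rw [X, hc, inner_rotF, mul_zero]

/-- Rotation fields are divergence free and tangent to spheres, hence annihilate the radial cutoff,
so the integrand is the divergence of a compactly supported field. -/
lemma integral_cutoff_mul_rot (hd : 0 < d) (hf : SP 1 f) (i j : Fin d) :
    ∫ x, cutoff d 0 x * rot[i, j] f x = 0 := by
  have h1 : SP 1 (fun y => f y • rotF i j y) := hf.smul (SP.rotF i j)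
  have h := integral_divg_of_hasCompactSupport (contDiff_cutoff_smul (k := 0) h1)
    hasCompactSupport_cutoff_smul
  rw [← h]
  refine integral_congr_ae ?_
  filter_upwards [ae_ne_zero hd] with x hx
  rw [divg_smul cutoff_smooth h1 hx, divg_smul hf (SP.rotF i j) hx, divg_rotF, map_smul]
  have := rot_cutoff (k := 0) hx i j
  rw [X] at this
  rw [this, X]; simp

/-- In polar coordinates the integral factors into a spherical and a radial integral. Identities on
the full space thereby descend to spheres, and only the positivity of the radial factor matters, not
its value. -/
lemma exists_integral_cutoff_mul_ext (hd : 0 < d) (r : ℝ) :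
    ∃ c : ℝ, 0 < c ∧ ∀ f : E d → ℝ, ∫ x, cutoff d 0 x * ext r f x = (∫ ω, f (r • ω.1) ∂dω d) * c := by
  let b : ContDiffBump (0 : ℝ) := ⟨1, 2, one_pos, one_lt_two⟩
  have key : ∀ f : E d → ℝ, ∫ x, cutoff d 0 x * ext r f x = (∫ ω, f (r • ω.1) ∂dω d) *
      ∫ s : Ioi (0 : ℝ), b (Real.log s.1 / ((0 : ℕ) + 1)) ∂(Measure.volumeIoiPow (d - 1)) := fun f => by
    rw [integral_polar hd, ← integral_prod_mul]
    refine integral_congr_ae (Filter.Eventually.of_forall fun z => ?_)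
    have hz : (0 : ℝ) < z.2.1 := z.2.2
    have h2 : ‖z.2.1 • z.1.1‖ = z.2.1 := by
      rw [norm_smul, norm_eq_of_mem_sphere, mul_one, Real.norm_of_nonneg hz.le]
    beta_reduce
    rw [cutoff_of_ne (sphere_smul_ne_zero hz z.1), h2, ext, dir_smul_sphere hz, mul_comm]
  refine ⟨_, ?_, key⟩
  -- Testing with `f = 1`: the integral of the cutoff is positive, while the total mass of the
  -- sphere is nonnegative, so the radial factor cannot be nonpositive.
  by_contra hc
  have h1 := key (fun _ => 1)
  have hcc : Continuous (cutoff d 0) := by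
    have := contDiff_cutoff_smul (d := d) (k := 0) (SP.const (k := 1) (EuclideanSpace.single ⟨0, hd⟩ 1))
    have h3 : Continuous fun x => (cutoff d 0 x • (EuclideanSpace.single ⟨0, hd⟩ 1 : E d)) ⟨0, hd⟩ :=
      (EuclideanSpace.proj (𝕜 := ℝ) (⟨0, hd⟩ : Fin d)).continuous.comp this.continuous
    simpa using h3
  have hcs : HasCompactSupport (cutoff d 0) := by
    have := (hasCompactSupport_cutoff_smul (d := d) (k := 0)
      (H := fun _ => EuclideanSpace.single ⟨0, hd⟩ 1)).comp_left
      (g := fun v : E d => v ⟨0, hd⟩) (by simp)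
    simpa [Function.comp_def] using this
  have hx1 : cutoff d 0 (EuclideanSpace.single ⟨0, hd⟩ 1) ≠ 0 := by
    rw [cutoff_of_ne (fun h => by simpa using congrArg norm h),
      ContDiffBump.one_of_mem_closedBall _ (by simp)]
    exact one_ne_zero
  have hnn : ∀ x, 0 ≤ cutoff d 0 x := fun x => by
    rw [cutoff]; split_ifs
    · exact le_rfl
    · exact ContDiffBump.nonneg _
  have hpos := hcc.integral_pos_of_hasCompactSupport_nonneg_nonzero (μ := volume) hcs hnn hx1
  simp only [ext, mul_one] at h1
  rw [h1] at hpos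
  have : 0 ≤ ∫ ω, (1 : ℝ) ∂dω d := integral_nonneg fun _ => zero_le_one
  nlinarith

/-- The rotation derivatives integrate to zero on spheres. -/
lemma integral_rot_sphere (hd : 0 < d) (hr : 0 < r) (hf : SP 1 f) (i j : Fin d) :
    ∫ ω, rot[i, j] f (r • ω.1) ∂dω d = 0 := by
  obtain ⟨c, hc, h⟩ := exists_integral_cutoff_mul_ext hd r
  have h1 := h (rot[i, j] f)
  have h2 := integral_cutoff_mul_rot hd (hf.ext hr) i j
  rw [integral_congr_ae (g := fun x => cutoff d 0 x * ext r (rot[i, j] f) x)] at h2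
  · rw [h2] at h1
    exact (mul_eq_zero.1 h1.symm).resolve_right hc.ne'
  · filter_upwards [ae_ne_zero hd] with x hx
    rw [rot_ext hf hr hx]

/-- Integration by parts on spheres. -/
lemma integral_mul_Lap_sphere (hd : 0 < d) (hr : 0 < r) {g : E d → ℝ} (hf : SP 1 f) (hg : SP 2 g) :
    ∫ ω, f (r • ω.1) * Lap g (r • ω.1) ∂dω d = -∫ ω, Gam f g (r • ω.1) ∂dω d := by
  have h0 : ∀ i j : Fin d, SP 1 (fun y => f y * rot[i, j] g y) := fun i j => hf.mul (hg.rot i j)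
  have h1 : ∫ ω, 1 / 2 * ∑ i, ∑ j, rot[i, j] (fun y => f y * rot[i, j] g y) (r • ω.1) ∂dω d = 0 := by
    rw [integral_const_mul, integral_finsetSum]
    · have : ∀ i : Fin d, ∫ ω, ∑ j, rot[i, j] (fun y => f y * rot[i, j] g y) (r • ω.1) ∂dω d = 0 :=
        fun i => by
          rw [integral_finsetSum _ fun j _ => ((h0 i j).rot i j).integrable_sphere hr]
          exact Finset.sum_eq_zero fun j _ => integral_rot_sphere hd hr (h0 i j) i j
      simp [this]
    · exact fun i _ => integrable_finsetSum _ fun j _ => ((h0 i j).rot i j).integrable_sphere hr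
  have hg1 : SP 1 g := hg.mono (by norm_num)
  have hL : SP 0 (Lap g) := SP.Lap hg
  have hG : SP 0 (Gam f g) := SP.Gam hf hg1
  rw [← sub_eq_zero, sub_neg_eq_add, ← h1, ← integral_add
    (((hf.mono (by norm_num)).mul hL).integrable_sphere hr) (hG.integrable_sphere hr)]
  refine integral_congr_ae (Filter.Eventually.of_forall fun ω => ?_)
  have hx := sphere_smul_ne_zero hr ω
  simp only [X_mul hf (hg.rot _ _) hx, Finset.sum_add_distrib, Lap, Gam, ← Finset.mul_sum]
  simp only [mul_comm (X _ g (r • ω.1))]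
  ring

end sphere

/-! ### The curvature-dimension inequality of the sphere. -/

/-- Here `A` and `v` stand for the Euclidean Hessian and gradient, at a unit vector `x`, of a
function constant along rays. The spherical Hessian is then `A + v ⊗ x + x ⊗ v`, which annihilates
`x`. The claim expands the squared norm of this matrix plus `t v ⊗ v` minus `c` times the tangential
projection. -/
lemma tangential_trace_ineq {ι : Type*} [Fintype ι] [DecidableEq ι] (A : ι → ι → ℝ) (x v : ι → ℝ)
    (hA : ∀ i j, A i j = A j i) (hx : ∑ i, x i * x i = 1) (hv : ∑ i, v i * x i = 0)
    (hAx : ∀ i, ∑ j, A i j * x j = -v i) (t c : ℝ) :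
    0 ≤ (∑ i, ∑ j, A i j ^ 2) - 2 * (∑ i, v i * v i) + 2 * t * (∑ i, v i * ∑ j, A i j * v j)
      + t ^ 2 * (∑ i, v i * v i) ^ 2 - 2 * c * ((∑ i, A i i) + t * ∑ i, v i * v i)
      + c ^ 2 * ((Fintype.card ι : ℝ) - 1) := by
  have h0 : 0 ≤ ∑ i, ∑ j, (A i j + v i * x j + x i * v j + t * (v i * v j)
      - c * ((if i = j then 1 else 0) - x i * x j)) ^ 2 :=
    Finset.sum_nonneg fun i _ => Finset.sum_nonneg fun j _ => sq_nonneg _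
  have h : ∀ i j, (A i j + v i * x j + x i * v j + t * (v i * v j)
      - c * ((if i = j then 1 else 0) - x i * x j)) ^ 2 =
      A i j ^ 2 + 2 * (v i * (A i j * x j)) + 2 * (x i * (A i j * v j))
      + 2 * t * (v i * (A i j * v j)) + 2 * c * (x i * (A i j * x j))
      + (v i * v i) * (x j * x j) + (x i * x i) * (v j * v j) + t ^ 2 * ((v i * v i) * (v j * v j))
      + c ^ 2 * ((x i * x i) * (x j * x j)) + 2 * ((v i * x i) * (v j * x j))
      + 2 * t * ((v i * v i) * (v j * x j)) + 2 * t * ((v i * x i) * (v j * v j))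
      + 2 * c * ((v i * x i) * (x j * x j)) + 2 * c * ((x i * x i) * (v j * x j))
      + 2 * t * c * ((v i * x i) * (v j * x j))
      + (if i = j then c ^ 2 - 2 * c * A i i - 4 * c * (v i * x i) - 2 * c * t * (v i * v i)
        - 2 * c ^ 2 * (x i * x i) else 0) := fun i j => by
    by_cases hij : i = j
    · subst hij; simp; ring
    · simp [hij]; ring
  have h3 : ∑ i, x i * ∑ j, A i j * v j = -∑ i, v i * v i := by
    simp only [Finset.mul_sum]
    rw [Finset.sum_comm, ← Finset.sum_neg_distrib]
    refine Finset.sum_congr rfl fun j _ => ?_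
    have := hAx j
    calc ∑ i, x i * (A i j * v j) = v j * ∑ i, A j i * x i := by
          rw [Finset.mul_sum]; exact Finset.sum_congr rfl fun i _ => by rw [hA i j]; ring
      _ = _ := by rw [this]; ring
  simp only [h, Finset.sum_add_distrib, Finset.sum_sub_distrib, ← Finset.mul_sum, ← Finset.sum_mul,
    Finset.sum_ite_eq, Finset.mem_univ, if_true, hx, hv, hAx, h3, Finset.sum_const,
    Finset.card_univ, nsmul_eq_mul] at h0
  have e1 : ∑ i, v i * -v i = -∑ i, v i * v i := by simp
  have e2 : ∑ i, x i * -v i = 0 := by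
    rw [← neg_zero, ← hv, ← Finset.sum_neg_distrib]
    exact Finset.sum_congr rfl fun i _ => by ring
  rw [e1, e2] at h0
  linarith

section
variable {f p W : E d → ℝ} {x : E d}

lemma eul_congr {g : E d → ℝ} (h : ∀ y, y ≠ 0 → f y = g y) (hx : x ≠ 0) : eul f x = eul g x := by
  simp only [eul, X_congr h hx]

lemma SP.norm_sq {k : ℕ} : SP k (fun y : E d => ‖y‖ ^ 2) := SP.norm.pow 2

lemma pd_norm_sq (i : Fin d) (x : E d) : pd[i] (fun y : E d => ‖y‖ ^ 2) x = 2 * x i := by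
  rw [X, (hasStrictFDerivAt_norm_sq x).hasFDerivAt.fderiv]
  simp [cst, EuclideanSpace.inner_single_right]

lemma pd_norm_sq_mul (hf : SP 1 f) (hx : x ≠ 0) (i : Fin d) :
    pd[i] (fun y => ‖y‖ ^ 2 * f y) x = ‖x‖ ^ 2 * pd[i] f x + 2 * (x i * f x) := by
  rw [X_mul SP.norm_sq hf hx, pd_norm_sq]; ring

lemma sum_pd_pd_norm_sq_mul (hf : SP 2 f) (hx : x ≠ 0) :
    ∑ i, pd[i] (pd[i] (fun y => ‖y‖ ^ 2 * f y)) x =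
      ‖x‖ ^ 2 * (∑ i, pd[i] (pd[i] f) x) + 4 * eul f x + 2 * d * f x := by
  have hf1 : SP 1 f := hf.mono (by norm_num)
  have h : ∀ i : Fin d, pd[i] (pd[i] (fun y => ‖y‖ ^ 2 * f y)) x =
      ‖x‖ ^ 2 * pd[i] (pd[i] f) x + 4 * (x i * pd[i] f x) + 2 * f x := fun i => by
    have s1 : SP 1 (fun y : E d => y i * f y) := (SP.coord i).mul hf1
    rw [X_congr (fun y hy => pd_norm_sq_mul hf1 hy i) hx,
      X_add (SP.norm_sq.mul (hf.pd i)) ((SP.const _).mul s1) hx, pd_norm_sq_mul (hf.pd i) hx,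
      X_const_mul _ s1 hx, X_mul (SP.coord i) hf1 hx, pd_coord, if_pos rfl]
    ring
  simp only [h, Finset.sum_add_distrib, ← Finset.mul_sum, Finset.sum_const, Finset.card_univ,
    Fintype.card_fin, nsmul_eq_mul, eul]
  ring

lemma Gam_of_eul_eq_zero {g : E d → ℝ} (hf : eul f x = 0) :
    Gam f g x = ‖x‖ ^ 2 * ∑ i, pd[i] f x * pd[i] g x := by
  rw [Gam_eq, hf]; ring

/-- The Bochner formula for functions that are constant along rays. -/
lemma bochner_flat (hW : SP 3 W) (h0 : ∀ y, y ≠ 0 → eul W y = 0)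
    (h1 : ∀ y, y ≠ 0 → eul (Gam W W) y = 0) (hx : ‖x‖ = 1) :
    1 / 2 * Lap (Gam W W) x - Gam W (Lap W) x =
        (∑ i, ∑ j, pd[i] (pd[j] W) x ^ 2) + ((d : ℝ) - 4) * ∑ i, pd[i] W x * pd[i] W x ∧
      Gam W (Gam W W) x = 2 * ∑ i, pd[i] W x * ∑ j, pd[i] (pd[j] W) x * pd[j] W x := by
  have hx0 : x ≠ 0 := by rw [← norm_ne_zero_iff, hx]; exact one_ne_zero
  have W2 : SP 2 W := hW.mono (by norm_num)
  let Q : E d → ℝ := fun y => ∑ i, pd[i] W y * pd[i] W y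
  let D : E d → ℝ := fun y => ∑ i, pd[i] (pd[i] W) y
  have P2 : ∀ i : Fin d, SP 2 (pd[i] W) := fun i => SP.pd hW i
  have P1 : ∀ i : Fin d, SP 1 (pd[i] W) := fun i => (P2 i).mono (by norm_num)
  have PP1 : ∀ i j : Fin d, SP 1 (pd[i] (pd[j] W)) := fun i j => SP.pd (P2 j) i
  have Q2 : SP 2 Q := SP.sum fun i _ => (P2 i).mul (P2 i)
  have D1 : SP 1 D := SP.sum fun i _ => PP1 i i
  have hG : ∀ y, y ≠ 0 → Gam W W y = ‖y‖ ^ 2 * Q y := fun y hy => Gam_of_eul_eq_zero (h0 y hy)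
  have hL : ∀ y, y ≠ 0 → Lap W y = ‖y‖ ^ 2 * D y := fun y hy => Lap_of_eul_eq_zero W2 h0 hy
  have hv : ∑ i, x i * pd[i] W x = 0 := h0 x hx0
  -- Differentiating `x · ∇W = 0`: the Hessian maps `x` to `-∇W`.
  have hAx : ∀ i, ∑ j, x j * pd[i] (pd[j] W) x = -pd[i] W x := fun i => by
    have h := pd_eul W2 hx0 i
    rw [X_congr (g := fun _ => 0) h0 hx0, X_const] at h
    linarith
  have pQ : ∀ y, y ≠ 0 → ∀ i, pd[i] Q y = 2 * ∑ k, pd[i] (pd[k] W) y * pd[k] W y :=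
    fun y hy i => by
      change pd[i] (fun y => ∑ k, pd[k] W y * pd[k] W y) y = _
      rw [X_sum (fun k _ => (P1 k).mul (P1 k)) hy, Finset.mul_sum]
      refine Finset.sum_congr rfl fun k _ => ?_
      rw [X_mul (P1 k) (P1 k) hy]; ring
  have ppQ : ∀ i, pd[i] (pd[i] Q) x = 2 * ∑ k, (pd[i] (pd[k] W) x ^ 2
      + pd[k] W x * pd[i] (pd[i] (pd[k] W)) x) := fun i => by
    have s : ∀ k, SP 1 (fun y => pd[i] (pd[k] W) y * pd[k] W y) := fun k => (PP1 i k).mul (P1 k)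
    rw [X_congr (fun y hy => pQ y hy i) hx0, X_const_mul _ (SP.sum fun k _ => s k) hx0,
      X_sum (fun k _ => s k) hx0]
    congr 1
    refine Finset.sum_congr rfl fun k _ => ?_
    rw [X_mul (PP1 i k) (P1 k) hx0]; ring
  have eQ : eul Q x = -2 * Q x := by
    simp only [eul, pQ x hx0, Finset.mul_sum, Q]
    rw [Finset.sum_comm]
    refine Finset.sum_congr rfl fun k _ => ?_
    have := hAx k
    calc _ = 2 * pd[k] W x * ∑ j, x j * pd[k] (pd[j] W) x := by
          rw [Finset.mul_sum]
          exact Finset.sum_congr rfl fun j _ => by rw [pd_comm W2 j k hx0]; ring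
      _ = _ := by rw [this]; ring
  have pD : ∀ i, pd[i] D x = ∑ k, pd[k] (pd[k] (pd[i] W)) x := fun i => by
    change pd[i] (fun y => ∑ k, pd[k] (pd[k] W) y) x = _
    rw [X_sum (fun k _ => PP1 k k) hx0]
    refine Finset.sum_congr rfl fun k _ => ?_
    rw [pd_comm (P2 k) i k hx0]
    exact X_congr (fun y hy => pd_comm W2 i k hy) hx0
  have e1 : Gam W (Gam W W) x = 2 * ∑ i, pd[i] W x * ∑ j, pd[i] (pd[j] W) x * pd[j] W x := by
    rw [Gam_congr (fun _ _ => rfl) hG hx0, Gam_of_eul_eq_zero (h0 x hx0), hx]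
    simp only [pd_norm_sq_mul (Q2.mono (by norm_num)) hx0, hx, pQ x hx0, mul_add,
      Finset.sum_add_distrib]
    have : ∑ i, pd[i] W x * (2 * (x i * Q x)) = 2 * Q x * ∑ i, x i * pd[i] W x := by
      rw [Finset.mul_sum]; exact Finset.sum_congr rfl fun i _ => by ring
    rw [this, hv]
    simp only [one_pow, one_mul, mul_zero, add_zero, mul_left_comm _ (2 : ℝ), ← Finset.mul_sum]
  have e2 : Gam W (Lap W) x = ∑ i, pd[i] W x * ∑ k, pd[k] (pd[k] (pd[i] W)) x := by
    rw [Gam_congr (fun _ _ => rfl) hL hx0, Gam_of_eul_eq_zero (h0 x hx0), hx]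
    simp only [pd_norm_sq_mul D1 hx0, hx, pD, mul_add, Finset.sum_add_distrib]
    have : ∑ i, pd[i] W x * (2 * (x i * D x)) = 2 * D x * ∑ i, x i * pd[i] W x := by
      rw [Finset.mul_sum]; exact Finset.sum_congr rfl fun i _ => by ring
    rw [this, hv]
    simp
  have e3 : Lap (Gam W W) x = ∑ i, pd[i] (pd[i] Q) x - 8 * Q x + 2 * d * Q x := by
    rw [Lap_of_eul_eq_zero (SP.Gam hW hW) h1 hx0, hx, one_pow, one_mul]
    have : ∀ i, pd[i] (pd[i] (Gam W W)) x = pd[i] (pd[i] (fun y => ‖y‖ ^ 2 * Q y)) x :=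
      fun i => X_congr (fun y hy => X_congr hG hy) hx0
    simp only [this]
    rw [sum_pd_pd_norm_sq_mul Q2 hx0, eQ, hx]
    ring
  refine ⟨?_, e1⟩
  rw [e2, e3]
  simp only [ppQ, ← Finset.mul_sum, Finset.sum_add_distrib]
  have : ∑ i, ∑ k, pd[k] W x * pd[i] (pd[i] (pd[k] W)) x =
      ∑ i, pd[i] W x * ∑ k, pd[k] (pd[k] (pd[i] W)) x := by
    rw [Finset.sum_comm]; simp only [Finset.mul_sum]
  rw [this]
  simp only [Q]
  ring

/-- The curvature-dimension inequality of the sphere in the form that allows for an additional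
gradient term. -/
theorem curvature_dimension (hd : 2 ≤ d) (hp : SP 3 p) (hx : x ≠ 0) (t : ℝ) :
    ((d : ℝ) - 2) * Gam p p x + (Lap p x + t * Gam p p x) ^ 2 / ((d : ℝ) - 1) ≤
      1 / 2 * Lap (Gam p p) x - Gam p (Lap p) x + t * Gam p (Gam p p) x
        + t ^ 2 * Gam p p x ^ 2 := by
  have hr : 0 < ‖x‖ := norm_pos_iff.2 hx
  have hω := dir_ne_zero hx
  set ω := dir x with hωdef
  set W := ext ‖x‖ p with hWdef
  have hext : ∀ f : E d → ℝ, ext ‖x‖ f ω = f x := fun f => by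
    rw [ext, hωdef, dir_dir hx, norm_smul_dir hx]
  have p2 : SP 2 p := hp.mono (by norm_num)
  have p1 : SP 1 p := hp.mono (by norm_num)
  have G2 : SP 2 (Gam p p) := SP.Gam hp hp
  have G1 : SP 1 (Gam p p) := G2.mono (by norm_num)
  have L1 : SP 1 (Lap p) := SP.Lap hp
  have hW : SP 3 W := hp.ext hr
  have gW : ∀ y, y ≠ 0 → Gam W W y = ext ‖x‖ (Gam p p) y := fun y hy => Gam_ext p1 p1 hr hy
  have lW : ∀ y, y ≠ 0 → Lap W y = ext ‖x‖ (Lap p) y := fun y hy => Lap_ext p2 hr hy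
  have h0 : ∀ y, y ≠ 0 → eul W y = 0 := fun y hy => eul_ext p1 hr hy
  have h1 : ∀ y, y ≠ 0 → eul (Gam W W) y = 0 := fun y hy => by
    rw [eul_congr gW hy, eul_ext G1 hr hy]
  have a1 : Gam p p x = Gam W W ω := by rw [gW ω hω, hext]
  have a2 : Lap p x = Lap W ω := by rw [lW ω hω, hext]
  have a3 : Lap (Gam p p) x = Lap (Gam W W) ω := by
    rw [Lap_congr gW hω, Lap_ext G2 hr hω, hext]
  have a4 : Gam p (Lap p) x = Gam W (Lap W) ω := by
    rw [Gam_congr (fun _ _ => rfl) lW hω, Gam_ext p1 L1 hr hω, hext]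
  have a5 : Gam p (Gam p p) x = Gam W (Gam W W) ω := by
    rw [Gam_congr (fun _ _ => rfl) gW hω, Gam_ext p1 G1 hr hω, hext]
  have hn : ‖ω‖ = 1 := norm_dir hx
  obtain ⟨b1, b2⟩ := bochner_flat hW h0 h1 hn
  rw [a3, a4, a5, b1, b2, a1, a2, Lap_of_eul_eq_zero (hW.mono (by norm_num)) h0 hω,
    Gam_of_eul_eq_zero (h0 ω hω), hn]
  have hd' : (0 : ℝ) < (d : ℝ) - 1 := by
    have : (2 : ℝ) ≤ d := by exact_mod_cast hd
    linarith
  set Q := ∑ i, pd[i] W ω * pd[i] W ω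
  set D := ∑ i, pd[i] (pd[i] W) ω
  -- The value of `c` is the trace `D + t Q` divided by the dimension `d - 1` of the sphere, so that
  -- the trace-free part is what gets squared.
  have key := tangential_trace_ineq (fun i j => pd[i] (pd[j] W) ω) (fun i => ω i)
    (fun i => pd[i] W ω) (fun i j => pd_comm (hW.mono (by norm_num)) i j hω)
    (by rw [sum_coord_sq, hn]; norm_num)
    (by rw [← h0 ω hω, eul]; exact Finset.sum_congr rfl fun i _ => mul_comm _ _)
    (fun i => by
      have h := pd_eul (hW.mono (by norm_num)) hω i
      rw [X_congr (g := fun _ => 0) h0 hω, X_const] at h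
      simp only [mul_comm (X _ (X _ W) ω)]
      linarith) t ((D + t * Q) / ((d : ℝ) - 1))
  simp only [Fintype.card_fin] at key
  have e : (D + t * Q) ^ 2 / ((d : ℝ) - 1) = 2 * ((D + t * Q) / ((d : ℝ) - 1)) * (D + t * Q)
      - ((D + t * Q) / ((d : ℝ) - 1)) ^ 2 * ((d : ℝ) - 1) := by
    field_simp; ring
  rw [one_pow, one_mul, one_mul, e]
  linarith

end

/-! ### Wirtinger's inequality on the circle. -/

/-- Wirtinger's inequality. -/
theorem wirtinger {g g' : ℝ → ℝ} (hg : ∀ θ, HasDerivAt g (g' θ) θ) (hc : Continuous g')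
    (hper : g Real.pi = g (-Real.pi)) (h0 : ∫ θ in (-Real.pi)..Real.pi, g θ = 0) :
    ∫ θ in (-Real.pi)..Real.pi, g θ ^ 2 ≤ ∫ θ in (-Real.pi)..Real.pi, g' θ ^ 2 := by
  have hab : -Real.pi < Real.pi := by linarith [Real.pi_pos]
  have hgc : Continuous g := continuous_iff_continuousAt.2 fun θ => (hg θ).continuousAt
  have hmem : ∀ f : ℝ → ℝ, Continuous f →
      MemLp (fun θ => (f θ : ℂ)) 2 (volume.restrict (Ioc (-Real.pi) Real.pi)) := fun f hf => by
    obtain ⟨C, hC⟩ := (isCompact_Icc (a := -Real.pi) (b := Real.pi)).exists_bound_of_continuousOn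
      hf.continuousOn
    refine MemLp.of_bound (Complex.continuous_ofReal.comp hf).aestronglyMeasurable C ?_
    filter_upwards [ae_restrict_mem measurableSet_Ioc] with θ hθ
    rw [Complex.norm_real]
    exact hC θ (Ioc_subset_Icc_self hθ)
  have s1 := hasSum_sq_fourierCoeffOn hab (hmem g hgc)
  have s2 := hasSum_sq_fourierCoeffOn hab (hmem g' hc)
  have hpos : 0 < (Real.pi - -Real.pi)⁻¹ := inv_pos.2 (by linarith)
  have hle := hasSum_le (fun k => ?_) s1 s2
  · simp only [Complex.norm_real, Real.norm_eq_abs, sq_abs, smul_eq_mul] at hle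
    exact le_of_mul_le_mul_left hle hpos
  -- The mean-zero condition disposes of the zeroth mode. Every other mode of the derivative carries
  -- a factor `i k` with `|k| ≥ 1`, as the boundary term vanishes by periodicity.
  by_cases hk : k = 0
  · have : fourierCoeffOn hab (fun θ => (g θ : ℂ)) 0 = 0 := by
      have h1 : ∫ θ in (-Real.pi)..Real.pi, (g θ : ℂ) = 0 := by
        rw [intervalIntegral.integral_ofReal, h0, Complex.ofReal_zero]
      rw [fourierCoeffOn_eq_integral]
      simp [h1]
    rw [hk, this]
    simp
  have h := fourierCoeffOn_of_hasDerivAt hab hk (f := fun θ => (g θ : ℂ))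
    (f' := fun θ => (g' θ : ℂ)) (fun θ _ => (hg θ).ofReal_comp)
    ((Complex.continuous_ofReal.comp hc).intervalIntegrable _ _)
  rw [hper, sub_self, mul_zero, zero_sub] at h
  have hpi : (Real.pi : ℂ) ≠ 0 := by exact_mod_cast Real.pi_ne_zero
  have hkc : (k : ℂ) ≠ 0 := by exact_mod_cast hk
  have h2 : fourierCoeffOn hab (fun θ => (g' θ : ℂ)) k
      = Complex.I * k * fourierCoeffOn hab (fun θ => (g θ : ℂ)) k := by
    rw [h]; push_cast; field_simp; ring
  have hk1 : (1 : ℝ) ≤ |(k : ℝ)| := by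
    rw [← Int.cast_abs]; exact_mod_cast Int.one_le_abs hk
  have hn : ‖(k : ℂ)‖ = |(k : ℝ)| := by rw [Complex.norm_intCast]
  rw [h2, norm_mul, norm_mul, Complex.norm_I, one_mul, hn]
  exact pow_le_pow_left₀ (norm_nonneg _) (le_mul_of_one_le_left (norm_nonneg _) hk1) 2

/-- The unit circle. -/
def circ (θ : ℝ) : E 2 := !₂[Real.cos θ, Real.sin θ]

lemma norm_circ (θ : ℝ) : ‖circ θ‖ = 1 := by
  rw [EuclideanSpace.norm_eq]; simp [circ]

lemma circ_ne_zero (θ : ℝ) : circ θ ≠ 0 := by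
  rw [← norm_ne_zero_iff, norm_circ]; exact one_ne_zero

lemma integral_E_two (F : E 2 → ℝ) : ∫ x, F x = ∫ p : ℝ × ℝ, F !₂[p.1, p.2] := by
  have h1 := (EuclideanSpace.volume_preserving_symm_measurableEquiv_toLp (Fin 2)).symm
  have h2 := (volume_preserving_finTwoArrow ℝ).symm
  rw [← h1.integral_comp (MeasurableEquiv.measurableEmbedding _),
    ← h2.integral_comp (MeasurableEquiv.measurableEmbedding _)]
  rfl

/-- Both sides come from evaluating the planar integral of `cutoff * ext r f` in two kinds of polar
coordinates. This compares the surface measure with arc length up to constants, which is enough for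
a homogeneous inequality. -/
lemma exists_integral_circ (r : ℝ) : ∃ a b : ℝ, 0 < a ∧ 0 ≤ b ∧ ∀ f : E 2 → ℝ,
    a * ∫ ω, f (r • ω.1) ∂dω 2 = b * ∫ θ in (-Real.pi)..Real.pi, f (r • circ θ) := by
  obtain ⟨c, hc, h⟩ := exists_integral_cutoff_mul_ext (d := 2) two_pos r
  let β : ContDiffBump (0 : ℝ) := ⟨1, 2, one_pos, one_lt_two⟩
  refine ⟨c, ∫ s in Ioi (0 : ℝ), s * β (Real.log s / ((0 : ℕ) + 1)), hc,
    setIntegral_nonneg measurableSet_Ioi fun s hs => mul_nonneg (le_of_lt hs) β.nonneg, fun f => ?_⟩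
  rw [mul_comm, ← h f, integral_E_two, ← integral_comp_polarCoord_symm, polarCoord_target,
    intervalIntegral.integral_of_le (by linarith [Real.pi_pos]), integral_Ioc_eq_integral_Ioo,
    ← setIntegral_prod_mul]
  refine setIntegral_congr_fun (measurableSet_Ioi.prod measurableSet_Ioo) fun p hp => ?_
  have hp1 : 0 < p.1 := hp.1
  have e : (!₂[(polarCoord.symm p).1, (polarCoord.symm p).2] : E 2) = p.1 • circ p.2 := by
    ext i; fin_cases i <;> simp [circ, polarCoord]
  have hn : ‖p.1 • circ p.2‖ = p.1 := by
    rw [norm_smul, norm_circ, mul_one, Real.norm_of_nonneg hp1.le]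
  have hd : dir (p.1 • circ p.2) = circ p.2 := by
    rw [dir_smul hp1, dir, norm_circ, inv_one, one_smul]
  beta_reduce
  rw [e, ext, hd, cutoff_of_ne (smul_ne_zero hp1.ne' (circ_ne_zero _)), hn, smul_eq_mul, mul_assoc]

lemma hasDerivAt_circ (r θ : ℝ) :
    HasDerivAt (fun θ => r • circ θ) (rotF 0 1 (r • circ θ)) θ := by
  have h : HasDerivAt circ (rotF 0 1 (circ θ)) θ := by
    have h1 := ((Real.hasDerivAt_cos θ).smul_const (EuclideanSpace.single 0 1 : E 2)).add
      ((Real.hasDerivAt_sin θ).smul_const (EuclideanSpace.single 1 1 : E 2))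
    have h2 : circ = (fun θ => Real.cos θ • (EuclideanSpace.single 0 1 : E 2)) +
        fun θ => Real.sin θ • (EuclideanSpace.single 1 1 : E 2) := by
      ext θ i; fin_cases i <;> simp [circ]
    rw [h2]
    refine h1.congr_deriv ?_
    ext i; fin_cases i <;> simp
  rw [rotF_smul]
  exact h.const_smul r

lemma hasDerivAt_comp_circ {f : E 2 → ℝ} (hf : SP 1 f) {r : ℝ} (hr : 0 < r) (θ : ℝ) :
    HasDerivAt (fun θ => f (r • circ θ)) (rot[0, 1] f (r • circ θ)) θ :=
  (hf.diff (smul_ne_zero hr.ne' (circ_ne_zero θ))).hasFDerivAt.comp_hasDerivAt θ (hasDerivAt_circ r θ)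

/-- The Poincaré inequality for derivatives on circles. -/
theorem wirtinger_sphere {f : E 2 → ℝ} (hf : SP 2 f) {r : ℝ} (hr : 0 < r) :
    ∫ ω, Gam f f (r • ω.1) ∂dω 2 ≤ ∫ ω, Lap f (r • ω.1) ^ 2 ∂dω 2 := by
  obtain ⟨a, b, ha, hb, h⟩ := exists_integral_circ r
  have hf1 : SP 1 f := hf.mono (by norm_num)
  have hg : SP 1 (rot[0, 1] f) := SP.rot hf 0 1
  have hgg : SP 0 (rot[0, 1] (rot[0, 1] f)) := SP.rot hg 0 1
  have e1 : ∀ x, Gam f f x = rot[0, 1] f x ^ 2 := fun x => by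
    simp [Gam, Fin.sum_univ_two, rot_eq]; ring
  have e2 : ∀ x, x ≠ 0 → Lap f x = rot[0, 1] (rot[0, 1] f) x := fun x hx => by
    have h1 : ∀ y, rot[1, 0] f y = - rot[0, 1] f y := fun y => by
      rw [rot_eq, rot_eq]; ring
    have h2 : rot[1, 0] (rot[1, 0] f) x = rot[0, 1] (rot[0, 1] f) x := by
      rw [X_congr (fun y _ => h1 y) hx, X_neg, rot_eq, rot_eq]; ring
    have h3 : ∀ (i : Fin 2) (f : E 2 → ℝ) y, rot[i, i] f y = 0 := fun i f y => by
      rw [rot_eq]; ring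
    simp only [Lap, Fin.sum_univ_two, h2, h3]; ring
  have i1 : ∫ ω, Gam f f (r • ω.1) ∂dω 2 = ∫ ω, (fun x => rot[0, 1] f x ^ 2) (r • ω.1) ∂dω 2 :=
    integral_congr_ae (Filter.Eventually.of_forall fun ω => e1 _)
  have i2 : ∫ ω, Lap f (r • ω.1) ^ 2 ∂dω 2 =
      ∫ ω, (fun x => rot[0, 1] (rot[0, 1] f) x ^ 2) (r • ω.1) ∂dω 2 :=
    integral_congr_ae (Filter.Eventually.of_forall fun ω => by
      beta_reduce; rw [e2 _ (sphere_smul_ne_zero hr ω)])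
  rw [i1, i2]
  refine le_of_mul_le_mul_left ?_ ha
  rw [h (fun x => rot[0, 1] f x ^ 2), h (fun x => rot[0, 1] (rot[0, 1] f) x ^ 2)]
  have hmean := h (rot[0, 1] f)
  rw [integral_rot_sphere two_pos hr hf1 0 1, mul_zero] at hmean
  -- The comparison does not exclude `b = 0`, but then both sides vanish. Otherwise the rotation
  -- derivative has mean zero in the angle, as Wirtinger's inequality requires.
  rcases mul_eq_zero.1 hmean.symm with hb0 | hm
  · rw [hb0, zero_mul, zero_mul]
  refine mul_le_mul_of_nonneg_left ?_ hb
  refine wirtinger (fun θ => hasDerivAt_comp_circ hg hr θ) ?_ ?_ hm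
  · rw [continuous_iff_continuousAt]
    intro θ
    have h1 : ContinuousAt (rot[0, 1] (rot[0, 1] f)) (r • circ θ) :=
      (hgg _ (smul_ne_zero hr.ne' (circ_ne_zero θ))).continuousAt
    exact h1.comp (f := fun θ => r • circ θ) (hasDerivAt_circ r θ).continuousAt
  · simp [circ]

/-! ### Weighted inequalities on spheres. -/

/-- The integral over the sphere of radius `r` with respect to the measure of the unit sphere. -/
def sint (r : ℝ) (f : E d → ℝ) : ℝ := ∫ ω, f (r • ω.1) ∂dω d

section
variable {r : ℝ} {f g p u : E d → ℝ}

lemma sint_congr (hr : 0 < r) (h : ∀ x, x ≠ 0 → f x = g x) : sint r f = sint r g :=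
  integral_congr_ae (Filter.Eventually.of_forall fun ω => h _ (sphere_smul_ne_zero hr ω))

lemma sint_add (hr : 0 < r) (hf : SP 0 f) (hg : SP 0 g) :
    sint r (fun x => f x + g x) = sint r f + sint r g :=
  integral_add (hf.integrable_sphere hr) (hg.integrable_sphere hr)

lemma sint_const_mul (c : ℝ) (f : E d → ℝ) : sint r (fun x => c * f x) = c * sint r f :=
  integral_const_mul _ _

lemma sint_mono (hr : 0 < r) (hf : SP 0 f) (hg : SP 0 g) (h : ∀ x, x ≠ 0 → f x ≤ g x) :
    sint r f ≤ sint r g :=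
  integral_mono (hf.integrable_sphere hr) (hg.integrable_sphere hr)
    fun ω => h _ (sphere_smul_ne_zero hr ω)

lemma sint_mul_Lap (hd : 0 < d) (hr : 0 < r) (hf : SP 1 f) (hg : SP 2 g) :
    sint r (fun x => f x * Lap g x) = -sint r (Gam f g) :=
  integral_mul_Lap_sphere hd hr hf hg

/-- The functions whose logarithmic rotation derivatives are those of `p`. -/
def LogRot (p u : E d → ℝ) : Prop := ∀ x, x ≠ 0 → ∀ i j, rot[i, j] u x = u x * rot[i, j] p x

lemma LogRot.Gam (h : LogRot p u) {x : E d} (hx : x ≠ 0) : Gam f u x = u x * Gam f p x := by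
  simp only [WLS.Gam, h x hx, Finset.mul_sum]
  exact Finset.sum_congr rfl fun i _ => Finset.sum_congr rfl fun j _ => by ring

/-- The carré du champ itéré of the sphere. -/
def Gam2 (p : E d → ℝ) (x : E d) : ℝ := 1 / 2 * Lap (Gam p p) x - Gam p (Lap p) x

lemma SP.Gam2 (hp : SP 3 p) : SP 0 (Gam2 p) := by
  have h1 : SP 2 (WLS.Gam p p) := SP.Gam hp hp
  have h2 : SP 1 (WLS.Lap p) := SP.Lap hp
  exact SP.sub ((SP.const _).mul (SP.Lap h1)) (SP.Gam (k := 0) (hp.mono (by norm_num)) h2)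

/-- Integration by parts of `Δ_ω p` against `Γ u`. The last term arises because the angular gradient
of `u` is `u` times that of `p`. -/
lemma sint_Gam_mul_Lap (hd : 0 < d) (hr : 0 < r) (hp : SP 3 p) (hu : SP 2 u) (h : LogRot p u) :
    sint r (fun x => Gam p p x * Lap p x * u x) =
    -sint r (fun x => Gam p (Gam p p) x * u x) - sint r (fun x => Gam p p x ^ 2 * u x) := by
  have p2 : SP 2 p := hp.mono (by norm_num)
  have p1 : SP 1 p := hp.mono (by norm_num)
  have u1 : SP 1 u := hu.mono (by norm_num)
  have u0 : SP 0 u := hu.mono (by norm_num)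
  have G2 : SP 2 (Gam p p) := SP.Gam hp hp
  have G1 : SP 1 (Gam p p) := G2.mono (by norm_num)
  have G0 : SP 0 (Gam p p) := G2.mono (by norm_num)
  have GG : SP 0 (Gam p (Gam p p)) := SP.Gam p1 G1
  have e := sint_mul_Lap hd hr (G1.mul u1) p2
  rw [sint_congr hr (g := fun x => Gam p p x * Lap p x * u x) (fun x _ => by ring)] at e
  rw [e, sint_congr hr (g := fun x => Gam p (Gam p p) x * u x + Gam p p x ^ 2 * u x), sint_add hr
    (GG.mul u0) ((G0.pow 2).mul u0)]
  · ring
  · intro x hx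
    rw [Gam_comm, Gam_mul G1 u1 hx, h.Gam hx]
    ring

/-- Integrating both terms of `Γ₂` by parts. With `sint_Gam_mul_Lap` this gives `∫ Γ₂ u = X + (3/2)
Y + (1/2) Z`, where `X`, `Y`, `Z` are the integrals of `(Δ_ω p)² u`, `Γ Δ_ω p u` and `Γ² u`. -/
lemma sint_Gam2 (hd : 0 < d) (hr : 0 < r) (hp : SP 3 p) (hu : SP 2 u) (h : LogRot p u) :
    sint r (fun x => Gam2 p x * u x) = sint r (fun x => Lap p x ^ 2 * u x)
    + sint r (fun x => Gam p p x * Lap p x * u x)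
    - 1 / 2 * sint r (fun x => Gam p (Gam p p) x * u x) := by
  have p2 : SP 2 p := hp.mono (by norm_num)
  have p1 : SP 1 p := hp.mono (by norm_num)
  have u1 : SP 1 u := hu.mono (by norm_num)
  have u0 : SP 0 u := hu.mono (by norm_num)
  have G2 : SP 2 (Gam p p) := SP.Gam hp hp
  have G1 : SP 1 (Gam p p) := G2.mono (by norm_num)
  have G0 : SP 0 (Gam p p) := G2.mono (by norm_num)
  have LG0 : SP 0 (Lap (Gam p p)) := SP.Lap G2
  have L1 : SP 1 (Lap p) := SP.Lap hp
  have L0 : SP 0 (Lap p) := L1.mono (by norm_num)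
  have GL0 : SP 0 (Gam p (Lap p)) := SP.Gam p1 L1
  have e1 : sint r (fun x => u x * Lap (Gam p p) x) = -sint r (fun x => Gam p (Gam p p) x * u x) := by
    rw [sint_mul_Lap hd hr u1 G2]
    congr 1
    refine sint_congr hr fun x hx => ?_
    rw [Gam_comm, h.Gam hx, Gam_comm]; ring
  have e2 : sint r (fun x => Lap p x ^ 2 * u x) = -(sint r (fun x => Gam p (Lap p) x * u x)
      + sint r (fun x => Gam p p x * Lap p x * u x)) := by
    have e := sint_mul_Lap hd hr (L1.mul u1) p2
    rw [sint_congr hr (g := fun x => Lap p x ^ 2 * u x) (fun x _ => by ring)] at e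
    rw [e, ← sint_add hr (GL0.mul u0) ((G0.mul L0).mul u0)]
    congr 1
    refine sint_congr hr fun x hx => ?_
    rw [Gam_comm, Gam_mul L1 u1 hx, h.Gam hx]
    ring
  have e3 : sint r (fun x => Gam2 p x * u x) =
      1 / 2 * sint r (fun x => u x * Lap (Gam p p) x) + -1 * sint r (fun x => Gam p (Lap p) x * u x) := by
    rw [← sint_const_mul, ← sint_const_mul, ← sint_add hr ((SP.const _).mul (u0.mul LG0))
      ((SP.const _).mul (GL0.mul u0))]
    refine sint_congr hr fun x _ => ?_
    rw [Gam2]; ring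
  rw [e3, e1, e2]; ring

lemma sint_curvature_dimension (hd : 2 ≤ d) (hr : 0 < r) (hp : SP 3 p) (hu : SP 0 u)
    (hpos : ∀ x, x ≠ 0 → 0 < u x) (t : ℝ) :
    ((d : ℝ) - 2) * sint r (fun x => Gam p p x * u x)
        + (sint r (fun x => Lap p x ^ 2 * u x) + 2 * t * sint r (fun x => Gam p p x * Lap p x * u x)
          + t ^ 2 * sint r (fun x => Gam p p x ^ 2 * u x)) / ((d : ℝ) - 1) ≤
      sint r (fun x => Gam2 p x * u x) + t * sint r (fun x => Gam p (Gam p p) x * u x)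
        + t ^ 2 * sint r (fun x => Gam p p x ^ 2 * u x) := by
  have p1 : SP 1 p := hp.mono (by norm_num)
  have G1 : SP 1 (Gam p p) := SP.Gam (k := 1) (hp.mono (by norm_num)) (hp.mono (by norm_num))
  have G0 : SP 0 (Gam p p) := G1.mono (by norm_num)
  have L0 : SP 0 (Lap p) := SP.Lap (hp.mono (by norm_num))
  have GG : SP 0 (Gam p (Gam p p)) := SP.Gam p1 G1
  have s0 : SP 0 (fun x => Gam p p x * u x) := G0.mul hu
  have s1 : SP 0 (fun x => Lap p x ^ 2 * u x) := (L0.pow 2).mul hu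
  have s2 : SP 0 (fun x => Gam p p x * Lap p x * u x) := (G0.mul L0).mul hu
  have s3 : SP 0 (fun x => Gam p p x ^ 2 * u x) := (G0.pow 2).mul hu
  have s4 : SP 0 (fun x => Gam2 p x * u x) := hp.Gam2.mul hu
  have s5 : SP 0 (fun x => Gam p (Gam p p) x * u x) := GG.mul hu
  have hc : ∀ {f : E d → ℝ} (c : ℝ), SP 0 f → SP 0 (fun x => c * f x) := fun c h => (SP.const c).mul h
  have key := sint_mono (f := fun x => ((d : ℝ) - 2) * (Gam p p x * u x)
        + (((d : ℝ) - 1)⁻¹ * (Lap p x ^ 2 * u x)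
          + ((2 * t * ((d : ℝ) - 1)⁻¹) * (Gam p p x * Lap p x * u x)
          + (t ^ 2 * ((d : ℝ) - 1)⁻¹) * (Gam p p x ^ 2 * u x))))
      (g := fun x => Gam2 p x * u x + (t * (Gam p (Gam p p) x * u x)
        + t ^ 2 * (Gam p p x ^ 2 * u x))) hr
      ((hc _ s0).add ((hc _ s1).add ((hc _ s2).add (hc _ s3)))) (s4.add ((hc _ s5).add (hc _ s3)))
      (fun x hx => by
        have := mul_le_mul_of_nonneg_right (curvature_dimension hd hp hx t) (hpos x hx).le
        rw [div_eq_mul_inv] at this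
        rw [Gam2]
        linarith)
  rw [sint_add hr (hc _ s0) ((hc _ s1).add ((hc _ s2).add (hc _ s3))),
    sint_add hr (hc _ s1) ((hc _ s2).add (hc _ s3)), sint_add hr (hc _ s2) (hc _ s3),
    sint_add hr s4 ((hc _ s5).add (hc _ s3)), sint_add hr (hc _ s5) (hc _ s3)] at key
  simp only [sint_const_mul] at key
  rw [div_eq_mul_inv]
  linarith

/-- The constant in front of the quartic term in dimension at least `3`. -/
lemma exists_sphere_constant {m N : ℝ} (hm : 1 < m) (hN : m < N) :
    ∃ δ θ t : ℝ, 0 < δ ∧ 0 ≤ θ ∧ θ * (m - 1) = (N - 1) * m / N ∧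
      1 - 1 / N - θ * (1 - 1 / m) = 0 ∧ 3 / 2 - θ * (3 / 2 - t - 2 * t / m) = 0 ∧
      1 / 2 - θ * (1 / 2 - t + t ^ 2 - t ^ 2 / m) = δ := by
  have h0 : 0 < N := by linarith
  have h1 : 0 < m - 1 := by linarith
  have h2 : 0 < N - m := by linarith
  have h3 : 0 < N - 1 := by linarith
  have h4 : 0 < m := by linarith
  -- This holds because `N - m < N - 1` and `m + 2 > 3 > 9/4`.
  have hb : 0 < 1 - 9 / 4 * ((N - m) / ((N - 1) * (m + 2))) := by
    rw [sub_pos, ← mul_div_assoc, div_lt_one (by positivity)]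
    nlinarith
  -- `θ` is forced by the coefficient of `X`, and then automatically yields the sharp coefficient of
  -- the gradient term; `t` is forced by the coefficient of `Y`. The first witness `δ` is what
  -- remains in front of `Z`; it is positive because `N > m`.
  refine ⟨(N - m) / (N * (m - 1)) * ((m - 1) / (m + 2)) * (1 - 9 / 4 * ((N - m) / ((N - 1) * (m + 2)))),
    (N - 1) * m / (N * (m - 1)), 3 / 2 * (N - m) / ((N - 1) * (m + 2)), by positivity, by positivity,
    by field_simp, by field_simp; ring, by field_simp; ring, by field_simp; ring⟩

/-- The weighted inequality on the sphere in dimension at least `3`. -/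
lemma sphere_ineq_of_three_le (hd : 3 ≤ d) {n : ℝ} (hn : (d : ℝ) < n) :
    ∃ δ : ℝ, 0 < δ ∧ ∀ (p u : E d → ℝ), SP 3 p → SP 2 u → (∀ x, x ≠ 0 → 0 < u x) → LogRot p u →
      ∀ r : ℝ, 0 < r → (n - 2) * (((d : ℝ) - 1) / (n - 1)) * sint r (fun x => Gam p p x * u x)
        + δ * sint r (fun x => Gam p p x ^ 2 * u x) ≤
        sint r (fun x => Gam2 p x * u x) - 1 / (n - 1) * sint r (fun x => Lap p x ^ 2 * u x) := by
  have hd3 : (3 : ℝ) ≤ d := by exact_mod_cast hd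
  obtain ⟨δ, θ, t, hδ, hθ, e1, e2, e3, e4⟩ := exists_sphere_constant (m := (d : ℝ) - 1) (N := n - 1)
    (by linarith) (by linarith)
  refine ⟨δ, hδ, fun p u hp hu hpos h r hr => ?_⟩
  have hd0 : 0 < d := by omega
  have a1 := sint_Gam2 hd0 hr hp hu h
  have a2 := sint_Gam_mul_Lap hd0 hr hp hu h
  have a3 := mul_le_mul_of_nonneg_left
    (sint_curvature_dimension (by omega) hr hp (hu.mono (by norm_num)) hpos t) hθ
  set Q := sint r (fun x => Gam2 p x * u x)
  set G := sint r (fun x => Gam p p x * u x)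
  set X := sint r (fun x => Lap p x ^ 2 * u x)
  set Y := sint r (fun x => Gam p p x * Lap p x * u x)
  set Z := sint r (fun x => Gam p p x ^ 2 * u x)
  set U := sint r (fun x => Gam p (Gam p p) x * u x)
  have hU : U = -Y - Z := by linarith
  have hQ : Q = X + 3 / 2 * Y + 1 / 2 * Z := by linarith
  have e5 : (n - 2) * (((d : ℝ) - 1) / (n - 1)) = θ * ((d : ℝ) - 2) := by
    rw [show (d : ℝ) - 2 = (d : ℝ) - 1 - 1 by ring, e1]; ring
  rw [e5]
  rw [hQ, hU] at a3
  rw [hQ]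
  -- Subtracting `θ` times the curvature-dimension inequality cancels `X` and `Y` and leaves exactly
  -- `δ Z`.
  linear_combination a3 - X * e2 - Y * e3 - Z * e4

lemma half_exp_rot (hl : SP 2 p) {x : E d} (hx : x ≠ 0) (i j : Fin d) :
    rot[i, j] (fun y => Real.exp (1 / 2 * p y)) x
      = 1 / 2 * (Real.exp (1 / 2 * p x) * rot[i, j] p x) := by
  have hl1 : SP 1 p := hl.mono (by norm_num)
  rw [X_exp ((SP.const _).mul hl1) hx, X_const_mul _ hl1 hx]; ring

lemma half_exp_Gam (hl : SP 2 p) {x : E d} (hx : x ≠ 0) :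
    Gam (fun y => Real.exp (1 / 2 * p y)) (fun y => Real.exp (1 / 2 * p y)) x
      = 1 / 4 * (Real.exp (p x) * Gam p p x) := by
  have e : Real.exp (p x) = Real.exp (1 / 2 * p x) * Real.exp (1 / 2 * p x) := by
    rw [← Real.exp_add]; ring_nf
  simp only [Gam, half_exp_rot hl hx, Finset.mul_sum, e]
  exact Finset.sum_congr rfl fun i _ => Finset.sum_congr rfl fun j _ => by ring

lemma half_exp_Lap (hl : SP 2 p) {x : E d} (hx : x ≠ 0) :
    Lap (fun y => Real.exp (1 / 2 * p y)) x
      = Real.exp (1 / 2 * p x) * (1 / 2 * Lap p x + 1 / 4 * Gam p p x) := by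
  have hl1 : SP 1 p := hl.mono (by norm_num)
  have he : SP 1 (fun y => Real.exp (1 / 2 * p y)) := ((SP.const _).mul hl1).exp
  have h : ∀ i j : Fin d, rot[i, j] (rot[i, j] (fun y => Real.exp (1 / 2 * p y))) x =
      1 / 2 * Real.exp (1 / 2 * p x) * rot[i, j] (rot[i, j] p) x
        + 1 / 4 * Real.exp (1 / 2 * p x) * (rot[i, j] p x * rot[i, j] p x) := fun i j => by
    rw [X_congr (fun y hy => half_exp_rot hl hy i j) hx, X_const_mul _ (he.mul (hl.rot i j)) hx,
      X_mul he (hl.rot i j) hx, half_exp_rot hl hx]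
    ring
  simp only [Lap, Gam, h, Finset.sum_add_distrib, ← Finset.mul_sum]
  ring

end

/-- The weighted inequality on the circle. -/
lemma sphere_ineq_two {n : ℝ} (hn : 2 < n) :
    ∃ δ : ℝ, 0 < δ ∧ ∀ (p u : E 2 → ℝ), SP 3 p → SP 2 u → (∀ x, x ≠ 0 → 0 < u x) → LogRot p u →
      ∀ r : ℝ, 0 < r → (n - 2) * ((((2 : ℕ) : ℝ) - 1) / (n - 1)) * sint r (fun x => Gam p p x * u x)
        + δ * sint r (fun x => Gam p p x ^ 2 * u x) ≤
        sint r (fun x => Gam2 p x * u x) - 1 / (n - 1) * sint r (fun x => Lap p x ^ 2 * u x) := by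
  have hn1 : 0 < n - 1 := by linarith
  have hn2 : 0 < n - 2 := by linarith
  -- Inserting `Y = -Z/3` into Wirtinger's inequality for the derivative of `√u` gives `X ≥ G +
  -- Z/12`. Since then also `Q = X`, the right-hand side of the claim is `(n-2)/(n-1)` times `X`.
  refine ⟨(n - 2) / (n - 1) / 12, by positivity, fun p u hp hu hpos h r hr => ?_⟩
  have a1 := sint_Gam2 two_pos hr hp hu h
  have a2 := sint_Gam_mul_Lap two_pos hr hp hu h
  have a3 := sint_curvature_dimension le_rfl hr hp (hu.mono (by norm_num)) hpos
  have u0 : SP 0 u := hu.mono (by norm_num)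
  have G0 : SP 0 (Gam p p) := SP.Gam (k := 0) (hp.mono (by norm_num)) (hp.mono (by norm_num))
  have L0 : SP 0 (Lap p) := SP.Lap (hp.mono (by norm_num))
  -- the Poincaré inequality for the square root of `u`
  have hl : SP 2 (fun x => Real.log (u x)) := hu.log fun x hx => (hpos x hx).ne'
  have hlr : ∀ x, x ≠ 0 → ∀ i j : Fin 2, rot[i, j] (fun x => Real.log (u x)) x = rot[i, j] p x :=
    fun x hx i j => by
      rw [X_log (hu.mono (by norm_num)) (hpos x hx).ne' hx, h x hx, inv_mul_cancel_left₀ (hpos x hx).ne']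
  have hlG : ∀ x, x ≠ 0 → Gam (fun x => Real.log (u x)) (fun x => Real.log (u x)) x = Gam p p x :=
    fun x hx => by simp only [Gam, hlr x hx]
  have hlL : ∀ x, x ≠ 0 → Lap (fun x => Real.log (u x)) x = Lap p x := fun x hx => by
    simp only [Lap, X_congr (fun y hy => hlr y hy _ _) hx]
  let φ : E 2 → ℝ := fun x => Real.exp (1 / 2 * Real.log (u x))
  have w : sint r (Gam φ φ) ≤ sint r (fun x => Lap φ x ^ 2) :=
    wirtinger_sphere (SP.exp ((SP.const (1 / 2 : ℝ)).mul hl)) hr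
  have w1 : sint r (Gam φ φ) = sint r (fun x => 1 / 4 * (Gam p p x * u x)) :=
    sint_congr hr fun x hx => by
      rw [half_exp_Gam hl hx, hlG x hx, Real.exp_log (hpos x hx)]; ring
  have w2 : sint r (fun x => Lap φ x ^ 2) = sint r (fun x => 1 / 4 * (Lap p x ^ 2 * u x)
      + (1 / 4 * (Gam p p x * Lap p x * u x) + 1 / 16 * (Gam p p x ^ 2 * u x))) :=
    sint_congr hr fun x hx => by
      have e : Real.exp (1 / 2 * Real.log (u x)) ^ 2 = u x := by
        rw [← Real.exp_nat_mul]
        simp only [Nat.cast_ofNat]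
        rw [show 2 * (1 / 2 * Real.log (u x)) = Real.log (u x) by ring, Real.exp_log (hpos x hx)]
      rw [half_exp_Lap hl hx, hlG x hx, hlL x hx, mul_pow, e]; ring
  rw [w1, w2,
    sint_add hr ((SP.const _).mul ((L0.pow 2).mul u0)) (((SP.const _).mul ((G0.mul L0).mul u0)).add
      ((SP.const _).mul ((G0.pow 2).mul u0))),
    sint_add hr ((SP.const _).mul ((G0.mul L0).mul u0)) ((SP.const _).mul ((G0.pow 2).mul u0))] at w
  simp only [sint_const_mul] at w
  set Q := sint r (fun x => Gam2 p x * u x)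
  set G := sint r (fun x => Gam p p x * u x)
  set X := sint r (fun x => Lap p x ^ 2 * u x)
  set Y := sint r (fun x => Gam p p x * Lap p x * u x)
  set Z := sint r (fun x => Gam p p x ^ 2 * u x)
  set U := sint r (fun x => Gam p (Gam p p) x * u x)
  have hU : U = -Y - Z := by linarith
  have hQ : Q = X + 3 / 2 * Y + 1 / 2 * Z := by linarith
  have hm : ((2 : ℕ) : ℝ) - 1 = 1 := by norm_num
  -- On the circle this is the vanishing of the integral of `(p'³ u)'`, with primes for angular
  -- derivatives. It is read off from the curvature-dimension inequality, which becomes `(t -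
  -- 1/2)(3Y + Z) ≤ 0` for every `t`; the values `t = 0` and `t = 1` force equality.
  have hY : Y = -Z / 3 := by
    have b0 := a3 1
    have b1 := a3 (-1)
    have b2 := a3 0
    rw [hQ, hU, hm] at b0 b1 b2
    have hm2 : ((2 : ℕ) : ℝ) - 2 = 0 := by norm_num
    rw [hm2] at b0 b1 b2
    have key : ∀ t : ℝ, (t - 1 / 2) * (3 * Y + Z) ≤ 0 := fun t => by
      have b := a3 t
      rw [hQ, hU, hm, hm2] at b
      linarith
    have k0 := key 0
    have k1 := key 1
    linarith
  rw [hm, hQ, hY]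
  have : 0 ≤ (n - 2) / (n - 1) * (1 / 4 * X + (1 / 4 * Y + 1 / 16 * Z) - 1 / 4 * G) :=
    mul_nonneg (by positivity) (by linarith)
  rw [hY] at this
  have e : 1 - 1 / (n - 1) = (n - 2) / (n - 1) := by field_simp; ring
  have e2 : X - 1 / (n - 1) * X = (n - 2) / (n - 1) * X := by rw [← e]; ring
  rw [show (n - 2) * (1 / (n - 1)) = (n - 2) / (n - 1) by ring]
  linarith

/-- The weighted inequality on the sphere. -/
theorem sphere_ineq (hd : 2 ≤ d) {n : ℝ} (hn : (d : ℝ) < n) :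
    ∃ δ : ℝ, 0 < δ ∧ ∀ (p u : E d → ℝ), SP 3 p → SP 2 u → (∀ x, x ≠ 0 → 0 < u x) → LogRot p u →
      ∀ r : ℝ, 0 < r → (n - 2) * (((d : ℝ) - 1) / (n - 1)) * sint r (fun x => Gam p p x * u x)
        + δ * sint r (fun x => Gam p p x ^ 2 * u x) ≤
        sint r (fun x => Gam2 p x * u x) - 1 / (n - 1) * sint r (fun x => Lap p x ^ 2 * u x) := by
  rcases hd.eq_or_lt with rfl | h3
  · exact sphere_ineq_two (by exact_mod_cast hn)
  · exact sphere_ineq_of_three_le h3 hn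

/-- The integral estimate for `k[p]` on the sphere. -/
theorem exists_kSph_lower_bound (hd : 2 ≤ d) {n : ℝ} (hn : (d : ℝ) < n) :
    ∃ δ : ℝ, 0 < δ ∧ ∀ (α : ℝ) (p u : E d → ℝ), SP 3 p → SP 2 u → (∀ x, x ≠ 0 → 0 < u x) →
      LogRot p u → ∀ r : ℝ, 0 < r →
      (n - 2) * (alphaFS d n ^ 2 - α ^ 2) * ∫ ω, ‖angGrad p (r • ω.1)‖ ^ 2 * u (r • ω.1) ∂(dω d)
          + δ * ∫ ω, ‖angGrad p (r • ω.1)‖ ^ 4 * u (r • ω.1) ∂(dω d)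
        ≤ ∫ ω, kSph n α p (r • ω.1) * u (r • ω.1) ∂(dω d) := by
  obtain ⟨δ, hδ, H⟩ := sphere_ineq hd hn
  refine ⟨δ, hδ, fun α p u hp hu hpos h r hr => ?_⟩
  have hd2 : (2 : ℝ) ≤ d := by exact_mod_cast hd
  have key := H p u hp hu hpos h r hr
  have p2 : SP 2 p := hp.mono (by norm_num)
  have p1 : SP 1 p := hp.mono (by norm_num)
  have u0 : SP 0 u := hu.mono (by norm_num)
  have G2 : SP 2 (Gam p p) := SP.Gam hp hp
  have G0 : SP 0 (Gam p p) := G2.mono (by norm_num)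
  have L1 : SP 1 (Lap p) := SP.Lap hp
  have L0 : SP 0 (Lap p) := L1.mono (by norm_num)
  have hkk : ∀ y : E d, y ≠ 0 → ‖angGrad p y‖ ^ 2 = Gam p p y := fun y hy => norm_angGrad_sq p1 hy
  have sL : SP 1 (angLap p) := L1.congr fun y hy => angLap_eq p2 hy
  have i1 : ∫ ω, ‖angGrad p (r • ω.1)‖ ^ 2 * u (r • ω.1) ∂(dω d) = sint r (fun x => Gam p p x * u x) :=
    sint_congr (f := fun x => ‖angGrad p x‖ ^ 2 * u x) hr fun x hx => by rw [hkk x hx]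
  have i2 : ∫ ω, ‖angGrad p (r • ω.1)‖ ^ 4 * u (r • ω.1) ∂(dω d)
      = sint r (fun x => Gam p p x ^ 2 * u x) :=
    sint_congr (f := fun x => ‖angGrad p x‖ ^ 4 * u x) hr fun x hx => by rw [← hkk x hx]; ring
  have hk : ∀ x, x ≠ 0 → kSph n α p x * u x = Gam2 p x * u x
      + ((-(1 / (n - 1))) * (Lap p x ^ 2 * u x) + (-((n - 2) * α ^ 2)) * (Gam p p x * u x)) :=
    fun x hx => by
      have sk : SP 2 (fun y => ‖angGrad p y‖ ^ 2) := G2.congr hkk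
      rw [kSph, angLap_eq sk hx, Lap_congr hkk hx, inner_angGrad p1 sL hx,
        Gam_congr (g' := Lap p) (fun _ _ => rfl) (fun y hy => angLap_eq p2 hy) hx,
        angLap_eq p2 hx, hkk x hx, Gam2]
      ring
  have i3 : ∫ ω, kSph n α p (r • ω.1) * u (r • ω.1) ∂(dω d) = sint r (fun x => Gam2 p x * u x)
      + ((-(1 / (n - 1))) * sint r (fun x => Lap p x ^ 2 * u x)
      + (-((n - 2) * α ^ 2)) * sint r (fun x => Gam p p x * u x)) := by
    rw [← sint_const_mul, ← sint_const_mul, ← sint_add hr ((SP.const _).mul ((L0.pow 2).mul u0))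
      ((SP.const _).mul (G0.mul u0)), ← sint_add hr (hp.Gam2.mul u0)
      (((SP.const _).mul ((L0.pow 2).mul u0)).add ((SP.const _).mul (G0.mul u0)))]
    exact sint_congr (f := fun x => kSph n α p x * u x) hr hk
  rw [i1, i2, i3, alphaFS, Real.sq_sqrt (div_nonneg (by linarith) (by linarith))]
  linarith

/-! ### The relative pressure. -/

section pressure
variable {n α σ : ℝ} {u : E d → ℝ}

/-- Only the positivity of the Gaussian normalization enters: its logarithm is an additive constant,
independent of `u` and `x`, which every derivative ignores. -/
lemma exists_pressure_eq (hd : 0 < d) (hn : 0 < n) (hα : 0 < α) (hσ : 0 < σ) :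
    ∃ c : ℝ, ∀ (u : E d → ℝ) (x : E d),
      pressure n α σ u x = Real.log (u x) + (σ / α ^ 2 * ‖x‖ ^ 2 + c) := by
  have hd' : (0 : ℝ) < d := by exact_mod_cast hd
  have hg : 0 < gaussConst d n := by
    unfold gaussConst
    refine Real.sqrt_pos.2 (div_pos (Real.Gamma_pos_of_pos (by positivity)) ?_)
    have := Real.Gamma_pos_of_pos (half_pos hn)
    positivity
  have hc : 0 < (2 * σ * (α ^ 2)⁻¹) ^ (n / 4) := Real.rpow_pos_of_pos (by positivity) _
  refine ⟨-2 * (Real.log ((2 * σ * (α ^ 2)⁻¹) ^ (n / 4)) + Real.log (gaussConst d n)),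
    fun u x => ?_⟩
  rw [pressure, gStarScaled, gStar, Real.log_mul hc.ne' (mul_pos hg (Real.exp_pos _)).ne',
    Real.log_mul hg.ne' (Real.exp_pos _).ne', Real.log_exp, norm_smul, mul_pow, Real.norm_eq_abs,
    sq_abs, div_pow, Real.sq_sqrt (by positivity)]
  ring

lemma SP.pressure {k : ℕ} (hd : 0 < d) (hn : 0 < n) (hα : 0 < α) (hσ : 0 < σ) (hu : SP k u)
    (hpos : ∀ x, x ≠ 0 → 0 < u x) : SP k (pressure n α σ u) := by
  obtain ⟨c, hc⟩ := exists_pressure_eq (d := d) hd hn hα hσ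
  exact ((hu.log fun x hx => (hpos x hx).ne').add
    (((SP.const _).mul SP.norm_sq).add (SP.const c))).congr fun x _ => hc u x

lemma pd_pressure (hd : 0 < d) (hn : 0 < n) (hα : 0 < α) (hσ : 0 < σ) (hu : SP 1 u)
    (hpos : ∀ x, x ≠ 0 → 0 < u x) {x : E d} (hx : x ≠ 0) (i : Fin d) :
    pd[i] (pressure n α σ u) x = pd[i] (fun y => Real.log (u y)) x + 2 * σ / α ^ 2 * x i := by
  obtain ⟨c, hc⟩ := exists_pressure_eq (d := d) hd hn hα hσ
  have h2 : SP 1 (fun y : E d => σ / α ^ 2 * ‖y‖ ^ 2) := (SP.const _).mul SP.norm_sq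
  rw [X_congr (fun y _ => hc u y) hx, X_add (hu.log fun x hx => (hpos x hx).ne')
    (h2.add (SP.const c)) hx, X_add h2 (SP.const c) hx, X_const_mul _ SP.norm_sq hx, X_const,
    pd_norm_sq]
  ring

lemma logRot_pressure (hd : 0 < d) (hn : 0 < n) (hα : 0 < α) (hσ : 0 < σ) (hu : SP 1 u)
    (hpos : ∀ x, x ≠ 0 → 0 < u x) : LogRot (pressure n α σ u) u := fun x hx i j => by
  rw [rot_eq, rot_eq, pd_pressure hd hn hα hσ hu hpos hx, pd_pressure hd hn hα hσ hu hpos hx,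
    X_log hu (hpos x hx).ne' hx, X_log hu (hpos x hx).ne' hx]
  have := (hpos x hx).ne'
  field_simp
  ring

end pressure

/-! ### Symbol estimates at the origin and at infinity. -/

section bounds
variable {J : Set ℝ} {k a b : ℕ} {f g : ℝ → E d → ℝ}

/-- Locally uniform bounds by `r ^ (-a)`, up to polynomial growth at infinity. -/
def Bd (J : Set ℝ) (a : ℕ) (f : ℝ → E d → ℝ) : Prop :=
  ∃ (C : ℝ) (N : ℕ), ∀ t ∈ J, ∀ x : E d, x ≠ 0 → ‖x‖ ^ a * |f t x| ≤ C * (1 + ‖x‖) ^ N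

/-- Symbols of order `-a`: families of functions of class `C^k` whose derivatives of order `j`
satisfy bounds by `r ^ (-a - j)`, up to polynomial growth at infinity. -/
def SB (J : Set ℝ) : ℕ → ℕ → (ℝ → E d → ℝ) → Prop
  | 0, a, f => (∀ t ∈ J, SP 0 (f t)) ∧ Bd J a f
  | k + 1, a, f => (∀ t ∈ J, SP (k + 1) (f t)) ∧ Bd J a f ∧
      ∀ i, SB J k (a + 1) (fun t => pd[i] (f t))

lemma Bd.nonneg (h : Bd J a f) : ∃ (C : ℝ) (N : ℕ), 0 ≤ C ∧ ∀ t ∈ J, ∀ x : E d, x ≠ 0 →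
    ‖x‖ ^ a * |f t x| ≤ C * (1 + ‖x‖) ^ N := by
  obtain ⟨C, N, h⟩ := h
  refine ⟨|C|, N, abs_nonneg C, fun t ht x hx => (h t ht x hx).trans ?_⟩
  gcongr
  exact le_abs_self C

lemma Bd.congr (h : Bd J a f) (hfg : ∀ t ∈ J, ∀ x, x ≠ 0 → g t x = f t x) : Bd J a g := by
  obtain ⟨C, N, h⟩ := h
  exact ⟨C, N, fun t ht x hx => by rw [hfg t ht x hx]; exact h t ht x hx⟩

lemma Bd.add (hf : Bd J a f) (hg : Bd J a g) : Bd J a (fun t x => f t x + g t x) := by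
  obtain ⟨C, N, hC, hf⟩ := hf.nonneg
  obtain ⟨D, M, hD, hg⟩ := hg.nonneg
  refine ⟨C + D, N + M, fun t ht x hx => ?_⟩
  have h1 : (1 : ℝ) ≤ 1 + ‖x‖ := by linarith [norm_nonneg x]
  calc ‖x‖ ^ a * |f t x + g t x| ≤ ‖x‖ ^ a * |f t x| + ‖x‖ ^ a * |g t x| := by
        rw [← mul_add]; gcongr; exact abs_add_le _ _
    _ ≤ C * (1 + ‖x‖) ^ N + D * (1 + ‖x‖) ^ M := add_le_add (hf t ht x hx) (hg t ht x hx)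
    _ ≤ C * (1 + ‖x‖) ^ (N + M) + D * (1 + ‖x‖) ^ (N + M) := by
        gcongr <;> first | exact h1 | omega
    _ = _ := by ring

lemma Bd.mul (hf : Bd J a f) (hg : Bd J b g) : Bd J (a + b) (fun t x => f t x * g t x) := by
  obtain ⟨C, N, hC, hf⟩ := hf.nonneg
  obtain ⟨D, M, hD, hg⟩ := hg.nonneg
  refine ⟨C * D, N + M, fun t ht x hx => ?_⟩
  calc ‖x‖ ^ (a + b) * |f t x * g t x| = (‖x‖ ^ a * |f t x|) * (‖x‖ ^ b * |g t x|) := by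
        rw [abs_mul]; ring
    _ ≤ (C * (1 + ‖x‖) ^ N) * (D * (1 + ‖x‖) ^ M) := by
        exact mul_le_mul (hf t ht x hx) (hg t ht x hx) (by positivity) (by positivity)
    _ = _ := by ring

lemma Bd.succ (hf : Bd J a f) : Bd J (a + 1) f := by
  obtain ⟨C, N, hC, hf⟩ := hf.nonneg
  refine ⟨C, N + 1, fun t ht x hx => ?_⟩
  calc ‖x‖ ^ (a + 1) * |f t x| = ‖x‖ * (‖x‖ ^ a * |f t x|) := by ring
    _ ≤ (1 + ‖x‖) * (C * (1 + ‖x‖) ^ N) := by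
        exact mul_le_mul (by linarith) (hf t ht x hx) (by positivity) (by positivity)
    _ = _ := by ring

lemma SB.smooth (h : SB J k a f) : ∀ t ∈ J, SP k (f t) := by
  cases k
  exacts [h.1, h.1]

lemma SB.bd (h : SB J k a f) : Bd J a f := by
  cases k
  exacts [h.2, h.2.1]

lemma SB.pd (h : SB J (k + 1) a f) (i : Fin d) : SB J k (a + 1) (fun t => pd[i] (f t)) := h.2.2 i

lemma SB.congr (h : SB J k a f) (hfg : ∀ t ∈ J, ∀ x, x ≠ 0 → g t x = f t x) : SB J k a g := by
  induction k generalizing a f g with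
  | zero => exact ⟨fun t ht => (h.1 t ht).congr (hfg t ht), h.2.congr hfg⟩
  | succ k ih => exact ⟨fun t ht => (h.1 t ht).congr (hfg t ht), h.2.1.congr hfg, fun i =>
      ih (h.2.2 i) fun t ht x hx => X_congr (hfg t ht) hx⟩

lemma SB.succ (h : SB J k a f) : SB J k (a + 1) f := by
  induction k generalizing a f with
  | zero => exact ⟨h.1, h.2.succ⟩
  | succ k ih => exact ⟨h.1, h.2.1.succ, fun i => ih (h.2.2 i)⟩

lemma SB.lower (h : SB J (k + 1) a f) : SB J k a f := by
  induction k generalizing a f with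
  | zero => exact ⟨fun t ht => (h.1 t ht).mono (by norm_num), h.2.1⟩
  | succ k ih => exact ⟨fun t ht => (h.1 t ht).mono (by omega), h.2.1, fun i => ih (h.2.2 i)⟩

lemma SB.add (hf : SB J k a f) (hg : SB J k a g) : SB J k a (fun t x => f t x + g t x) := by
  induction k generalizing a f g with
  | zero => exact ⟨fun t ht => (hf.1 t ht).add (hg.1 t ht), hf.2.add hg.2⟩
  | succ k ih => exact ⟨fun t ht => (hf.1 t ht).add (hg.1 t ht), hf.2.1.add hg.2.1, fun i =>
      (ih (hf.2.2 i) (hg.2.2 i)).congr fun t ht x hx =>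
        X_add ((hf.1 t ht).mono (by omega)) ((hg.1 t ht).mono (by omega)) hx⟩

lemma SB.mul (hf : SB J k a f) (hg : SB J k b g) : SB J k (a + b) (fun t x => f t x * g t x) := by
  induction k generalizing a b f g with
  | zero => exact ⟨fun t ht => (hf.1 t ht).mul (hg.1 t ht), hf.2.mul hg.2⟩
  | succ k ih => exact ⟨fun t ht => (hf.1 t ht).mul (hg.1 t ht), hf.2.1.mul hg.2.1, fun i =>
      ((ih hf.lower (hg.2.2 i)).add (f := fun t x => f t x * pd[i] (g t) x)
        (g := fun t x => g t x * pd[i] (f t) x)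
        (by have := ih hg.lower (hf.2.2 i)
            rwa [show b + (a + 1) = a + (b + 1) by ring] at this)).congr fun t ht x hx =>
        X_mul ((hf.1 t ht).mono (by omega)) ((hg.1 t ht).mono (by omega)) hx⟩

lemma SB.const (c : ℝ) : SB J k a (fun _ (_ : E d) => c) := by
  have h0 : Bd J 0 (fun _ (_ : E d) => c) := ⟨|c|, 0, by simp⟩
  have hb : ∀ a, Bd J a (fun _ (_ : E d) => c) := fun a => by
    induction a with
    | zero => exact h0
    | succ a ih => exact ih.succ
  have hz : ∀ k a, SB J k a (fun _ (_ : E d) => (0 : ℝ)) := fun k => by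
    induction k with
    | zero => exact fun a => ⟨fun _ _ => SP.const _, ⟨0, 0, by simp⟩⟩
    | succ k ih => exact fun a => ⟨fun _ _ => SP.const _, ⟨0, 0, by simp⟩, fun i =>
        (ih (a + 1)).congr fun t _ x _ => X_const 0⟩
  cases k with
  | zero => exact ⟨fun _ _ => SP.const _, hb a⟩
  | succ k => exact ⟨fun _ _ => SP.const _, hb a, fun i => (hz k _).congr fun t _ x _ => X_const c⟩

lemma SB.const_mul (c : ℝ) (hf : SB J k a f) : SB J k a (fun t x => c * f t x) := by
  have := (SB.const (J := J) (k := k) (a := 0) (d := d) c).mul hf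
  rwa [zero_add] at this

lemma SB.neg (hf : SB J k a f) : SB J k a (fun t x => -f t x) :=
  (hf.const_mul (-1)).congr fun _ _ _ _ => by ring

lemma SB.sub (hf : SB J k a f) (hg : SB J k a g) : SB J k a (fun t x => f t x - g t x) :=
  (hf.add hg.neg).congr fun _ _ _ _ => by ring

lemma SB.sum {ι : Type*} {s : Finset ι} {f : ι → ℝ → E d → ℝ} (h : ∀ i ∈ s, SB J k a (f i)) :
    SB J k a (fun t x => ∑ i ∈ s, f i t x) := by
  classical
  induction s using Finset.induction_on with
  | empty => simpa using SB.const 0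
  | insert i s hi ih =>
    refine ((h i (Finset.mem_insert_self i s)).add
      (ih fun j hj => h j (Finset.mem_insert_of_mem hj))).congr fun t _ x _ => ?_
    rw [Finset.sum_insert hi]

lemma abs_coord_le (x : E d) (i : Fin d) : |x i| ≤ ‖x‖ := PiLp.norm_apply_le x i

lemma SB.coord (i : Fin d) : SB J k 0 (fun _ (x : E d) => x i) := by
  have h0 : Bd J 0 (fun _ (x : E d) => x i) := ⟨1, 1, fun t _ x _ => by
    have := abs_coord_le x i
    simp only [pow_zero, one_mul, pow_one]; linarith⟩
  cases k with
  | zero => exact ⟨fun _ _ => SP.coord i, h0⟩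
  | succ k => exact ⟨fun _ _ => SP.coord i, h0, fun j =>
      (SB.const (if j = i then 1 else 0)).congr fun t _ x _ => pd_coord j i⟩

/-- The two families must be treated in one induction, since `∂_i ρ = -ρ² ω_i` and `∂_j ω_i = ρ
(δ_ij - ω_i ω_j)`. -/
lemma SB.rho_dir : ∀ k : ℕ, SB J k 1 (fun _ => (rho : E d → ℝ)) ∧
    ∀ i, SB J k 0 (fun _ (x : E d) => dir x i) := by
  have b1 : Bd J 1 (fun _ => (rho : E d → ℝ)) := ⟨1, 0, fun t _ x hx => by
    have h0 : ‖x‖ ≠ 0 := norm_ne_zero_iff.2 hx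
    simp [rho, h0]⟩
  have b2 : ∀ i, Bd J 0 (fun _ (x : E d) => dir x i) := fun i => ⟨1, 0, fun t _ x hx => by
    have := abs_coord_le (dir x) i
    rw [norm_dir hx] at this
    simpa using this⟩
  intro k
  induction k with
  | zero => exact ⟨⟨fun _ _ => SP.rho, b1⟩, fun i => ⟨fun _ _ => SP.dir.comp_vec i, b2 i⟩⟩
  | succ k ih =>
    obtain ⟨h1, h2⟩ := ih
    refine ⟨⟨fun _ _ => SP.rho, b1, fun i => ?_⟩, fun i => ⟨fun _ _ => SP.dir.comp_vec i, b2 i,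
      fun j => ?_⟩⟩
    · have h3 := ((h2 i).mul (h1.mul h1)).neg
      refine (by simpa using h3 : SB J k 2 _).congr fun t _ x hx => ?_
      rw [pd_rho i hx]; simp [dir, rho]; ring
    · have h3 := (h1.const_mul (if j = i then 1 else 0)).sub
        (by simpa using (h2 i).mul ((h2 j).mul h1) : SB J k 1 _)
      refine (h3 : SB J k 1 _).congr fun t _ x hx => ?_
      have h4 : ∀ y : E d, y ≠ 0 → dir y i = rho y * y i := fun y _ => by simp [dir, rho]
      rw [X_congr h4 hx, X_mul SP.rho (SP.coord i) hx, pd_coord, pd_rho j hx, h4 x hx]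
      simp [dir, rho]; ring

lemma SB.rho : SB J k 1 (fun _ => (rho : E d → ℝ)) := (SB.rho_dir k).1

lemma SB.dir (i : Fin d) : SB J k 0 (fun _ (x : E d) => dir x i) := (SB.rho_dir k).2 i

lemma radial_eq_sum_dir {h : E d → ℝ} {x : E d} : radial h x = ∑ i, dir x i * pd[i] h x :=
  fderiv_eq_sum h x (dir x)

lemma SB.radial_of_pd (h : ∀ i, SB J k a (fun t => pd[i] (f t))) :
    SB J k a (fun t => radial (f t)) :=
  (SB.sum fun i _ => (SB.dir i).mul (h i)).congr (a := 0 + a) (fun _ _ _ _ => radial_eq_sum_dir)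
    |> fun h => by rwa [zero_add] at h

lemma SB.Da_of_pd (α : ℝ) (h : ∀ i, SB J k a (fun t => pd[i] (f t))) (i : Fin d) :
    SB J k a (fun t x => Da α (f t) x i) := by
  have h2 := ((SB.radial_of_pd h).mul (SB.dir i)).const_mul (α - 1)
  rw [add_zero] at h2
  refine ((h i).add h2).congr fun t _ x _ => ?_
  simp only [Da, PiLp.add_apply, gradient_apply, PiLp.smul_apply, smul_eq_mul]
  ring

lemma SB.Da (α : ℝ) (h : SB J (k + 1) a f) (i : Fin d) :
    SB J k (a + 1) (fun t x => Da α (f t) x i) :=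
  SB.Da_of_pd α (fun i => h.pd i) i

lemma SB.inner {F G : ℝ → E d → E d} (hF : ∀ i, SB J k a (fun t x => F t x i))
    (hG : ∀ i, SB J k b (fun t x => G t x i)) : SB J k (a + b) (fun t x => ⟪F t x, G t x⟫) :=
  (SB.sum fun i _ => (hF i).mul (hG i)).congr fun _ _ _ _ => inner_eq_sum _ _

lemma SB.norm_sq {F : ℝ → E d → E d} (hF : ∀ i, SB J k 0 (fun t x => F t x i)) :
    SB J k 0 (fun t x => ‖F t x‖ ^ 2) :=
  (SB.inner hF hF).congr fun _ _ _ _ => (real_inner_self_eq_norm_sq _).symm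

/-- `D_α^*` costs one derivative and one power of `1/r`: each zeroth-order term carries a factor
`ρ`, which has the same order as a derivative. -/
lemma SB.DaStar (n α : ℝ) {F : ℝ → E d → E d} (hF : ∀ i, SB J (k + 1) a (fun t x => F t x i)) :
    SB J k (a + 1) (fun t => DaStar n α (F t)) := by
  have h1 : SB J k (a + 1) (fun t x => ∑ i, pd[i] (fun y => F t y i) x) :=
    SB.sum fun i _ => (hF i).pd i
  have h2 : SB J (k + 1) a (fun t x => ⟪WLS.dir x, F t x⟫) := by
    have := SB.inner (F := fun _ => WLS.dir) (fun i => SB.dir i) hF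
    rwa [zero_add] at this
  have h3 := SB.radial_of_pd fun i => h2.pd i
  have h4 : SB J k (a + 1) (fun t x => WLS.rho x * ⟪WLS.dir x, F t x⟫) := by
    have := SB.rho.mul h2.lower
    rwa [add_comm] at this
  refine ((h1.add ((h4.const_mul (n - d)).add ((h3.add (h4.const_mul (n - 1))).const_mul
    (α - 1)))).neg).congr fun t ht x hx => ?_
  have hs : SP 1 (F t) := SP.vec fun i => ((hF i).smooth t ht).mono (by omega)
  rw [DaStar_eq hs hx, divg_eq hs hx]
  ring

lemma SB.of_iteratedFDeriv (hf : ∀ t ∈ J, SP k (f t))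
    (h : ∀ j ≤ k, ∃ (C : ℝ) (N : ℕ), ∀ t ∈ J, ∀ x : E d, x ≠ 0 →
      ‖x‖ ^ (a + j) * ‖iteratedFDeriv ℝ j (f t) x‖ ≤ C * (1 + ‖x‖) ^ N) : SB J k a f := by
  have hb : ∀ {a : ℕ} {f : ℝ → E d → ℝ}, (∃ (C : ℝ) (N : ℕ), ∀ t ∈ J, ∀ x : E d, x ≠ 0 →
      ‖x‖ ^ (a + 0) * ‖iteratedFDeriv ℝ 0 (f t) x‖ ≤ C * (1 + ‖x‖) ^ N) → Bd J a f :=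
    fun ⟨C, N, h⟩ => ⟨C, N, fun t ht x hx => by simpa using h t ht x hx⟩
  induction k generalizing a f with
  | zero => exact ⟨hf, hb (h 0 le_rfl)⟩
  | succ k ih =>
    refine ⟨hf, hb (h 0 (by omega)), fun i => ih (fun t ht => SP.pd (hf t ht) i) fun j hj => ?_⟩
    obtain ⟨C, N, hC⟩ := h (j + 1) (by omega)
    refine ⟨C, N, fun t ht x hx => le_trans ?_ (hC t ht x hx)⟩
    have hfd : ContDiffAt ℝ j (fderiv ℝ (f t)) x :=
      (hf t ht x hx).fderiv_right (by norm_cast; omega)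
    have h1 := norm_iteratedFDeriv_clm_apply_const (c := (EuclideanSpace.single i 1 : E d)) hfd le_rfl
    rw [norm_iteratedFDeriv_fderiv] at h1
    rw [show a + (j + 1) = a + 1 + j by ring]
    refine mul_le_mul_of_nonneg_left ?_ (by positivity)
    simp only [PiLp.norm_single, norm_one, one_mul] at h1
    exact h1

end bounds

/-! ### Integrability and integration by parts for the weighted measure. -/

section mu
variable {n : ℝ}

lemma measurable_mu_density (d : ℕ) (n : ℝ) :
    Measurable fun x : E d => ENNReal.ofReal (‖x‖ ^ (n - (d : ℝ))) :=
  (measurable_norm.pow_const _).ennreal_ofReal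

lemma integrable_mu_iff {f : E d → ℝ} :
    Integrable f (mu d n) ↔ Integrable fun x => ‖x‖ ^ (n - (d : ℝ)) * f x := by
  rw [mu, integrable_withDensity_iff_integrable_smul' (measurable_mu_density d n)
    (Filter.Eventually.of_forall fun _ => ENNReal.ofReal_lt_top)]
  simp only [ENNReal.toReal_ofReal (Real.rpow_nonneg (norm_nonneg _) _), smul_eq_mul]

lemma integral_mu {f : E d → ℝ} :
    ∫ x, f x ∂(mu d n) = ∫ x, ‖x‖ ^ (n - (d : ℝ)) * f x := by
  rw [mu, integral_withDensity_eq_integral_toReal_smul (measurable_mu_density d n)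
    (Filter.Eventually.of_forall fun _ => ENNReal.ofReal_lt_top)]
  simp only [ENNReal.toReal_ofReal (Real.rpow_nonneg (norm_nonneg _) _), smul_eq_mul]

lemma ae_mu_ne_zero (hd : 0 < d) : ∀ᵐ x ∂(mu d n), x ≠ 0 :=
  (withDensity_absolutelyContinuous _ _).ae_le (ae_ne_zero hd)

lemma mu_restrict (hd : 0 < d) : (mu d n).restrict ({0}ᶜ : Set (E d)) = mu d n :=
  Measure.restrict_eq_self_of_ae_mem (by filter_upwards [ae_mu_ne_zero hd] with x hx using hx)

lemma SP.aestronglyMeasurable {f : E d → ℝ} (hd : 0 < d) (hf : SP 0 f) :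
    AEStronglyMeasurable f (mu d n) := by
  have h1 : ContinuousOn f {0}ᶜ := fun x hx => (hf x hx).continuousAt.continuousWithinAt
  have h2 := h1.aestronglyMeasurable (μ := mu d n) (measurableSet_singleton _).compl
  rwa [mu_restrict hd] at h2

/-- In polar coordinates the density is `r^(n-3) (1+r)^(-M)`: integrable at the origin exactly
because `n > 2`, and at infinity because `M ≥ n`. This fixes order `-2` as the admissible symbol
order throughout. -/
lemma integrable_weight (hd : 0 < d) (hn : 2 < n) {M : ℕ} (hM : n ≤ M) :
    Integrable (fun x : E d => rho x ^ 2 * ((1 + ‖x‖) ^ M)⁻¹) (mu d n) := by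
  have := nontrivial_E hd
  rw [integrable_mu_iff]
  have h := (integrable_fun_norm_addHaar (volume : Measure (E d))
    (f := fun y : ℝ => y ^ (n - (d : ℝ)) * (y⁻¹ ^ 2 * ((1 + y) ^ M)⁻¹))).2 ?_
  · exact h
  rw [finrank_euclideanSpace_fin]
  have key : ∀ y ∈ Ioi (0 : ℝ), y ^ (d - 1) • (y ^ (n - (d : ℝ)) * (y⁻¹ ^ 2 * ((1 + y) ^ M)⁻¹)) =
      y ^ (n - 3) * ((1 + y) ^ M)⁻¹ := fun y hy => by
    have hy' : 0 < y := hy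
    rw [smul_eq_mul, ← Real.rpow_natCast y (d - 1), inv_pow, ← Real.rpow_natCast y 2,
      ← Real.rpow_neg hy'.le, ← mul_assoc, ← mul_assoc, ← Real.rpow_add hy', ← Real.rpow_add hy']
    congr 2
    rw [Nat.cast_sub hd]; push_cast; ring
  rw [integrableOn_congr_fun key measurableSet_Ioi, ← Ioc_union_Ioi_eq_Ioi zero_le_one]
  have hmeas : Measurable fun y : ℝ => y ^ (n - 3) * ((1 + y) ^ M)⁻¹ := by fun_prop
  refine IntegrableOn.union ?_ ?_
  · have h1 : IntegrableOn (fun y : ℝ => y ^ (n - 3)) (Ioc 0 1) := by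
      rw [integrableOn_Ioc_iff_integrableOn_Ioo, intervalIntegral.integrableOn_Ioo_rpow_iff one_pos]
      linarith
    refine h1.mono' hmeas.aestronglyMeasurable ?_
    filter_upwards [ae_restrict_mem measurableSet_Ioc] with y hy
    have hy0 : 0 < y := hy.1
    rw [Real.norm_of_nonneg (by positivity)]
    exact mul_le_of_le_one_right (by positivity) (inv_le_one_of_one_le₀ (one_le_pow₀ (by linarith)))
  · have h1 : IntegrableOn (fun y : ℝ => y ^ (-2 : ℝ)) (Ioi 1) :=
      integrableOn_Ioi_rpow_of_lt (by norm_num) one_pos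
    refine h1.mono' hmeas.aestronglyMeasurable ?_
    filter_upwards [ae_restrict_mem measurableSet_Ioi] with y hy
    have hy1 : 1 < y := hy
    have hy0 : 0 < y := by linarith
    rw [Real.norm_of_nonneg (by positivity), ← div_eq_mul_inv, div_le_iff₀ (by positivity)]
    calc y ^ (n - 3) ≤ y ^ (-2 + (M : ℝ)) := Real.rpow_le_rpow_of_exponent_le hy1.le (by linarith)
      _ = y ^ (-2 : ℝ) * y ^ M := by rw [Real.rpow_add hy0, Real.rpow_natCast]
      _ ≤ y ^ (-2 : ℝ) * (1 + y) ^ M := by gcongr; linarith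

end mu

section decay
variable {n : ℝ} {J : Set ℝ} {u f : ℝ → E d → ℝ}

/-- Decay faster than any power, uniformly on `J`. -/
def Dec (J : Set ℝ) (u : ℝ → E d → ℝ) : Prop :=
  ∀ m : ℕ, ∃ C : ℝ, ∀ t ∈ J, ∀ x : E d, x ≠ 0 → ‖x‖ ^ m * u t x ≤ C

lemma Dec.weight (h : Dec J u) (hpos : ∀ t ∈ J, ∀ x : E d, x ≠ 0 → 0 < u t x) (M : ℕ) :
    ∃ C : ℝ, 0 ≤ C ∧ ∀ t ∈ J, ∀ x : E d, x ≠ 0 → (1 + ‖x‖) ^ M * u t x ≤ C := by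
  obtain ⟨A, hA⟩ := h 0
  obtain ⟨B, hB⟩ := h M
  refine ⟨|2 ^ (M - 1) * (A + B)|, abs_nonneg _, fun t ht x hx => le_trans ?_ (le_abs_self _)⟩
  have h1 := add_pow_le zero_le_one (norm_nonneg x) M
  calc (1 + ‖x‖) ^ M * u t x ≤ (2 ^ (M - 1) * (1 ^ M + ‖x‖ ^ M)) * u t x :=
        mul_le_mul_of_nonneg_right h1 (hpos t ht x hx).le
    _ = 2 ^ (M - 1) * (‖x‖ ^ 0 * u t x + ‖x‖ ^ M * u t x) := by ring
    _ ≤ _ := by gcongr; exacts [hA t ht x hx, hB t ht x hx]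

/-- The rapid decay of `u` absorbs the polynomial growth of the symbol and supplies the weight as
well. The majorant does not depend on the time in `J`, as differentiation under the integral
requires. -/
lemma Dec.exists_integrable_bound (hd : 0 < d) (hn : 2 < n) (h : Dec J u)
    (hpos : ∀ t ∈ J, ∀ x : E d, x ≠ 0 → 0 < u t x) (hf : Bd J 2 f) :
    ∃ g : E d → ℝ, Integrable g (mu d n) ∧ ∀ t ∈ J, ∀ x : E d, x ≠ 0 → ‖u t x * f t x‖ ≤ g x := by
  obtain ⟨M, hM⟩ := exists_nat_ge n
  obtain ⟨C, N, hC, hf⟩ := hf.nonneg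
  obtain ⟨D, hD, hu⟩ := h.weight hpos (N + M)
  refine ⟨_, (integrable_weight hd hn hM).const_mul (C * D), fun t ht x hx => ?_⟩
  have h0 : 0 < ‖x‖ := norm_pos_iff.2 hx
  have hu0 := hpos t ht x hx
  rw [norm_mul, Real.norm_of_nonneg hu0.le, Real.norm_eq_abs]
  have h1 : rho x ^ 2 * ‖x‖ ^ 2 = 1 := by rw [← mul_pow, rho_mul_norm hx, one_pow]
  have hr : 0 < rho x := inv_pos.2 h0
  calc u t x * |f t x| = u t x * rho x ^ 2 * (‖x‖ ^ 2 * |f t x|) := by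
        linear_combination (-(u t x * |f t x|)) * h1
    _ ≤ u t x * rho x ^ 2 * (C * (1 + ‖x‖) ^ N) :=
        mul_le_mul_of_nonneg_left (hf t ht x hx) (by positivity)
    _ = C * rho x ^ 2 * ((1 + ‖x‖) ^ (N + M) * u t x) * ((1 + ‖x‖) ^ M)⁻¹ := by
        rw [pow_add]; field_simp
    _ ≤ C * rho x ^ 2 * D * ((1 + ‖x‖) ^ M)⁻¹ := by
        gcongr; exact hu t ht x hx
    _ = _ := by ring

lemma Dec.integrable (hd : 0 < d) (hn : 2 < n) (h : Dec J u)
    (hpos : ∀ t ∈ J, ∀ x : E d, x ≠ 0 → 0 < u t x) (hu : ∀ t ∈ J, SP 0 (u t)) (hf : SB J 0 2 f)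
    {t : ℝ} (ht : t ∈ J) : Integrable (fun x => u t x * f t x) (mu d n) := by
  obtain ⟨g, hg, hb⟩ := h.exists_integrable_bound hd hn hpos hf.bd
  refine hg.mono' (((hu t ht).mul (hf.smooth t ht)).aestronglyMeasurable hd) ?_
  filter_upwards [ae_mu_ne_zero hd] with x hx
  exact hb t ht x hx

end decay

section weighted
variable {n α : ℝ} {J : Set ℝ} {f g : E d → ℝ} {F : E d → E d} {x : E d}

lemma DaStar_smul (hf : SP 1 f) (hF : SP 1 F) (hx : x ≠ 0) :
    DaStar n α (fun y => f y • F y) x = f x * DaStar n α F x - ⟪Da α f x, F x⟫ := by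
  have h1 : SP 1 (fun y => ⟪dir y, F y⟫) := SP.dir.inner hF
  have h2 : ∀ y : E d, ⟪dir y, f y • F y⟫ = f y * ⟪dir y, F y⟫ := fun y => inner_smul_right _ _ _
  rw [DaStar_eq (hf.smul hF) hx, DaStar_eq hF hx, divg_smul hf hF hx]
  simp only [h2]
  rw [radial_mul hf h1 hx, real_inner_comm (F x) (Da α f x), inner_Da_eq_fderiv,
    real_inner_comm (dir x) (F x)]
  ring

lemma Da_log (hf : SP 1 f) (hpos : 0 < f x) (hx : x ≠ 0) :
    Da α f x = f x • Da α (fun y => Real.log (f y)) x := by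
  ext i
  have := hpos.ne'
  simp only [Da, PiLp.add_apply, gradient_apply, PiLp.smul_apply, radial_eq_X, X_log hf this hx,
    smul_eq_mul]
  field_simp

/-- Integration by parts for the operator `D_α` with the weight `|x| ^ (n - d)`. -/
theorem integral_DaStar_eq_zero (hd : 0 < d) (hF : SP 1 F)
    (h1 : Integrable (fun x => rho x * ‖stretch α F x‖) (mu d n))
    (h2 : Integrable (DaStar n α F) (mu d n)) : ∫ x, DaStar n α F x ∂(mu d n) = 0 := by
  rw [integrable_mu_iff] at h1 h2
  rw [integral_mu]
  have e : ∀ x : E d, x ≠ 0 → ‖x‖ ^ (n - (d : ℝ)) * DaStar n α F x =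
      -divg (fun y => ‖y‖ ^ (n - (d : ℝ)) • stretch α F y) x := fun x hx => by
    have h0 : 0 < ‖x‖ := norm_pos_iff.2 hx
    have e1 : ‖x‖ ^ (n - (d : ℝ)) * ‖x‖ ^ ((d : ℝ) - n) = 1 := by
      rw [← Real.rpow_add h0]; simp
    rw [DaStar_eq_divg hF hx, mul_neg, ← mul_assoc, e1, one_mul]
  have h3 : Integrable (divg fun y => ‖y‖ ^ (n - (d : ℝ)) • stretch α F y) := by
    refine h2.neg.congr ?_
    filter_upwards [ae_ne_zero hd] with x hx
    simp only [Pi.neg_apply]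
    rw [e x hx, neg_neg]
  rw [integral_congr_ae (g := fun x => -divg (fun y => ‖y‖ ^ (n - (d : ℝ)) • stretch α F y) x),
    integral_neg, integral_divg_eq_zero hd ((SP.norm_rpow _).smul hF.stretch) ?_ h3, neg_zero]
  · refine h1.congr (Filter.Eventually.of_forall fun x => ?_)
    simp only [norm_smul, Real.norm_of_nonneg (Real.rpow_nonneg (norm_nonneg x) _), rho]
    ring
  · filter_upwards [ae_ne_zero hd] with x hx
    exact e x hx

lemma norm_stretch_le (hx : x ≠ 0) : ‖stretch α F x‖ ≤ (1 + |α - 1|) * ‖F x‖ := by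
  refine (norm_add_le _ _).trans ?_
  have h := abs_real_inner_le_norm (dir x) (F x)
  rw [norm_dir hx, one_mul] at h
  rw [norm_smul, norm_dir hx, mul_one, norm_mul, Real.norm_eq_abs, Real.norm_eq_abs, add_mul, one_mul]
  gcongr

lemma norm_le_sum_abs (v : E d) : ‖v‖ ≤ ∑ i, |v i| := by
  have h : v = ∑ i, v i • (EuclideanSpace.single i 1 : E d) := by
    ext k; simp [Finset.sum_apply, Pi.single_apply]
  conv_lhs => rw [h]
  refine (norm_sum_le _ _).trans (Finset.sum_le_sum fun i _ => ?_)
  rw [norm_smul]; simp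

variable {u : ℝ → E d → ℝ} {G : ℝ → E d → E d}

/-- Integration by parts against a rapidly decreasing density. -/
theorem integral_mul_DaStar (hd : 0 < d) (hn : 2 < n) (h : Dec J u)
    (hpos : ∀ t ∈ J, ∀ x : E d, x ≠ 0 → 0 < u t x) (hu : ∀ t ∈ J, SP 1 (u t))
    (hl : ∀ i, SB J 0 0 (fun t => pd[i] (fun y => Real.log (u t y))))
    (hG : ∀ i, SB J 1 1 (fun t x => G t x i)) {t : ℝ} (ht : t ∈ J) :
    ∫ x, u t x * DaStar n α (G t) x ∂(mu d n) =
      ∫ x, u t x * ⟪Da α (fun y => Real.log (u t y)) x, G t x⟫ ∂(mu d n) := by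
  have hu0 : ∀ t ∈ J, SP 0 (u t) := fun t ht => (hu t ht).mono (by norm_num)
  have sG : SP 1 (G t) := SP.vec fun i => (hG i).smooth t ht
  have b1 : SB J 0 2 (fun t => DaStar n α (G t)) := SB.DaStar n α hG
  have b2 : SB J 0 1 (fun t x => ⟪Da α (fun y => Real.log (u t y)) x, G t x⟫) := by
    have := SB.inner (fun i => SB.Da_of_pd α hl i) (fun i => (hG i).lower)
    rwa [zero_add] at this
  have i1 := h.integrable hd hn hpos hu0 b1 ht
  have i2 := h.integrable hd hn hpos hu0 b2.succ ht
  have e : ∀ x, x ≠ 0 → DaStar n α (fun y => u t y • G t y) x =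
      u t x * DaStar n α (G t) x - u t x * ⟪Da α (fun y => Real.log (u t y)) x, G t x⟫ :=
    fun x hx => by
      rw [DaStar_smul (hu t ht) sG hx, Da_log (hu t ht) (hpos t ht x hx) hx, real_inner_smul_left]
  rw [← sub_eq_zero, ← integral_sub i1 i2,
    ← integral_DaStar_eq_zero (n := n) (α := α) hd ((hu t ht).smul sG)]
  · refine integral_congr_ae ?_
    filter_upwards [ae_mu_ne_zero hd] with x hx
    exact (e x hx).symm
  -- The divergence theorem needs the field divided by `|x|`. A field of order `-1` becomes one of
  -- order `-2`, which is just admissible.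
  · have b3 : ∀ i, SB J 0 2 (fun t x => rho x * G t x i) := fun i => SB.rho.mul (hG i).lower
    have i3 : Integrable (fun x => (1 + |α - 1|) * ∑ i, ‖u t x * (rho x * G t x i)‖) (mu d n) :=
      (integrable_finsetSum _ fun i _ => (h.integrable hd hn hpos hu0 (b3 i) ht).norm).const_mul _
    have sH : SP 1 (fun y => u t y • G t y) := (hu t ht).smul sG
    refine i3.mono' ?_ ?_
    · have hc : ContinuousOn (fun x => rho x * ‖stretch α (fun y => u t y • G t y) x‖) {0}ᶜ :=
        fun x hx => ((SP.rho (k := 0) x hx).continuousAt.mul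
          (sH.stretch x hx).continuousAt.norm).continuousWithinAt
      have h2 := hc.aestronglyMeasurable (μ := mu d n) (measurableSet_singleton _).compl
      rwa [mu_restrict hd] at h2
    · filter_upwards [ae_mu_ne_zero hd] with x hx
      have hr : 0 < rho x := inv_pos.2 (norm_pos_iff.2 hx)
      have hux := hpos t ht x hx
      rw [norm_mul, norm_norm, Real.norm_of_nonneg hr.le]
      calc rho x * ‖stretch α (fun y => u t y • G t y) x‖
          ≤ rho x * ((1 + |α - 1|) * (u t x * ∑ i, |G t x i|)) := by
            gcongr
            refine (norm_stretch_le hx).trans ?_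
            rw [norm_smul, Real.norm_of_nonneg hux.le]
            gcongr
            exact norm_le_sum_abs _
        _ = _ := by
            simp only [norm_mul, Real.norm_of_nonneg hr.le, Real.norm_of_nonneg hux.le,
              Real.norm_eq_abs, ← Finset.mul_sum]
            ring
  · refine (i1.sub i2).congr ?_
    filter_upwards [ae_mu_ne_zero hd] with x hx
    exact (e x hx).symm

end weighted

/-! ### Pointwise identities for the flux. -/

section pointwise
variable {n α σ : ℝ} {f g p u : E d → ℝ} {F : E d → E d} {x : E d}

lemma Da_apply (i : Fin d) : Da α f x i = pd[i] f x + (α - 1) * radial f x * dir x i := by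
  simp only [Da, PiLp.add_apply, gradient_apply, PiLp.smul_apply, smul_eq_mul]

lemma Da_add (hf : SP 1 f) (hg : SP 1 g) (hx : x ≠ 0) :
    Da α (fun y => f y + g y) x = Da α f x + Da α g x := by
  ext i
  rw [PiLp.add_apply, Da_apply, Da_apply, Da_apply, X_add hf hg hx, radial_add hf hg hx]
  ring

lemma Da_const_mul (a : ℝ) (hf : SP 1 f) (hx : x ≠ 0) :
    Da α (fun y => a * f y) x = a • Da α f x := by
  ext i
  rw [PiLp.smul_apply, Da_apply, Da_apply, X_const_mul a hf hx, radial_const_mul a hf hx,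
    smul_eq_mul]
  ring

lemma X_norm {v : E d → E d} (hx : x ≠ 0) : X v (fun y => ‖y‖) x = ⟪dir x, v x⟫ := by
  simp [X, (hasFDerivAt_norm hx).fderiv, dir, real_inner_smul_left]

lemma radial_norm (hx : x ≠ 0) : radial (fun y : E d => ‖y‖) x = 1 := by
  rw [radial_eq_X, X_norm hx, inner_dir_dir hx]

lemma RotInv.norm : RotInv (fun y : E d => ‖y‖) := fun x hx i j => by
  rw [X_norm hx, dir, real_inner_smul_left, inner_rotF, mul_zero]

lemma inner_self_Da (hx : x ≠ 0) : ⟪x, Da α f x⟫ = α * (‖x‖ * radial f x) := by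
  conv_lhs => rw [← norm_smul_dir hx]
  rw [real_inner_smul_left, norm_smul_dir hx, inner_dir_Da hx]
  ring

/-- The commutation identity between the drift and the squared flux. -/
lemma drift_identity (hp : SP 2 p) (hx : x ≠ 0) :
    ⟪x, Da α (fun y => ‖Da α p y‖ ^ 2) x⟫ - 2 * ⟪Da α p x, Da α (fun y => ⟪Da α p y, y⟫) x⟫
      = -2 * α * ‖Da α p x‖ ^ 2 := by
  have p1 : SP 1 p := hp.mono (by norm_num)
  have T : SP 1 (radial p) := SP.radial hp
  have N : SP 1 (fun y : E d => ‖y‖) := SP.norm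
  have G : SP 1 (Gam p p) := SP.Gam hp hp
  have e1 : radial (fun y => ‖Da α p y‖ ^ 2) x = α ^ 2 * (2 * (radial p x * radial (radial p) x))
      + (2 * rho x ^ 2 * Gam p (radial p) x - 2 * rho x ^ 3 * Gam p p x) := by
    rw [radial_congr (G := fun y => α ^ 2 * (radial p y * radial p y) + rho y * rho y * Gam p p y)
      (fun y hy => by rw [norm_Da_sq hy]; ring) hx,
      radial_add ((SP.const _).mul (T.mul T)) ((SP.rho.mul SP.rho).mul G) hx,
      radial_const_mul _ (T.mul T) hx, radial_mul T T hx, radial_mul (SP.rho.mul SP.rho) G hx,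
      radial_mul SP.rho SP.rho hx, radial_rho hx, radial_Gam hp hp hx,
      Gam_comm (f := radial p) (g := p)]
    ring
  -- Pairing with `x` sees only the radial component of the flux: `F · x = α r p'`.
  have e2 : Da α (fun y => ⟪Da α p y, y⟫) x = α • Da α (fun y => ‖y‖ * radial p y) x := by
    rw [Da_congr (g := fun y => α * (‖y‖ * radial p y))
      (fun y hy => by rw [real_inner_comm, inner_self_Da hy]) hx, Da_const_mul _ (N.mul T) hx]
  rw [e2, inner_smul_right, inner_Da_Da hx, inner_self_Da hx, e1, norm_Da_sq hx,
    radial_mul N T hx, radial_norm hx, Gam_mul_rotInv RotInv.norm N T hx]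
  have h := rho_mul_norm hx
  linear_combination (2 * α * rho x * Gam p (radial p) x - 2 * α * rho x ^ 2 * Gam p p x
    - 2 * α * rho x * Gam p (radial p) x) * h

/-- The gradient of `σ |x|²/α²` is radial, so `D_α` multiplies it by `α`; this turns `2σ/α²` into
`2σ/α`. -/
lemma Da_pressure (hd : 0 < d) (hn : 0 < n) (hα : 0 < α) (hσ : 0 < σ) (hu : SP 1 u)
    (hpos : ∀ x, x ≠ 0 → 0 < u x) (hx : x ≠ 0) :
    Da α (pressure n α σ u) x = Da α (fun y => Real.log (u y)) x + (2 * σ / α) • x := by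
  have h1 : radial (pressure n α σ u) x
      = radial (fun y => Real.log (u y)) x + 2 * σ / α ^ 2 * ‖x‖ := by
    rw [radial_eq_sum_dir, radial_eq_sum_dir]
    simp only [pd_pressure hd hn hα hσ hu hpos hx, mul_add, Finset.sum_add_distrib]
    have h2 : ∑ i, dir x i * x i = ‖x‖ := by
      rw [← inner_eq_sum, dir, real_inner_smul_left, real_inner_self_eq_norm_sq]
      have := norm_ne_zero_iff.2 hx
      field_simp
    rw [← h2, Finset.mul_sum]
    congr 1
    exact Finset.sum_congr rfl fun i _ => by ring
  ext i
  rw [PiLp.add_apply, PiLp.smul_apply, Da_apply, Da_apply, pd_pressure hd hn hα hσ hu hpos hx, h1]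
  have h3 : ‖x‖ * dir x i = x i := by
    conv_rhs => rw [← norm_smul_dir hx]
    simp
  simp only [smul_eq_mul]
  have := hα.ne'
  field_simp
  linear_combination (2 * σ * (α - 1)) * h3

lemma SP.kSph (hp : SP 3 p) : SP 0 (kSph n α p) := by
  have p2 : SP 2 p := hp.mono (by norm_num)
  have p1 : SP 1 p := hp.mono (by norm_num)
  have G2 : SP 2 (WLS.Gam p p) := SP.Gam hp hp
  have L1 : SP 1 (WLS.Lap p) := SP.Lap hp
  have hkk : ∀ y : E d, y ≠ 0 → ‖angGrad p y‖ ^ 2 = WLS.Gam p p y :=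
    fun y hy => norm_angGrad_sq p1 hy
  have sL : SP 1 (angLap p) := L1.congr fun y hy => angLap_eq p2 hy
  have sk : SP 2 (fun y => ‖angGrad p y‖ ^ 2) := G2.congr hkk
  have h1 : SP 0 (angLap fun y => ‖angGrad p y‖ ^ 2) :=
    (SP.Lap sk).congr fun y hy => angLap_eq sk hy
  have h2 : SP 0 (fun x => ⟪angGrad p x, angGrad (angLap p) x⟫) :=
    (SP.Gam (k := 0) p1 sL).congr fun y hy => inner_angGrad p1 sL hy
  exact ((((SP.const _).mul h1).sub h2).sub ((SP.const _).mul ((sL.mono (by norm_num)).pow 2))).sub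
    ((SP.const _).mul (sk.mono (by norm_num)))

lemma kSph_le_K (hn : 1 < n) (hα : 0 < α) (hp : SP 3 p) (hx : x ≠ 0) :
    kSph n α p x / ‖x‖ ^ 4 ≤ K n α (Da α p) x := by
  rw [K_Da hn hα hp hx]
  have : 1 / n ≤ 1 := by rw [div_le_one (by linarith)]; exact hn.le
  have : 0 ≤ 1 - 1 / n := by linarith
  have h1 : 0 ≤ α ^ 4 * (1 - 1 / n) *
          |radial (radial p) x - radial p x / ‖x‖
            - angLap p x / (α ^ 2 * (n - 1) * ‖x‖ ^ 2)| ^ 2 := by positivity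
  have h2 : 0 ≤ 2 * α ^ 2 / ‖x‖ ^ 2 *
          ‖angGrad (radial p) x - ‖x‖⁻¹ • angGrad p x‖ ^ 2 := by positivity
  linarith

end pointwise

/-! ### Positivity of the integral of `u K`. -/

section integral
variable {n α : ℝ} {p u : E d → ℝ}

/-- The hypothesis `α ≤ α_FS` makes the gradient coefficient in the spherical estimate nonnegative;
the quartic term helps as well. -/
lemma sint_mul_kSph_nonneg (hd : 2 ≤ d) (hn : (d : ℝ) < n) (hα : 0 < α) (hα' : α ≤ alphaFS d n)
    (hp : SP 3 p) (hu : SP 2 u) (hpos : ∀ x, x ≠ 0 → 0 < u x) (h : LogRot p u) {r : ℝ}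
    (hr : 0 < r) : 0 ≤ sint r (fun x => kSph n α p x * u x) := by
  obtain ⟨δ, hδ, H⟩ := exists_kSph_lower_bound hd hn
  refine le_trans ?_ (H α p u hp hu hpos h r hr)
  have hd2 : (2 : ℝ) ≤ d := by exact_mod_cast hd
  have hp' : ∀ ω : Metric.sphere (0 : E d) 1, 0 ≤ u (r • ω.1) := fun ω =>
    (hpos _ (sphere_smul_ne_zero hr ω)).le
  have h1 : α ^ 2 ≤ alphaFS d n ^ 2 := by gcongr
  have h2 : 0 ≤ (n - 2) * (alphaFS d n ^ 2 - α ^ 2) :=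
    mul_nonneg (by linarith) (by linarith)
  refine add_nonneg (mul_nonneg h2 (integral_nonneg fun ω => ?_))
    (mul_nonneg hδ.le (integral_nonneg fun ω => ?_))
  · have := hp' ω
    positivity
  · have := hp' ω
    positivity

/-- A function whose spherical means are nonnegative has nonnegative integral. -/
lemma integral_nonneg_of_sint_nonneg (hd : 0 < d) {f : E d → ℝ} (hi : Integrable f (mu d n))
    (h : ∀ r, 0 < r → 0 ≤ sint r f) : 0 ≤ ∫ x, f x ∂(mu d n) := by
  rw [integrable_mu_iff] at hi
  rw [integral_mu, integral_polar hd, integral_prod_symm _ (integrable_polar hi)]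
  refine integral_nonneg fun r => ?_
  have hr : 0 < r.1 := r.2
  have e : ∀ ω : Metric.sphere (0 : E d) 1, ‖r.1 • ω.1‖ ^ (n - (d : ℝ)) * f (r.1 • ω.1)
      = r.1 ^ (n - (d : ℝ)) * f (r.1 • ω.1) := fun ω => by
    rw [norm_smul, norm_eq_of_mem_sphere, mul_one, Real.norm_of_nonneg hr.le]
  simp only [e, integral_const_mul]
  exact mul_nonneg (Real.rpow_nonneg hr.le _) (h _ hr)

theorem integral_mul_K_nonneg (hd : 2 ≤ d) (hn : (d : ℝ) < n) (hα : 0 < α)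
    (hα' : α ≤ alphaFS d n) (hp : SP 3 p) (hu : SP 2 u) (hpos : ∀ x, x ≠ 0 → 0 < u x)
    (h : LogRot p u) (hK : SP 0 (K n α (Da α p)))
    (hi : Integrable (fun x => u x * K n α (Da α p) x) (mu d n)) :
    0 ≤ ∫ x, u x * K n α (Da α p) x ∂(mu d n) := by
  have hd2 : (2 : ℝ) ≤ d := by exact_mod_cast hd
  refine integral_nonneg_of_sint_nonneg (by omega) hi fun r hr => ?_
  have u0 : SP 0 u := hu.mono (by norm_num)
  have h1 := sint_mul_kSph_nonneg hd hn hα hα' hp hu hpos h hr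
  have h2 : SP 0 (fun x => r⁻¹ ^ 4 * (kSph n α p x * u x)) := (SP.const _).mul (hp.kSph.mul u0)
  -- The factor `|x|^(-4)` is constant on the sphere, so the sign of the spherical integral of `k[p]
  -- u` survives.
  have h3 : sint r (fun x => r⁻¹ ^ 4 * (kSph n α p x * u x)) ≤ sint r (fun x => u x * K n α (Da α p) x) := by
    refine integral_mono (h2.integrable_sphere hr) ((u0.mul hK).integrable_sphere hr) fun ω => ?_
    have hx := sphere_smul_ne_zero hr ω
    have h4 := kSph_le_K (by linarith) hα hp hx (n := n)
    have h5 : ‖r • ω.1‖ = r := by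
      rw [norm_smul, norm_eq_of_mem_sphere, mul_one, Real.norm_of_nonneg hr.le]
    rw [h5, div_eq_mul_inv] at h4
    have := mul_le_mul_of_nonneg_left h4 (hpos _ hx).le
    calc _ = u (r • ω.1) * (kSph n α p (r • ω.1) * (r ^ 4)⁻¹) := by rw [inv_pow]; ring
      _ ≤ _ := this
  rw [sint_const_mul] at h3
  exact le_trans (by positivity) h3

end integral

lemma integral_linear_comb {Ω : Type*} [MeasurableSpace Ω] {μ : Measure Ω} {f g h : Ω → ℝ}
    (hf : Integrable f μ) (hg : Integrable g μ) (hh : Integrable h μ) (a b c : ℝ) :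
    Integrable (fun x => a * f x + b * g x + c * h x) μ ∧
    ∫ x, a * f x + b * g x + c * h x ∂μ = a * ∫ x, f x ∂μ + b * ∫ x, g x ∂μ + c * ∫ x, h x ∂μ := by
  have h1 : Integrable (fun x => a * f x + b * g x) μ := (hf.const_mul a).add (hg.const_mul b)
  refine ⟨h1.add (hh.const_mul c), ?_⟩
  rw [integral_add h1 (hh.const_mul c), integral_add (hf.const_mul a) (hg.const_mul b),
    integral_const_mul, integral_const_mul, integral_const_mul]

/-! ### The dissipation identity for the Fisher information. -/

section regular
variable {n α σ : ℝ} {J : Set ℝ} {u : ℝ → E d → ℝ} {t : ℝ} {x : E d}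

/-- Families of positive densities with the regularity of the solutions of the flow on the compact
set `J` of times, with admissible parameters. -/
structure Reg (n α σ : ℝ) (J : Set ℝ) (u : ℝ → E d → ℝ) : Prop where
  hd : 2 ≤ d
  hn : (d : ℝ) < n
  hα : 0 < α
  hσ : 0 < σ
  pos : ∀ t ∈ J, ∀ x : E d, x ≠ 0 → 0 < u t x
  smooth : ∀ t ∈ J, SP 3 (u t)
  dec : Dec J u
  log : ∀ i, SB J 2 0 (fun t => pd[i] (fun y => Real.log (u t y)))

/-- The logarithmic time derivative `- D_α^*(u F) / u` of the solutions of the flow. -/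
def vel (n α σ : ℝ) (u : E d → ℝ) (x : E d) : ℝ :=
  ⟪Da α (fun y => Real.log (u y)) x, flux n α σ u x⟫ - DaStar n α (flux n α σ u) x

namespace Reg

lemma hd0 (h : Reg n α σ J u) : 0 < d := by have := h.hd; omega

lemma hn2 (h : Reg n α σ J u) : 2 < n := by
  have h1 : (2 : ℝ) ≤ d := by exact_mod_cast h.hd
  linarith [h.hn]

lemma smooth_of_le (h : Reg n α σ J u) (ht : t ∈ J) {k : ℕ} (hk : k ≤ 3) : SP k (u t) :=
  (h.smooth t ht).mono hk

lemma pressure (h : Reg n α σ J u) (ht : t ∈ J) : SP 3 (pressure n α σ (u t)) :=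
  SP.pressure h.hd0 (by linarith [h.hn2]) h.hα h.hσ (h.smooth t ht) (h.pos t ht)

lemma pd_pressure (h : Reg n α σ J u) (i : Fin d) :
    SB J 2 0 (fun t => pd[i] (WLS.pressure n α σ (u t))) :=
  ((h.log i).add ((SB.coord i).const_mul (2 * σ / α ^ 2))).congr fun t ht x hx =>
    WLS.pd_pressure h.hd0 (by linarith [h.hn2]) h.hα h.hσ (h.smooth_of_le ht (by norm_num))
      (h.pos t ht) hx i

lemma flux (h : Reg n α σ J u) (i : Fin d) : SB J 2 0 (fun t x => flux n α σ (u t) x i) :=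
  SB.Da_of_pd α (fun i => h.pd_pressure i) i

lemma flux_smooth (h : Reg n α σ J u) (ht : t ∈ J) : SP 2 (WLS.flux n α σ (u t)) :=
  SP.vec fun i => (h.flux i).smooth t ht

lemma flux_eq (h : Reg n α σ J u) (ht : t ∈ J) (hx : x ≠ 0) :
    WLS.flux n α σ (u t) x = Da α (fun y => Real.log (u t y)) x + (2 * σ / α) • x :=
  Da_pressure h.hd0 (by linarith [h.hn2]) h.hα h.hσ (h.smooth_of_le ht (by norm_num))
    (h.pos t ht) hx

lemma norm_sq (h : Reg n α σ J u) : SB J 2 0 (fun t x => ‖WLS.flux n α σ (u t) x‖ ^ 2) :=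
  SB.norm_sq h.flux

lemma inner_self (h : Reg n α σ J u) : SB J 2 0 (fun t x => ⟪WLS.flux n α σ (u t) x, x⟫) := by
  have := SB.inner (G := fun _ x => x) h.flux (fun i => SB.coord i)
  rwa [add_zero] at this

lemma inner_flux (h : Reg n α σ J u) {k a : ℕ} (hk : k ≤ 2) {G : ℝ → E d → E d}
    (hG : ∀ i, SB J k a (fun t x => G t x i)) :
    SB J k a (fun t x => ⟪WLS.flux n α σ (u t) x, G t x⟫) := by
  have h1 : ∀ i, SB J k 0 (fun t x => WLS.flux n α σ (u t) x i) := fun i => by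
    interval_cases k
    exacts [(h.flux i).lower.lower, (h.flux i).lower, h.flux i]
  have := SB.inner h1 hG
  rwa [zero_add] at this

lemma DaStar_flux (h : Reg n α σ J u) : SB J 1 1 (fun t => DaStar n α (WLS.flux n α σ (u t))) :=
  SB.DaStar n α h.flux

lemma inner_Da_DaStar (h : Reg n α σ J u) :
    SB J 0 2 (fun t x => ⟪WLS.flux n α σ (u t) x, Da α (DaStar n α (WLS.flux n α σ (u t))) x⟫) :=
  h.inner_flux (by norm_num) fun i => h.DaStar_flux.Da α i

lemma La_norm_sq (h : Reg n α σ J u) :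
    SB J 0 2 (fun t => La n α (fun y => ‖WLS.flux n α σ (u t) y‖ ^ 2)) :=
  (SB.DaStar n α fun i => h.norm_sq.Da α i).neg

lemma K_flux (h : Reg n α σ J u) : SB J 0 2 (fun t => K n α (WLS.flux n α σ (u t))) := by
  have h1 := h.DaStar_flux.lower.mul h.DaStar_flux.lower
  exact (((h.La_norm_sq.const_mul (1 / 2)).add h.inner_Da_DaStar).sub
    (h1.const_mul (1 / n))).congr fun t _ x _ => by rw [K, sq]

lemma vel_bounds (h : Reg n α σ J u) : SB J 1 1 (fun t => vel n α σ (u t)) := by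
  have h1 : SB J 1 0 (fun t x =>
      ⟪Da α (fun y => Real.log (u t y)) x, WLS.flux n α σ (u t) x⟫) := by
    have := SB.inner (fun i => SB.Da_of_pd α (fun i => (h.log i).lower) i)
      (fun i => (h.flux i).lower)
    rwa [add_zero] at this
  exact h1.succ.sub h.DaStar_flux

lemma integrable (h : Reg n α σ J u) {f : ℝ → E d → ℝ} (hf : SB J 0 2 f) (ht : t ∈ J) :
    Integrable (fun x => u t x * f t x) (mu d n) :=
  h.dec.integrable h.hd0 h.hn2 h.pos (fun _ ht => h.smooth_of_le ht (by norm_num)) hf ht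

lemma integral_mul_DaStar (h : Reg n α σ J u) {G : ℝ → E d → E d}
    (hG : ∀ i, SB J 1 1 (fun t x => G t x i)) (ht : t ∈ J) :
    ∫ x, u t x * DaStar n α (G t) x ∂(mu d n) =
      ∫ x, u t x * ⟪Da α (fun y => Real.log (u t y)) x, G t x⟫ ∂(mu d n) :=
  WLS.integral_mul_DaStar h.hd0 h.hn2 h.dec h.pos (fun _ ht => h.smooth_of_le ht (by norm_num))
    (fun i => (h.log i).lower.lower) hG ht

lemma fisher_bounds (h : Reg n α σ J u) :
    SB J 0 2 (fun t x => ‖WLS.flux n α σ (u t) x‖ ^ 2) := h.norm_sq.lower.lower.succ.succ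

lemma drift_bounds (h : Reg n α σ J u) :
    SB J 0 2 (fun t x => ⟪x, Da α (fun y => ‖WLS.flux n α σ (u t) y‖ ^ 2) x⟫) := by
  have := SB.inner (F := fun _ x => x) (fun i => SB.coord i)
    (fun i => (h.norm_sq.Da α i).lower.succ)
  rwa [zero_add] at this

lemma flux_drift_bounds (h : Reg n α σ J u) :
    SB J 0 2 (fun t x =>
      ⟪WLS.flux n α σ (u t) x, Da α (fun y => ⟪WLS.flux n α σ (u t) y, y⟫) x⟫) :=
  h.inner_flux (by norm_num) fun i => (h.inner_self.Da α i).lower.succ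

lemma integral_drift (h : Reg n α σ J u) (ht : t ∈ J) :
    (∫ x, u t x * ⟪x, Da α (fun y => ‖WLS.flux n α σ (u t) y‖ ^ 2) x⟫ ∂(mu d n))
        - 2 * (∫ x, u t x *
          ⟪WLS.flux n α σ (u t) x, Da α (fun y => ⟪WLS.flux n α σ (u t) y, y⟫) x⟫ ∂(mu d n))
      = -2 * α * ∫ x, u t x * ‖WLS.flux n α σ (u t) x‖ ^ 2 ∂(mu d n) := by
  rw [← integral_const_mul, ← integral_const_mul, ← integral_sub (h.integrable h.drift_bounds ht)
    ((h.integrable h.flux_drift_bounds ht).const_mul 2)]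
  refine integral_congr_ae ?_
  filter_upwards [ae_mu_ne_zero h.hd0] with x hx
  have := drift_identity (α := α) ((h.pressure ht).mono (by norm_num : 2 ≤ 3)) hx
  simp only [WLS.flux] at this ⊢
  linear_combination u t x * this

/-- Substituting `D_α log u = F - (2σ/α) x` rewrites the velocity as `|F|² - (2σ/α) F · x - D_α^*
F`. Each piece then matches a term of `K[F]` or of the drift identity. -/
lemma Da_vel (h : Reg n α σ J u) (ht : t ∈ J) (hx : x ≠ 0) :
    Da α (vel n α σ (u t)) x = Da α (fun y => ‖WLS.flux n α σ (u t) y‖ ^ 2) x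
      - (2 * σ / α) • Da α (fun y => ⟪WLS.flux n α σ (u t) y, y⟫) x
      - Da α (DaStar n α (WLS.flux n α σ (u t))) x := by
  have s1 : SP 1 (fun y => ‖WLS.flux n α σ (u t) y‖ ^ 2) := h.norm_sq.lower.smooth t ht
  have s2 : SP 1 (fun y => ⟪WLS.flux n α σ (u t) y, y⟫) := h.inner_self.lower.smooth t ht
  have s3 : SP 1 (DaStar n α (WLS.flux n α σ (u t))) := h.DaStar_flux.smooth t ht
  rw [Da_congr (g := fun y => (‖WLS.flux n α σ (u t) y‖ ^ 2 +
      -(2 * σ / α) * ⟪WLS.flux n α σ (u t) y, y⟫) + -DaStar n α (WLS.flux n α σ (u t)) y) _ hx,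
    Da_add (s1.add ((SP.const _).mul s2)) s3.neg hx, Da_add s1 ((SP.const _).mul s2) hx,
    Da_const_mul _ s2 hx, Da_neg, neg_smul]
  · abel
  · intro y hy
    have e : Da α (fun y => Real.log (u t y)) y = WLS.flux n α σ (u t) y - (2 * σ / α) • y := by
      rw [h.flux_eq ht hy, add_sub_cancel_right]
    rw [vel, e, inner_sub_left, real_inner_smul_left, real_inner_self_eq_norm_sq,
      real_inner_comm y]
    ring

/-- The integrand of the time derivative of the Fisher information, divided by the density. -/
def rate (n α σ : ℝ) (u : E d → ℝ) (x : E d) : ℝ :=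
  vel n α σ u x * ‖WLS.flux n α σ u x‖ ^ 2 +
    2 * ⟪WLS.flux n α σ u x, Da α (vel n α σ u) x⟫

lemma vel_mul_norm_sq (h : Reg n α σ J u) :
    SB J 0 2 (fun t x => vel n α σ (u t) x * ‖WLS.flux n α σ (u t) x‖ ^ 2) :=
  (h.vel_bounds.lower.mul h.norm_sq.lower.lower).succ

lemma rate_bounds (h : Reg n α σ J u) : SB J 0 2 (fun t => rate n α σ (u t)) :=
  h.vel_mul_norm_sq.add
    ((h.inner_flux (by norm_num) fun i => h.vel_bounds.Da α i).const_mul 2)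

lemma inner_Da_norm_sq (h : Reg n α σ J u) :
    SB J 1 1 (fun t x =>
      ⟪WLS.flux n α σ (u t) x, Da α (fun y => ‖WLS.flux n α σ (u t) y‖ ^ 2) x⟫) :=
  h.inner_flux (by norm_num) fun i => h.norm_sq.Da α i

/-- Since `u vel = -D_α^*(u F)`, this is integration by parts against `|F|²`. It is obtained by
applying `integral_mul_DaStar` to the field `|F|² F` and expanding with the Leibniz rule. -/
lemma integral_vel_mul_norm_sq (h : Reg n α σ J u) (ht : t ∈ J) :
    ∫ x, u t x * (vel n α σ (u t) x * ‖WLS.flux n α σ (u t) x‖ ^ 2) ∂(mu d n) =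
      -∫ x, u t x *
        ⟪WLS.flux n α σ (u t) x, Da α (fun y => ‖WLS.flux n α σ (u t) y‖ ^ 2) x⟫ ∂(mu d n) := by
  have hG : ∀ i, SB J 1 1 (fun t x =>
      (‖WLS.flux n α σ (u t) x‖ ^ 2 • WLS.flux n α σ (u t) x) i) := fun i =>
    ((h.norm_sq.mul (h.flux i)).lower.succ).congr fun t _ x _ => by
      rw [PiLp.smul_apply, smul_eq_mul]
  have b1 := SB.DaStar n α hG
  have b2 : SB J 0 2 (fun t x => ⟪Da α (fun y => Real.log (u t y)) x,
      ‖WLS.flux n α σ (u t) x‖ ^ 2 • WLS.flux n α σ (u t) x⟫) := by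
    have := SB.inner (fun i => SB.Da_of_pd α (fun i => (h.log i).lower.lower) i)
      (fun i => (hG i).lower.succ)
    rwa [zero_add] at this
  have key := h.integral_mul_DaStar hG ht
  have i1 := h.integrable b1 ht
  have i2 := h.integrable b2 ht
  have i3 := h.integrable h.inner_Da_norm_sq.lower.succ ht
  have iV := h.integrable h.vel_mul_norm_sq ht
  rw [← sub_eq_zero, ← integral_sub i1 i2] at key
  rw [← integral_neg, ← sub_eq_zero, ← neg_eq_zero, ← key, ← integral_sub, ← integral_neg]
  · refine integral_congr_ae ?_
    filter_upwards [ae_mu_ne_zero h.hd0] with x hx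
    rw [DaStar_smul (h.norm_sq.lower.smooth t ht) ((h.flux_smooth ht).mono (by norm_num)) hx, vel,
      inner_smul_right, real_inner_comm (WLS.flux n α σ (u t) x) (Da α (fun y => ‖WLS.flux n α σ (u t) y‖ ^ 2) x)]
    ring
  · exact iV
  · exact i3.neg

/-- Splitting `u F = D_α u + (2σ/α) u x`, the first part integrates by parts to `-∫ u L_α |F|²`. -/
lemma integral_inner_Da_norm_sq (h : Reg n α σ J u) (ht : t ∈ J) :
    ∫ x, u t x *
        ⟪WLS.flux n α σ (u t) x, Da α (fun y => ‖WLS.flux n α σ (u t) y‖ ^ 2) x⟫ ∂(mu d n) =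
      2 * σ / α * (∫ x, u t x * ⟪x, Da α (fun y => ‖WLS.flux n α σ (u t) y‖ ^ 2) x⟫ ∂(mu d n))
      - ∫ x, u t x * La n α (fun y => ‖WLS.flux n α σ (u t) y‖ ^ 2) x ∂(mu d n) := by
  have hG := fun i => h.norm_sq.Da α i
  have key := h.integral_mul_DaStar hG ht
  have i1 := h.integrable h.drift_bounds ht
  have b2 : SB J 0 2 (fun t x => ⟪Da α (fun y => Real.log (u t y)) x,
      Da α (fun y => ‖WLS.flux n α σ (u t) y‖ ^ 2) x⟫) := by
    have := SB.inner (fun i => SB.Da_of_pd α (fun i => (h.log i).lower.lower) i)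
      (fun i => (hG i).lower.succ)
    rwa [zero_add] at this
  have i2 := h.integrable b2 ht
  simp only [La, mul_neg, integral_neg]
  rw [sub_neg_eq_add, key, ← integral_const_mul, ← integral_add (i1.const_mul _) i2]
  refine integral_congr_ae ?_
  filter_upwards [ae_mu_ne_zero h.hd0] with x hx
  have e := h.flux_eq ht hx
  conv_lhs => rw [e, inner_add_left, real_inner_smul_left]
  ring

/-- The term `-∫ u F · D_α |F|²` from the density combines with twice the same integral from the
flux. Replacing the remaining copy by `integral_inner_Da_norm_sq` produces the drift combination,
worth `-4σ` times the Fisher information, and `-2 ∫ u (½ L_α |F|² + F · D_α (D_α^* F))`, which is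
`K` plus its missing square. -/
theorem integral_rate (h : Reg n α σ J u) (ht : t ∈ J) :
    ∫ x, u t x * rate n α σ (u t) x ∂(mu d n) =
      -2 * (∫ x, u t x * K n α (WLS.flux n α σ (u t)) x ∂(mu d n))
      - 2 / n * (∫ x, u t x * DaStar n α (WLS.flux n α σ (u t)) x ^ 2 ∂(mu d n))
      - 4 * σ * fisher n α σ (u t) := by
  have hS : SB J 0 2 (fun t x => DaStar n α (WLS.flux n α σ (u t)) x ^ 2) :=
    (h.DaStar_flux.lower.mul h.DaStar_flux.lower).congr fun _ _ _ _ => sq _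
  have iS := h.integrable hS ht
  have iK := h.integrable h.K_flux ht
  have iL := h.integrable h.La_norm_sq ht
  have iD := h.integrable h.inner_Da_DaStar ht
  have iN := h.integrable h.inner_Da_norm_sq.lower.succ ht
  have iV := h.integrable h.vel_mul_norm_sq ht
  have iF := h.integrable h.flux_drift_bounds ht
  obtain ⟨c1, c2⟩ := integral_linear_comb iN iF iD 2 (-(4 * σ / α)) (-2)
  have e1 := integral_add iV c1
  rw [c2] at e1
  have e0 : (fun x => u t x * rate n α σ (u t) x) =ᵐ[mu d n] fun x =>
      u t x * (vel n α σ (u t) x * ‖WLS.flux n α σ (u t) x‖ ^ 2) + (2 * (u t x *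
        ⟪WLS.flux n α σ (u t) x, Da α (fun y => ‖WLS.flux n α σ (u t) y‖ ^ 2) x⟫)
      + -(4 * σ / α) * (u t x *
        ⟪WLS.flux n α σ (u t) x, Da α (fun y => ⟪WLS.flux n α σ (u t) y, y⟫) x⟫)
      + -2 * (u t x *
        ⟪WLS.flux n α σ (u t) x, Da α (DaStar n α (WLS.flux n α σ (u t))) x⟫)) := by
    filter_upwards [ae_mu_ne_zero h.hd0] with x hx
    rw [rate, h.Da_vel ht hx, inner_sub_right, inner_sub_right, inner_smul_right]
    ring
  have e2 : ∫ x, u t x * K n α (WLS.flux n α σ (u t)) x ∂(mu d n) =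
      ∫ x, 1 / 2 * (u t x * La n α (fun y => ‖WLS.flux n α σ (u t) y‖ ^ 2) x)
      + 1 * (u t x *
        ⟪WLS.flux n α σ (u t) x, Da α (DaStar n α (WLS.flux n α σ (u t))) x⟫)
      + -(1 / n) * (u t x * DaStar n α (WLS.flux n α σ (u t)) x ^ 2) ∂(mu d n) := by
    congr 1
    ext x
    rw [K]
    ring
  rw [(integral_linear_comb iL iD iS (1 / 2) 1 (-(1 / n))).2] at e2
  have e3 := h.integral_vel_mul_norm_sq ht
  have e4 := h.integral_inner_Da_norm_sq ht
  have e5 := h.integral_drift ht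
  have hα := h.hα.ne'
  have e6 : 2 * σ / α * (-2 * α * ∫ x, u t x * ‖WLS.flux n α σ (u t) x‖ ^ 2 ∂(mu d n))
      = -(4 * σ) * fisher n α σ (u t) := by
    rw [fisher]; field_simp; ring
  rw [← e5] at e6
  rw [integral_congr_ae e0, e1, e2, e3, e4]
  linear_combination e6

theorem integral_rate_le (h : Reg n α σ J u) (hα : α ≤ alphaFS d n) (ht : t ∈ J) :
    ∫ x, u t x * rate n α σ (u t) x ∂(mu d n) ≤ -(4 * σ) * fisher n α σ (u t) := by
  rw [h.integral_rate ht]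
  have hn := h.hn2
  have u2 : SP 2 (u t) := h.smooth_of_le ht (by norm_num)
  have hl : LogRot (WLS.pressure n α σ (u t)) (u t) := logRot_pressure h.hd0 (by linarith) h.hα h.hσ
    (h.smooth_of_le ht (by norm_num)) (h.pos t ht)
  have hK := h.K_flux.smooth t ht
  have iK := h.integrable h.K_flux ht
  have h1 : 0 ≤ ∫ x, u t x * K n α (WLS.flux n α σ (u t)) x ∂(mu d n) :=
    integral_mul_K_nonneg (p := WLS.pressure n α σ (u t)) h.hd h.hn h.hα hα (h.pressure ht) u2
      (h.pos t ht) hl hK iK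
  have h2 : 0 ≤ ∫ x, u t x * DaStar n α (WLS.flux n α σ (u t)) x ^ 2 ∂(mu d n) := by
    refine integral_nonneg_of_ae ?_
    filter_upwards [ae_mu_ne_zero h.hd0] with x hx
    have := h.pos t ht x hx
    simp only [Pi.zero_apply]
    positivity
  have h3 : 0 ≤ 2 / n * ∫ x, u t x * DaStar n α (WLS.flux n α σ (u t)) x ^ 2 ∂(mu d n) := by
    have : 0 < n := by linarith
    positivity
  linarith

end Reg
end regular

/-! ### Differentiation of the Fisher information in time. -/

/-- Exchange of a time derivative and a space derivative. -/
lemma hasDerivAt_fderiv_slice {W : Type*} [NormedAddCommGroup W] [NormedSpace ℝ W]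
    {ψ : ℝ × W → ℝ} {q : W → ℝ} {t : ℝ} {x : W} (h : ContDiffAt ℝ 2 ψ (t, x))
    (hq : ∀ᶠ y in nhds x, HasDerivAt (fun s => ψ (s, y)) (q y) t) (v : W) :
    HasDerivAt (fun s => fderiv ℝ (fun y => ψ (s, y)) x v) (fderiv ℝ q x v) t := by
  have hev : ∀ᶠ z in nhds (t, x), DifferentiableAt ℝ ψ z := by
    filter_upwards [h.eventually (by simp)] with z hz using hz.differentiableAt (by norm_num)
  have hD : DifferentiableAt ℝ (fderiv ℝ ψ) (t, x) :=
    (h.fderiv_right (m := 1) (by norm_num)).differentiableAt (by norm_num)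
  have ht : Filter.Tendsto (fun s : ℝ => (s, x)) (nhds t) (nhds (t, x)) :=
    (Continuous.tendsto (by fun_prop) t)
  have hx : Filter.Tendsto (fun y : W => (t, y)) (nhds x) (nhds (t, x)) :=
    (Continuous.tendsto (by fun_prop) x)
  have e1 : ∀ᶠ s in nhds t, fderiv ℝ (fun y => ψ (s, y)) x v = fderiv ℝ ψ (s, x) (0, v) := by
    filter_upwards [ht.eventually hev] with s hs
    have h1 := hs.hasFDerivAt.comp x (hasFDerivAt_prodMk_right s x)
    have h2 : (ψ ∘ fun y => (s, y)) = fun y => ψ (s, y) := rfl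
    rw [h2] at h1
    rw [h1.fderiv]; simp
  have e2 : ∀ᶠ y in nhds x, q y = fderiv ℝ ψ (t, y) (1, 0) := by
    filter_upwards [hx.eventually hev, hq] with y hy hqy
    have h1 := (hy.hasFDerivAt.comp t (hasFDerivAt_prodMk_left t y)).hasDerivAt
    rw [hqy.unique h1]; simp
  have d1 : HasDerivAt (fun s => fderiv ℝ ψ (s, x) (0, v))
      (fderiv ℝ (fderiv ℝ ψ) (t, x) (1, 0) (0, v)) t := by
    have h1 := (hD.hasFDerivAt.comp t (hasFDerivAt_prodMk_left t x)).hasDerivAt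
    have h2 := h1.clm_apply (hasDerivAt_const t ((0, v) : ℝ × W))
    simpa using h2
  have d2 : fderiv ℝ q x v = fderiv ℝ (fderiv ℝ ψ) (t, x) (0, v) (1, 0) := by
    rw [Filter.EventuallyEq.fderiv_eq e2]
    have h1 := hD.hasFDerivAt.comp x (hasFDerivAt_prodMk_right t x)
    have h2 := h1.clm_apply (hasFDerivAt_const ((1, 0) : ℝ × W) x)
    have h3 := congrArg (fun L => L v) h2.fderiv
    simpa using h3
  -- Both candidates are values of the second derivative of `ψ` on `(1, 0)` and `(0, v)`, in
  -- opposite orders; symmetry identifies them.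
  rw [d2, (h.isSymmSndFDerivAt (by simp)) (0, v) (1, 0)]
  exact d1.congr_of_eventuallyEq e1

section flow
variable {n α σ : ℝ} {I J : Set ℝ} {u : ℝ → E d → ℝ} {t : ℝ} {x : E d}

namespace IsRegularSolution

lemma contDiffAt (h : IsRegularSolution n α σ I u) (hI : IsOpen I) (ht : t ∈ I) (hx : x ≠ 0) :
    ContDiffAt ℝ 3 (fun z : ℝ × E d => u z.1 z.2) (t, x) :=
  h.smooth.contDiffAt (prod_mem_nhds (hI.mem_nhds ht) (nhds_punct hx))

lemma slice (h : IsRegularSolution n α σ I u) (hI : IsOpen I) (ht : t ∈ I) : SP 3 (u t) :=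
  fun x hx => (h.contDiffAt hI ht hx).comp x (contDiffAt_const.prodMk contDiffAt_id)

lemma reg (h : IsRegularSolution n α σ I u) (hI : IsOpen I) (hd : 2 ≤ d) (hn : (d : ℝ) < n)
    (hα : 0 < α) (hσ : 0 < σ) (hJ : J ⊆ I) (hc : IsCompact J) : Reg n α σ J u where
  hd := hd
  hn := hn
  hα := hα
  hσ := hσ
  pos := fun t ht => h.pos t (hJ ht)
  smooth := fun t ht => h.slice hI (hJ ht)
  dec := h.decay J hJ hc
  -- The growth condition on the derivatives of `log u` of orders one to three says that its
  -- gradient is a symbol of order `0` with two derivatives; a coordinate derivative is a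
  -- contraction of the full one.
  log := fun i => by
    obtain ⟨C, N, hC⟩ := h.growth J hJ hc
    have hl : ∀ t ∈ J, SP 3 (fun y => Real.log (u t y)) := fun t ht =>
      (h.slice hI (hJ ht)).log fun x hx => (h.pos t (hJ ht) x hx).ne'
    refine SB.of_iteratedFDeriv (fun t ht => SP.pd (hl t ht) i) fun j hj =>
      ⟨C, N, fun t ht x hx => le_trans ?_ (hC t ht x hx j (by omega))⟩
    have hfd : ContDiffAt ℝ j (fderiv ℝ (fun y => Real.log (u t y))) x :=
      (hl t ht x hx).fderiv_right (by norm_cast; omega)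
    have h1 := norm_iteratedFDeriv_clm_apply_const (c := (EuclideanSpace.single i 1 : E d)) hfd le_rfl
    rw [norm_iteratedFDeriv_fderiv] at h1
    simp only [PiLp.norm_single, norm_one, one_mul] at h1
    rw [zero_add]
    exact mul_le_mul_of_nonneg_left h1 (by positivity)

lemma singleton (h : IsRegularSolution n α σ I u) (hI : IsOpen I) (hd : 2 ≤ d) (hn : (d : ℝ) < n)
    (hα : 0 < α) (hσ : 0 < σ) (ht : t ∈ I) : Reg n α σ {t} u :=
  h.reg hI hd hn hα hσ (by simpa using ht) isCompact_singleton

lemma hasDerivAt_density (h : IsRegularSolution n α σ I u) (hI : IsOpen I) (hd : 2 ≤ d)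
    (hn : (d : ℝ) < n) (hα : 0 < α) (hσ : 0 < σ) (ht : t ∈ I) (hx : x ≠ 0) :
    HasDerivAt (fun s => u s x) (u t x * vel n α σ (u t) x) t := by
  have hR := h.singleton hI hd hn hα hσ ht
  have hu := hR.smooth_of_le (mem_singleton t) (k := 1) (by norm_num)
  have h1 := h.equation t ht x hx
  rw [DaStar_smul hu ((hR.flux_smooth (mem_singleton t)).mono (by norm_num)) hx,
    Da_log hu (h.pos t ht x hx) hx, real_inner_smul_left] at h1
  rw [vel]
  convert h1 using 1
  ring

lemma hasDerivAt_pd_log (h : IsRegularSolution n α σ I u) (hI : IsOpen I) (hd : 2 ≤ d)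
    (hn : (d : ℝ) < n) (hα : 0 < α) (hσ : 0 < σ) (ht : t ∈ I) (hx : x ≠ 0) (i : Fin d) :
    HasDerivAt (fun s => pd[i] (fun y => Real.log (u s y)) x) (pd[i] (vel n α σ (u t)) x) t := by
  have h1 : ContDiffAt ℝ 2 (fun z : ℝ × E d => Real.log (u z.1 z.2)) (t, x) :=
    ((h.contDiffAt hI ht hx).log (h.pos t ht x hx).ne').of_le (by norm_num)
  refine hasDerivAt_fderiv_slice h1 ?_ _
  filter_upwards [nhds_punct hx] with y hy
  have h2 := (h.hasDerivAt_density hI hd hn hα hσ ht hy).log (h.pos t ht y hy).ne'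
  rwa [mul_div_cancel_left₀ _ (h.pos t ht y hy).ne'] at h2

lemma hasDerivAt_flux (h : IsRegularSolution n α σ I u) (hI : IsOpen I) (hd : 2 ≤ d)
    (hn : (d : ℝ) < n) (hα : 0 < α) (hσ : 0 < σ) (ht : t ∈ I) (hx : x ≠ 0) (i : Fin d) :
    HasDerivAt (fun s => flux n α σ (u s) x i) (Da α (vel n α σ (u t)) x i) t := by
  have h1 : ∀ j : Fin d, HasDerivAt (fun s => pd[j] (fun y => Real.log (u s y)) x)
      (pd[j] (vel n α σ (u t)) x) t := fun j => h.hasDerivAt_pd_log hI hd hn hα hσ ht hx j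
  have h2 : HasDerivAt (fun s => (pd[i] (fun y => Real.log (u s y)) x
      + (α - 1) * (∑ j, dir x j * pd[j] (fun y => Real.log (u s y)) x) * dir x i)
      + 2 * σ / α * x i)
      (Da α (vel n α σ (u t)) x i) t := by
    rw [Da_apply, radial_eq_sum_dir]
    exact ((h1 i).add (((HasDerivAt.fun_sum fun j _ => (h1 j).const_mul (dir x j)).const_mul
      (α - 1)).mul_const (dir x i))).add_const _
  refine h2.congr_of_eventuallyEq ?_
  filter_upwards [hI.mem_nhds ht] with s hs
  rw [(h.singleton hI hd hn hα hσ hs).flux_eq (mem_singleton s) hx, PiLp.add_apply,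
    PiLp.smul_apply, Da_apply, radial_eq_sum_dir, smul_eq_mul]

lemma hasDerivAt_integrand (h : IsRegularSolution n α σ I u) (hI : IsOpen I) (hd : 2 ≤ d)
    (hn : (d : ℝ) < n) (hα : 0 < α) (hσ : 0 < σ) (ht : t ∈ I) (hx : x ≠ 0) :
    HasDerivAt (fun s => u s x * ‖flux n α σ (u s) x‖ ^ 2) (u t x * Reg.rate n α σ (u t) x) t := by
  have h1 := h.hasDerivAt_density hI hd hn hα hσ ht hx
  have h2 : HasDerivAt (fun s => ‖flux n α σ (u s) x‖ ^ 2)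
      (2 * ⟪flux n α σ (u t) x, Da α (vel n α σ (u t)) x⟫) t := by
    have h3 := HasDerivAt.fun_sum (u := Finset.univ) fun (i : Fin d) _ =>
      (h.hasDerivAt_flux hI hd hn hα hσ ht hx i).fun_pow 2
    have e : (fun s => ‖flux n α σ (u s) x‖ ^ 2) = fun s => ∑ i, flux n α σ (u s) x i ^ 2 := by
      ext s
      rw [← real_inner_self_eq_norm_sq, inner_eq_sum]
      exact Finset.sum_congr rfl fun i _ => (sq _).symm
    rw [e, inner_eq_sum, Finset.mul_sum]
    refine h3.congr_deriv (Finset.sum_congr rfl fun i _ => ?_)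
    push_cast
    ring
  refine (h1.fun_mul h2).congr_deriv ?_
  simp only [Reg.rate]
  ring

/-- Decay of the Fisher information along the flow. -/
theorem exists_hasDerivAt_fisher (h : IsRegularSolution n α σ I u) (hI : IsOpen I) (hd : 2 ≤ d)
    (hn : (d : ℝ) < n) (hα : 0 < α) (hσ : 0 < σ) (hα' : α ≤ alphaFS d n) (ht : t ∈ I) :
    ∃ D : ℝ, HasDerivAt (fun s => fisher n α σ (u s)) D t ∧ D ≤ -(4 * σ) * fisher n α σ (u t) := by
  obtain ⟨ε, hε, hb⟩ := Metric.nhds_basis_closedBall.mem_iff.1 (hI.mem_nhds ht)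
  have hR := h.reg hI hd hn hα hσ hb (isCompact_closedBall t ε)
  have htJ : t ∈ Metric.closedBall t ε := Metric.mem_closedBall_self hε.le
  have hnhds : Metric.closedBall t ε ∈ nhds t := Metric.closedBall_mem_nhds t hε
  -- A compact time interval around `t` makes the symbol bounds uniform, so a single integrable
  -- majorant serves for all nearby times.
  obtain ⟨g, hg, hbound⟩ := hR.dec.exists_integrable_bound hR.hd0 hR.hn2 hR.pos hR.rate_bounds.bd
  have i0 : ∀ s ∈ Metric.closedBall t ε,
      Integrable (fun x => u s x * ‖flux n α σ (u s) x‖ ^ 2) (mu d n) :=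
    fun s hs => by
      have := hR.integrable hR.fisher_bounds hs
      exact this
  have ir := hR.integrable hR.rate_bounds htJ
  have key := hasDerivAt_integral_of_dominated_loc_of_deriv_le (μ := mu d n) (𝕜 := ℝ)
    (F := fun s x => u s x * ‖flux n α σ (u s) x‖ ^ 2)
    (F' := fun s x => u s x * Reg.rate n α σ (u s) x) (bound := g) hnhds
    (by filter_upwards [hnhds] with s hs using (i0 s hs).aestronglyMeasurable)
    (i0 t htJ) ir.aestronglyMeasurable
    (by filter_upwards [ae_mu_ne_zero hR.hd0] with x hx s hs using hbound s hs x hx) hg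
    (by
      filter_upwards [ae_mu_ne_zero hR.hd0] with x hx s hs
      exact h.hasDerivAt_integrand hI hd hn hα hσ (hb hs) hx)
  exact ⟨_, key.2, hR.integral_rate_le hα' htJ⟩

end IsRegularSolution

lemma alphaFS_lt_one (hd : 2 ≤ d) (hn : (d : ℝ) < n) : alphaFS d n < 1 := by
  have hd2 : (2 : ℝ) ≤ d := by exact_mod_cast hd
  rw [alphaFS, Real.sqrt_lt' one_pos, one_pow, div_lt_one (by linarith)]
  linarith

lemma fisher_nonneg (hd : 0 < d) (hpos : ∀ x : E d, x ≠ 0 → 0 < u t x) :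
    0 ≤ fisher n α σ (u t) := by
  refine integral_nonneg_of_ae ?_
  filter_upwards [ae_mu_ne_zero hd] with x hx
  have := hpos x hx
  simp only [Pi.zero_apply]
  positivity

end flow

end WLS

end

/-! ### Assembly of the four statements. -/

theorem lemma2p5 (d : ℕ) (hd : 2 ≤ d) (n : ℝ) (hn : (d : ℝ) < n) :
    -- the pointwise identity for `K[D_α p]`
    (∀ α : ℝ, 0 < α → ∀ p : WLS.E d → ℝ, ContDiffOn ℝ 3 p {0}ᶜ → ∀ x : WLS.E d, x ≠ 0 →
      WLS.K n α (WLS.Da α p) x =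
        α ^ 4 * (1 - 1 / n) *
            |WLS.radial (WLS.radial p) x - WLS.radial p x / ‖x‖
              - WLS.angLap p x / (α ^ 2 * (n - 1) * ‖x‖ ^ 2)| ^ 2
          + 2 * α ^ 2 / ‖x‖ ^ 2 *
            ‖WLS.angGrad (WLS.radial p) x - ‖x‖⁻¹ • WLS.angGrad p x‖ ^ 2
          + WLS.kSph n α p x / ‖x‖ ^ 4) ∧
    -- the integral estimate on the sphere
    (∃ δ : ℝ, 0 < δ ∧ ∀ α σ : ℝ, 0 < α → 0 < σ → ∀ u : WLS.E d → ℝ,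
      (∀ x, x ≠ 0 → 0 < u x) → ContDiffOn ℝ 3 u {0}ᶜ → ∀ r : ℝ, 0 < r →
      ∀ p : WLS.E d → ℝ, p = WLS.pressure n α σ u →
      (n - 2) * (WLS.alphaFS d n ^ 2 - α ^ 2) *
            ∫ ω, ‖WLS.angGrad p (r • ω.1)‖ ^ 2 * u (r • ω.1) ∂(WLS.dω d)
          + δ * ∫ ω, ‖WLS.angGrad p (r • ω.1)‖ ^ 4 * u (r • ω.1) ∂(WLS.dω d)
        ≤ ∫ ω, WLS.kSph n α p (r • ω.1) * u (r • ω.1) ∂(WLS.dω d)) ∧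
    -- the drift identity and the decay of the Fisher information along the flow
    (∀ α σ : ℝ, 0 < α → α ≤ WLS.alphaFS d n → (σ = α / 2 ∨ σ = 1 / 2) →
      ∀ I : Set ℝ, IsOpen I → ∀ u : ℝ → WLS.E d → ℝ, WLS.IsRegularSolution n α σ I u →
      ∀ t ∈ I, ∀ F : WLS.E d → WLS.E d, F = WLS.flux n α σ (u t) →
        Integrable (fun x => u t x * ‖F x‖ ^ 2) (WLS.mu d n) ∧
        Integrable (fun x => u t x * ⟪x, WLS.Da α (fun y => ‖F y‖ ^ 2) x⟫) (WLS.mu d n) ∧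
        Integrable (fun x => u t x * ⟪F x, WLS.Da α (fun y => ⟪F y, y⟫) x⟫) (WLS.mu d n) ∧
        (∫ x, u t x * ⟪x, WLS.Da α (fun y => ‖F y‖ ^ 2) x⟫ ∂(WLS.mu d n))
            - 2 * (∫ x, u t x * ⟪F x, WLS.Da α (fun y => ⟪F y, y⟫) x⟫ ∂(WLS.mu d n))
          = -2 * α * ∫ x, u t x * ‖F x‖ ^ 2 ∂(WLS.mu d n) ∧
        ∃ D : ℝ, HasDerivAt (fun s => WLS.fisher n α σ (u s)) D t ∧
          D ≤ -2 * α * WLS.fisher n α σ (u t)) := by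
  have hd2 : (2 : ℝ) ≤ d := by exact_mod_cast hd
  have hd0 : 0 < d := by omega
  refine ⟨fun α hα p hp x hx => WLS.K_Da (by linarith) hα (WLS.sp_iff.2 hp) hx, ?_, ?_⟩
  · obtain ⟨δ, hδ, H⟩ := WLS.exists_kSph_lower_bound hd hn
    refine ⟨δ, hδ, fun α σ hα hσ u hpos hu r hr p hp => ?_⟩
    have hu3 : WLS.SP 3 u := WLS.sp_iff.2 hu
    subst hp
    exact H α _ u (WLS.SP.pressure hd0 (by linarith) hα hσ hu3 hpos) (hu3.mono (by norm_num)) hpos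
      (WLS.logRot_pressure hd0 (by linarith) hα hσ (hu3.mono (by norm_num)) hpos) r hr
  · intro α σ hα hα' hσ' I hI u hu t ht F hF
    have hσ : 0 < σ := by rcases hσ' with rfl | rfl <;> linarith
    subst hF
    have hR := hu.singleton hI hd hn hα hσ ht
    have hm := mem_singleton t
    have i1 := hR.integrable hR.fisher_bounds hm
    have i2 := hR.integrable hR.drift_bounds hm
    have i3 := hR.integrable hR.flux_drift_bounds hm
    refine ⟨i1, i2, i3, hR.integral_drift hm, ?_⟩
    obtain ⟨D, hD, hle⟩ := hu.exists_hasDerivAt_fisher hI hd hn hα hσ hα' ht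
    refine ⟨D, hD, hle.trans ?_⟩
    have h0 := WLS.fisher_nonneg (n := n) (α := α) (σ := σ) hd0 (hu.pos t ht)
    have h1 := WLS.alphaFS_lt_one hd hn
    -- For `σ = α/2` this is an equality; for `σ = 1/2` it says `α ≤ 1`, which follows from `α ≤
    -- α_FS < 1`.
    have h2 : 2 * α ≤ 4 * σ := by rcases hσ' with rfl | rfl <;> linarith
    have := mul_le_mul_of_nonneg_right h2 h0
    linarith
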